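/- Conventions. For a Riemannian metric $g$ with Levi-Civita connection $\nabla$, let $R_{ijkl}=g_{kh}R^h_{ijl}$ with $R^h_{ijl}=\partial_i\Gamma^h_{jl}-\partial_j\Gamma^h_{il}+\Gamma^h_{ip}\Gamma^p_{jl}-\Gamma^h_{jp}\Gamma^p_{il}$ be the components of the curvature tensor $\mathrm{Rm}$, let $R_{ij}=g^{kl}R_{ikjl}$, let $\Delta=g^{ij}\nabla_i\nabla_j$, let $|T|^2=g^{i_1j_1}\cdots g^{i_kj_k}T_{i_1\cdots i_k}T_{j_1\cdots j_k}$ for a covariant $k$-tensor $T$, and let $\square_g=-(dd^*+d^*d)$ be the Laplace–Beltrami operator on differential forms, where $(d^*\alpha)_{i_1\cdots i_{p-1}}=-g^{jk}\nabla_j\alpha_{ki_1\cdots i_{p-1}}$. A solution of the generalized Ricci flow (GRF) on a compact $n$-dimensional manifold $M$ is a smooth family $(g(t),H(t))$, with $t$ in a nondegenerate interval, of Riemannian metrics and $3$-forms on $M$ such that $$\frac{\partial}{\partial t}g_{ij}=-2R_{ij}+\tfrac12 g^{kp}g^{lq}H_{ikl}H_{jpq},\qquad \frac{\partial}{\partial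 t}H=\square_{g(t)}H.$$ (Time derivatives at an endpoint of the interval are one-sided.) For covariant tensors $A$, $B$ we write $A*B$ for any linear combination of contractions with $g$ of $A\otimes B$ (after permutations of the indices), and similarly $A*B*D$ for $A\otimes B\otimes D$. In the formula below each schematic term has the rank of $\nabla^l\mathrm{Rm}$, and its coefficients depend only on $n$, $l$ and the term (that is, the values of $i,j,k$), not on $M$, $g$, $H$. Proposition 4.1 (with Corollary 4.2). Let $n$ and $l$ be nonnegative integers. For every solution of GRF on a compact $n$-dimensional manifold, $$\frac{\partial}{\partial t}\nabla^l\mathrm{Rm}=\Delta(\nabla^l\mathrm{Rm})+\sum_{i+j=l}\nabla^i\mathrm{Rm}*\nabla^j\mathrm{Rm}+\sum_{i+j+k=l}\nabla^iH*\nabla^jH*\nabla^k\mathrm{Rm}+\sum_{i+j=l+2}\nabla^iH*\nabla^jH .$$ Moreover there is a constant $C>0$ depending only on $n$ and $l$ such that, for every such solution, $$\begin{aligned}\frac{\partial}{\partial t}|\nabla^l\mathrm{Rm}|^2\le{}&\Delta|\nabla^l\mathrm{Rm}|^2-2|\nabla^{l+1}\mathrm{Rm}|^2+C\sum_{i+j=l}|\nabla^i\mathrm{Rm}|\,|\nabla^j\mathrm{Rm}|\,|\nabla^l\mathrm{Rm}|\\&+C\sum_{i+j+k=l}|\nabla^iH|\,|\nabla^jH|\,|\nabla^k\mathrm{Rm}|\,|\nabla^l\mathrm{Rm}|+C\sum_{i+j=l+2}|\nabla^iH|\,|\nabla^jH|\,|\nabla^l\mathrm{Rm}|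 .\end{aligned}$$ -/

import Mathlib

open scoped Manifold ContDiff

universe u

noncomputable section

/-! The model space, component arrays of covariant tensors and component fields.
Everything below is classical tensor calculus in a coordinate chart; all tensors are covariant. -/

/-- The model space of an `n`-dimensional manifold. -/
abbrev Coord (n : ℕ) : Type := EuclideanSpace ℝ (Fin n)

/-- The components `T_{i_1 ... i_k}` of a covariant `k`-tensor at a point. -/
abbrev Comp (n k : ℕ) : Type := (Fin k → Fin n) → ℝ

/-- The components of a covariant `k`-tensor field as functions of the coordinates. -/
abbrev CompField (n k : ℕ) : Type := Coord n → Comp n k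

/-- The components `g_{ij}` of a metric as functions of the coordinates. -/
abbrev MetricField (n : ℕ) : Type := Coord n → Matrix (Fin n) (Fin n) ℝ

/-- The partial derivative `∂_i f`. -/
def pderiv {n : ℕ} (i : Fin n) (f : Coord n → ℝ) (y : Coord n) : ℝ :=
  fderiv ℝ f y (EuclideanSpace.single i 1)

/-- The Christoffel symbol
`Γ^m_{ij} = (1/2) g^{mp} (∂_i g_{jp} + ∂_j g_{ip} - ∂_p g_{ij})`. -/
def christoffel {n : ℕ} (g : MetricField n) (m i j : Fin n) (y : Coord n) : ℝ :=
  (1 / 2) * ∑ p, (g y)⁻¹ m p *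
    (pderiv i (fun z => g z j p) y + pderiv j (fun z => g z i p) y
      - pderiv p (fun z => g z i j) y)

/-- The covariant derivative of a covariant tensor; the new index comes first:
`∇_i T_{j_1 ... j_k} = ∂_i T_{j_1 ... j_k} - ∑_s Γ^m_{i j_s} T_{j_1 ... m ... j_k}`. -/
def covDeriv {n k : ℕ} (g : MetricField n) (T : CompField n k) : CompField n (k + 1) :=
  fun y I =>
    pderiv (I 0) (fun z => T z (Fin.tail I)) y
      - ∑ s : Fin k, ∑ m : Fin n,
          christoffel g m (I 0) (Fin.tail I s) y * T y (Function.update (Fin.tail I) s m)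

/-- The iterated covariant derivative `∇^l T`. -/
def covDerivIter {n k : ℕ} (g : MetricField n) (T : CompField n k) :
    (l : ℕ) → CompField n (k + l)
  | 0 => T
  | l + 1 => covDeriv g (covDerivIter g T l)

/-- The Laplacian `Δ T = g^{ij} ∇_i ∇_j T` of a tensor field. -/
def tensorLaplacian {n k : ℕ} (g : MetricField n) (T : CompField n k) : CompField n k :=
  fun y I => ∑ i, ∑ j, (g y)⁻¹ i j * covDeriv g (covDeriv g T) y (Fin.cons i (Fin.cons j I))

/-- The Laplacian of a function, regarded as a tensor field of rank `0`. -/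
def scalarLaplacian {n : ℕ} (g : MetricField n) (f : Coord n → ℝ) (y : Coord n) : ℝ :=
  tensorLaplacian g (fun z (_ : Fin 0 → Fin n) => f z) y Fin.elim0

/-- The curvature components
`R_{ijl}^h = ∂_i Γ^h_{jl} - ∂_j Γ^h_{il} + Γ^h_{ip} Γ^p_{jl} - Γ^h_{jp} Γ^p_{il}`. -/
def riemannUp {n : ℕ} (g : MetricField n) (h i j l : Fin n) (y : Coord n) : ℝ :=
  pderiv i (christoffel g h j l) y - pderiv j (christoffel g h i l) y
    + ∑ p, (christoffel g h i p y * christoffel g p j l y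
        - christoffel g h j p y * christoffel g p i l y)

/-- The Riemann tensor `R_{ijkl} = g_{kh} R_{ijl}^h`, with the sign for which
`R_{ij} = g^{kl} R_{ikjl}` is the (positive) Ricci tensor of a round sphere. -/
def riemannTensor {n : ℕ} (g : MetricField n) : CompField n 4 :=
  fun y I => ∑ h, g y (I 2) h * riemannUp g h (I 0) (I 1) (I 3) y

/-- The Ricci tensor `R_{ij} = g^{kl} R_{ikjl}`. -/
def ricciTensor {n : ℕ} (g : MetricField n) (y : Coord n) (i j : Fin n) : ℝ :=
  ∑ k, ∑ l, (g y)⁻¹ k l * riemannTensor g y ![i, k, j, l]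

/-- `h_{ij} = H_{ikl} H_j^{kl} = g^{kp} g^{lq} H_{ikl} H_{jpq}`. -/
def formSquare {n : ℕ} (g : MetricField n) (H : CompField n 3) (y : Coord n)
    (i j : Fin n) : ℝ :=
  ∑ k, ∑ l, ∑ p, ∑ q,
    (g y)⁻¹ k p * (g y)⁻¹ l q * H y ![i, k, l] * H y ![j, p, q]

/-- The exterior derivative in components:
`(dα)_{i_0 ... i_k} = ∑_s (-1)^s ∂_{i_s} α_{i_0 ... (omit i_s) ... i_k}`. -/
def extDer {n k : ℕ} (α : CompField n k) : CompField n (k + 1) :=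
  fun y I => ∑ s : Fin (k + 1),
    (-1 : ℝ) ^ (s : ℕ) * pderiv (I s) (fun z => α z (fun r => I (s.succAbove r))) y

/-- The formal adjoint of `d` with respect to `g`:
`(d^* α)_{i_1 ... i_k} = - g^{jm} ∇_j α_{m i_1 ... i_k}`. -/
def codiff {n k : ℕ} (g : MetricField n) (α : CompField n (k + 1)) : CompField n k :=
  fun y I => - ∑ j, ∑ m, (g y)⁻¹ j m * covDeriv g α y (Fin.cons j (Fin.cons m I))

/-- The Laplace-Beltrami operator `□ = -(d d^* + d^* d)` on forms of positive degree. -/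
def hodgeBox {n k : ℕ} (g : MetricField n) (α : CompField n (k + 1)) : CompField n (k + 1) :=
  fun y I => - (extDer (codiff g α) y I + codiff g (extDer α) y I)

/-! Norms and schematic products; here `gi` is the matrix `g^{ij}` at the point. -/

/-- `|T|^2 = g^{i_1 j_1} ... g^{i_k j_k} T_{i_1 ... i_k} T_{j_1 ... j_k}`. -/
def normSq {n k : ℕ} (gi : Matrix (Fin n) (Fin n) ℝ) (T : Comp n k) : ℝ :=
  ∑ I : Fin k → Fin n, ∑ J : Fin k → Fin n, (∏ s, gi (I s) (J s)) * T I * T J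

/-- `|T|`. -/
def tensorNorm {n k : ℕ} (gi : Matrix (Fin n) (Fin n) ℝ) (T : Comp n k) : ℝ :=
  Real.sqrt (normSq gi T)

/-- The tensor product `A ⊗ B`. -/
def tensorMul {n a b : ℕ} (A : Comp n a) (B : Comp n b) : Comp n (a + b) :=
  fun I => A (fun s => I (Fin.castAdd b s)) * B (fun s => I (Fin.natAdd a s))

/-- A contraction pattern: it matches the `a` slots of a tensor bijectively with `r` free
slots and `p` pairs of slots `(q, false)`, `(q, true)` that are to be contracted.
It exists only if `a = r + 2 p`. -/
abbrev Pattern (a r p : ℕ) : Type := Fin a ≃ Fin r ⊕ (Fin p × Bool)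

/-- The rank `r` tensor obtained from `T` by contracting, with `g^{ij}`, the `p` pairs of slots
given by the pattern `π`, the other slots being permuted as `π` says. -/
def contractAlong {n a r p : ℕ} (gi : Matrix (Fin n) (Fin n) ℝ) (π : Pattern a r p)
    (T : Comp n a) : Comp n r :=
  fun I => ∑ v : Fin p × Bool → Fin n,
    (∏ q : Fin p, gi (v (q, false)) (v (q, true))) * T (fun s => Sum.elim I v (π s))

/-- The linear combination, with coefficients `c`, of all contractions of `T`.
For `T = A ⊗ B` this is a tensor of the schematic type `A ∗ B`, and for `T = A ⊗ B ⊗ D` one of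
the type `A ∗ B ∗ D`. -/
def contractComb {n a r p : ℕ} (gi : Matrix (Fin n) (Fin n) ℝ) (c : Pattern a r p → ℝ)
    (T : Comp n a) : Comp n r :=
  fun I => ∑ π : Pattern a r p, c π * contractAlong gi π T I

/-! The manifold: components in a chart, and the flow. -/

section Manifold

variable {n : ℕ} {M : Type u} [TopologicalSpace M] [ChartedSpace (Coord n) M]

/-- The coordinate vector `∂/∂y^i` of the chart `e`, at the point with coordinates `y`. -/
def coordVector (e : OpenPartialHomeomorph M (Coord n)) (y : Coord n) (i : Fin n) :
    TangentSpace 𝓘(ℝ, Coord n) (e.symm y) :=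
  mfderiv 𝓘(ℝ, Coord n) 𝓘(ℝ, Coord n) e.symm y (EuclideanSpace.single i (1 : ℝ) : Coord n)

/-- A smooth Riemannian metric on `M`. -/
abbrev SmoothMetric (n : ℕ) (M : Type u) [TopologicalSpace M] [ChartedSpace (Coord n) M]
    [IsManifold 𝓘(ℝ, Coord n) ∞ M] : Type u :=
  Bundle.ContMDiffRiemannianMetric 𝓘(ℝ, Coord n) ∞ (Coord n)
    (fun x : M => TangentSpace 𝓘(ℝ, Coord n) x)

/-- A (not necessarily smooth) field of alternating `3`-linear forms on the tangent spaces. -/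
abbrev ThreeForm (n : ℕ) (M : Type u) [TopologicalSpace M] [ChartedSpace (Coord n) M] : Type u :=
  (x : M) → TangentSpace 𝓘(ℝ, Coord n) x [⋀^Fin 3]→ₗ[ℝ] ℝ

/-- The components `g_{ij}` of a metric in a chart. -/
def metricIn [IsManifold 𝓘(ℝ, Coord n) ∞ M] (g : SmoothMetric n M)
    (e : OpenPartialHomeomorph M (Coord n)) : MetricField n :=
  fun y => Matrix.of fun i j => g.inner (e.symm y) (coordVector e y i) (coordVector e y j)

/-- The components `H_{ijk}` of a `3`-form in a chart. -/
def formIn (H : ThreeForm n M) (e : OpenPartialHomeomorph M (Coord n)) : CompField n 3 :=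
  fun y I => H (e.symm y) (fun s => coordVector e y (I s))

/-- `(g(t), H(t))`, `t ∈ J`, is a smooth solution of the generalized Ricci flow
`∂_t g_{ij} = -2 R_{ij} + (1/2) H_{ikl} H_j^{kl}`, `∂_t H = □_{g(t)} H`.
The equations are required in all smooth charts; time derivatives at an endpoint of the
interval `J` are one-sided, and only the values for `t ∈ J` matter. -/
structure IsGRF [IsManifold 𝓘(ℝ, Coord n) ∞ M] (J : Set ℝ) (g : ℝ → SmoothMetric n M)
    (H : ℝ → ThreeForm n M) : Prop where
  smooth_metric : ∀ e ∈ IsManifold.maximalAtlas 𝓘(ℝ, Coord n) ∞ M, ∀ i j : Fin n,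
    ContDiffOn ℝ ∞ (fun q : ℝ × Coord n => metricIn (g q.1) e q.2 i j) (J ×ˢ e.target)
  smooth_form : ∀ e ∈ IsManifold.maximalAtlas 𝓘(ℝ, Coord n) ∞ M, ∀ I : Fin 3 → Fin n,
    ContDiffOn ℝ ∞ (fun q : ℝ × Coord n => formIn (H q.1) e q.2 I) (J ×ˢ e.target)
  evolve_metric : ∀ e ∈ IsManifold.maximalAtlas 𝓘(ℝ, Coord n) ∞ M, ∀ t ∈ J, ∀ y ∈ e.target,
    ∀ i j : Fin n, HasDerivWithinAt (fun s => metricIn (g s) e y i j)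
      (-2 * ricciTensor (metricIn (g t) e) y i j
        + 1 / 2 * formSquare (metricIn (g t) e) (formIn (H t) e) y i j) J t
  evolve_form : ∀ e ∈ IsManifold.maximalAtlas 𝓘(ℝ, Coord n) ∞ M, ∀ t ∈ J, ∀ y ∈ e.target,
    ∀ I : Fin 3 → Fin n, HasDerivWithinAt (fun s => formIn (H s) e y I)
      (hodgeBox (metricIn (g t) e) (formIn (H t) e) y I) J t

/-- The components of `∇^l Rm` in a chart. -/
def nablaRm [IsManifold 𝓘(ℝ, Coord n) ∞ M] (g : SmoothMetric n M)
    (e : OpenPartialHomeomorph M (Coord n)) (l : ℕ) : CompField n (4 + l) :=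
  covDerivIter (metricIn g e) (riemannTensor (metricIn g e)) l

/-- The components of `∇^l H` in a chart. -/
def nablaH [IsManifold 𝓘(ℝ, Coord n) ∞ M] (g : SmoothMetric n M) (H : ThreeForm n M)
    (e : OpenPartialHomeomorph M (Coord n)) (l : ℕ) : CompField n (3 + l) :=
  covDerivIter (metricIn g e) (formIn H e) l

end Manifold

end

/-! The claim is local, so a solution is studied in one chart, as a `LocalFlow`. Put v = -2 Ric +
h/2 with h_{ij} = H_{ikl} H_j^{kl}, the time derivative of g. The variation of Γ is linear in ∇v,
and the variation of Rm is linear in ∇∇v up to a term v ∗ Rm (`hasDeriv_christoffel`,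
`hasDeriv_riemannTensor`). The part ∇∇h is of type ∇^iH ∗ ∇^jH with i + j = 2. One pair of second
derivatives of v is a commutator; in the other four, the Ricci part equals Δ Rm up to commutators,
by two uses of the second Bianchi identity and the pair symmetry (`laplacian_riemannTensor`). The
Ricci identity turns every commutator into a contraction with Rm. This settles l = 0
(`exists_evolution_curvature`).

The step from l to l + 1 applies ∇. Time differentiation fails to commute with ∇ by ∂_tΓ acting on
∇^l Rm, that is by ∇v ∗ ∇^l Rm, and Δ fails to commute with ∇ by terms Rm ∗ ∇^{l+1} Rm and ∇(Rm ∗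
∇^l Rm) (`cov_laplacian`). The Leibniz rule shows that ∇ raises the total order of every error type
by exactly one (`cov_errorTypes`), which closes the induction (`exists_evolution_curvField`).

For |∇^l Rm|^2, the formula Δ|T|^2 = 2⟨ΔT, T⟩ + 2|∇T|^2 (`scalarLaplacian_pairing_self`) produces
the good term -2|∇^{l+1} Rm|^2. The time derivative of the inverse metric adds one more error v ∗
∇^l Rm. The Cauchy-Schwarz inequality and a bound for contractions finish the estimate.

The delicate point is that coefficients and constants may not depend on the solution. Schematic
terms are therefore values of operators built from renaming of slots, traces with the inverse metric
and linear combinations (`IsContr`), and such an operator is always chosen before the solution, the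
time and the point. Structural induction shows that these operators are compatible with tensor
products (`tmul_left`), commute with ∇ because the metric is parallel (`exists_cov`), are bounded
with respect to the norms (`exists_bound`), and are combinations of contraction patterns
(`eq_contractComb`). `Schematic` is the resulting calculus of error terms. Using arbitrary index
types for slots, with `Option` adding one slot, avoids arithmetic with ranks until the very end. -/

noncomputable section

/-! Component arrays over arbitrary index types, and natural contraction operators. -/

/-- Arrays of real numbers whose slots are indexed by `ι`. -/
abbrev Arr (n : ℕ) (ι : Type) : Type := (ι → Fin n) → ℝ

/-- Linear operators on arrays that depend on the inverse metric at the point. -/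
abbrev MOp (n : ℕ) (ι κ : Type) : Type := Matrix (Fin n) (Fin n) ℝ → Arr n ι → Arr n κ

/-- Prepend an index value in the slot `none`. -/
def icons {n : ℕ} {ι : Type} (a : Fin n) (I : ι → Fin n) : Option ι → Fin n := fun o => o.elim a I

@[simp] theorem icons_none {n : ℕ} {ι : Type} (a : Fin n) (I : ι → Fin n) : icons a I none = a := rfl
@[simp] theorem icons_some {n : ℕ} {ι : Type} (a : Fin n) (I : ι → Fin n) (s : ι) :
    icons a I (some s) = I s := rfl

theorem icons_eta {n : ℕ} {ι : Type} (J : Option ι → Fin n) : icons (J none) (J ∘ some) = J := by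
  funext o; cases o <;> rfl

/-- Contract the first two slots with the inverse metric. -/
def ctr {n : ℕ} {ι : Type} (gi : Matrix (Fin n) (Fin n) ℝ) (T : Arr n (Option (Option ι))) :
    Arr n ι :=
  fun I => ∑ a, ∑ b, gi a b * T (icons a (icons b I))

/-- Rename the slots of an array. -/
def reindex {n : ℕ} {ι κ : Type} (e : ι ≃ κ) (T : Arr n ι) : Arr n κ := fun I => T (I ∘ e)

/-- The tensor product of two arrays. -/
def tmul {n : ℕ} {ι κ : Type} (A : Arr n ι) (B : Arr n κ) : Arr n (ι ⊕ κ) :=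
  fun I => A (I ∘ Sum.inl) * B (I ∘ Sum.inr)

/-- The operators generated by renaming of slots, contraction and linear combinations. -/
inductive IsContr {n : ℕ} {ι : Type} : ∀ {κ : Type}, MOp n ι κ → Prop
  | id : IsContr (fun _ T => T)
  | reindex {κ κ' : Type} {Φ : MOp n ι κ} (e : κ ≃ κ') :
      IsContr Φ → IsContr (fun gi T => reindex e (Φ gi T))
  | ctr {κ : Type} {Φ : MOp n ι (Option (Option κ))} :
      IsContr Φ → IsContr (fun gi T => ctr gi (Φ gi T))
  | zero {κ : Type} : IsContr (fun _ _ => (0 : Arr n κ))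
  | add {κ : Type} {Φ Ψ : MOp n ι κ} :
      IsContr Φ → IsContr Ψ → IsContr (fun gi T => Φ gi T + Ψ gi T)
  | smul {κ : Type} {Φ : MOp n ι κ} (c : ℝ) : IsContr Φ → IsContr (fun gi T => c • Φ gi T)

namespace IsContr

variable {n : ℕ} {ι κ μ : Type}

theorem comp {Φ : MOp n ι κ} {Ψ : MOp n κ μ} (hΨ : IsContr Ψ) (hΦ : IsContr Φ) :
    IsContr (fun gi T => Ψ gi (Φ gi T)) := by
  induction hΨ with
  | id => exact hΦ
  | reindex e _ ih => exact ih.reindex e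
  | ctr _ ih => exact ih.ctr
  | zero => exact .zero
  | add _ _ ih₁ ih₂ => exact ih₁.add ih₂
  | smul c _ ih => exact ih.smul c

theorem sum {α : Type*} (s : Finset α) {Φ : α → MOp n ι κ} (h : ∀ a ∈ s, IsContr (Φ a)) :
    IsContr (fun gi T => ∑ a ∈ s, Φ a gi T) := by
  classical
  induction s using Finset.induction_on with
  | empty => simpa using .zero
  | insert a s ha ih =>
    simp only [Finset.sum_insert ha]
    exact (h a (Finset.mem_insert_self a s)).add
      (ih fun b hb => h b (Finset.mem_insert_of_mem hb))

theorem neg {Φ : MOp n ι κ} (h : IsContr Φ) : IsContr (fun gi T => - Φ gi T) := by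
  simpa using h.smul (-1)

theorem map_add {Φ : MOp n ι κ} (h : IsContr Φ) (gi : Matrix (Fin n) (Fin n) ℝ) (A B : Arr n ι) :
    Φ gi (A + B) = Φ gi A + Φ gi B := by
  induction h with
  | id => rfl
  | reindex e _ ih => simp only [ih]; rfl
  | ctr _ ih =>
    funext I
    simp only [ih, _root_.ctr, Pi.add_apply, mul_add, Finset.sum_add_distrib]
  | zero => simp
  | add _ _ ih₁ ih₂ => simp only [ih₁, ih₂]; abel
  | smul c _ ih => simp only [ih, smul_add]

theorem map_smul {Φ : MOp n ι κ} (h : IsContr Φ) (gi : Matrix (Fin n) (Fin n) ℝ) (r : ℝ)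
    (A : Arr n ι) : Φ gi (r • A) = r • Φ gi A := by
  induction h with
  | id => rfl
  | reindex e _ ih => simp only [ih]; rfl
  | ctr _ ih =>
    funext I
    simp only [ih, _root_.ctr, Pi.smul_apply, smul_eq_mul, Finset.mul_sum]
    exact Finset.sum_congr rfl fun a _ => Finset.sum_congr rfl fun b _ => by ring
  | zero => simp
  | add _ _ ih₁ ih₂ => simp only [ih₁, ih₂, smul_add]
  | smul c _ ih => simp only [ih, smul_comm r c]

theorem map_zero {Φ : MOp n ι κ} (h : IsContr Φ) (gi : Matrix (Fin n) (Fin n) ℝ) :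
    Φ gi 0 = 0 := by
  simpa using h.map_smul gi 0 0

end IsContr

/-! Reassociation of slots. -/

/-- Move a slot of the left factor to the front of the product. -/
def optionSumLeft (ι κ : Type) : Option ι ⊕ κ ≃ Option (ι ⊕ κ) where
  toFun
    | .inl none => none
    | .inl (some s) => some (.inl s)
    | .inr s => some (.inr s)
  invFun
    | none => .inl none
    | some (.inl s) => .inl (some s)
    | some (.inr s) => .inr s
  left_inv := by rintro ((_ | s) | s) <;> rfl
  right_inv := by rintro (_ | s | s) <;> rfl

/-- Move a slot of the right factor to the front of the product. -/
def optionSumRight (ι κ : Type) : ι ⊕ Option κ ≃ Option (ι ⊕ κ) where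
  toFun
    | .inr none => none
    | .inl s => some (.inl s)
    | .inr (some s) => some (.inr s)
  invFun
    | none => .inr none
    | some (.inl s) => .inl s
    | some (.inr s) => .inr (some s)
  left_inv := by rintro (s | (_ | s)) <;> rfl
  right_inv := by rintro (_ | s | s) <;> rfl

/-- Exchange the first two slots. -/
def optionSwap (ι : Type) : Option (Option ι) ≃ Option (Option ι) where
  toFun
    | none => some none
    | some none => none
    | some (some s) => some (some s)
  invFun
    | none => some none
    | some none => none
    | some (some s) => some (some s)
  left_inv := by rintro (_ | _ | s) <;> rfl
  right_inv := by rintro (_ | _ | s) <;> rfl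

theorem icons_optionSwap {n : ℕ} {ι : Type} (a b : Fin n) (I : ι → Fin n) :
    icons a (icons b I) ∘ optionSwap ι = icons b (icons a I) := by
  funext o; rcases o with _ | _ | s <;> rfl

/-- Move the first slot behind the next two slots. -/
def optionRotate (ι : Type) : Option (Option (Option ι)) ≃ Option (Option (Option ι)) where
  toFun
    | none => some (some none)
    | some none => none
    | some (some none) => some none
    | some (some (some s)) => some (some (some s))
  invFun
    | none => some none
    | some none => some (some none)
    | some (some none) => none
    | some (some (some s)) => some (some (some s))
  left_inv := by rintro (_ | _ | _ | s) <;> rfl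
  right_inv := by rintro (_ | _ | _ | s) <;> rfl

theorem icons_optionRotate {n : ℕ} {ι : Type} (a b c : Fin n) (I : ι → Fin n) :
    icons a (icons b (icons c I)) ∘ optionRotate ι = icons c (icons a (icons b I)) := by
  funext o; rcases o with _ | _ | _ | s <;> rfl

theorem icons_optionCongr {n : ℕ} {ι κ : Type} (a : Fin n) (I : κ → Fin n) (e : ι ≃ κ) :
    icons a I ∘ e.optionCongr = icons a (I ∘ e) := by
  funext o; rcases o with _ | s <;> rfl

/-! ### Contractions inside one factor of a product. -/

namespace IsContr

variable {n : ℕ} {ι κ μ : Type}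

/-- A contraction that touches only the slots of one factor can be carried out after tensoring with
the other factor. The lifted operator is fixed before the metric and the arrays, so coefficients
stay universal. -/
theorem tmul_left {Φ : MOp n ι κ} (h : IsContr Φ) (μ : Type) :
    ∃ Φ' : MOp n (ι ⊕ μ) (κ ⊕ μ), IsContr Φ' ∧
      ∀ gi A (B : Arr n μ), tmul (Φ gi A) B = Φ' gi (tmul A B) := by
  induction h with
  | id => exact ⟨_, .id, fun _ _ _ => rfl⟩
  | reindex e _ ih =>
    obtain ⟨Φ', h', H⟩ := ih
    refine ⟨_, h'.reindex (e.sumCongr (Equiv.refl μ)), fun gi A B => ?_⟩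
    rw [← H]; rfl
  | @ctr κ Φ _ ih =>
    obtain ⟨Φ', h', H⟩ := ih
    refine ⟨_, (h'.reindex ((optionSumLeft (Option κ) μ).trans
      (optionSumLeft κ μ).optionCongr)).ctr, fun gi A B => ?_⟩
    rw [← H]
    funext I
    simp only [_root_.ctr, tmul, _root_.reindex, Finset.sum_mul, mul_assoc]
    refine Finset.sum_congr rfl fun a _ => Finset.sum_congr rfl fun b _ => ?_
    congr 3
    funext o; rcases o with _ | _ | s <;> rfl
  | zero => exact ⟨_, .zero, fun _ _ _ => by funext I; simp [tmul]⟩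
  | add _ _ ih₁ ih₂ =>
    obtain ⟨Φ₁, h₁, H₁⟩ := ih₁
    obtain ⟨Φ₂, h₂, H₂⟩ := ih₂
    refine ⟨_, h₁.add h₂, fun gi A B => ?_⟩
    rw [← H₁, ← H₂]; funext I; simp [tmul, add_mul]
  | smul c _ ih =>
    obtain ⟨Φ', h', H⟩ := ih
    refine ⟨_, h'.smul c, fun gi A B => ?_⟩
    rw [← H]; funext I; simp [tmul, mul_assoc]

theorem tmul_comm_eq (A : Arr n ι) (B : Arr n κ) :
    tmul A B = _root_.reindex (Equiv.sumComm κ ι) (tmul B A) := by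
  funext I; exact mul_comm _ _

end IsContr

/-! Contraction patterns. -/

/-- Contraction along a pattern, for arbitrary slot types. -/
def contrAlong {n p : ℕ} {ι κ : Type} (gi : Matrix (Fin n) (Fin n) ℝ)
    (π : ι ≃ κ ⊕ (Fin p × Bool)) (T : Arr n ι) : Arr n κ :=
  fun I => ∑ v : Fin p × Bool → Fin n,
    (∏ q : Fin p, gi (v (q, false)) (v (q, true))) * T (fun s => Sum.elim I v (π s))

/-- Turn the first two free slots into a contracted pair. -/
def pairFirst (κ : Type) (p : ℕ) :
    Option (Option κ) ⊕ (Fin p × Bool) ≃ κ ⊕ (Fin (p + 1) × Bool) where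
  toFun
    | .inl none => .inr (0, false)
    | .inl (some none) => .inr (0, true)
    | .inl (some (some k)) => .inl k
    | .inr (q, b) => .inr (q.succ, b)
  invFun
    | .inl k => .inl (some (some k))
    | .inr (q, b) => Fin.cases (motive := fun _ => Option (Option κ) ⊕ (Fin p × Bool))
        (.inl (if b then some none else none)) (fun q => .inr (q, b)) q
  left_inv := by rintro ((_ | _ | k) | ⟨q, b⟩) <;> rfl
  right_inv := by
    rintro (k | ⟨q, b⟩)
    · rfl
    · refine Fin.cases ?_ (fun q => ?_) q
      · cases b <;> rfl
      · rfl

/-- Split off the values on the first pair of slots. -/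
def splitPair (n p : ℕ) :
    (Fin (p + 1) × Bool → Fin n) ≃ Fin n × Fin n × (Fin p × Bool → Fin n) where
  toFun v := (v (0, false), v (0, true), fun x => v (x.1.succ, x.2))
  invFun w := fun x => Fin.cases (motive := fun _ => Fin n)
    (if x.2 then w.2.1 else w.1) (fun q => w.2.2 (q, x.2)) x.1
  left_inv v := by
    funext ⟨q, b⟩
    refine Fin.cases ?_ (fun q => ?_) q
    · cases b <;> rfl
    · rfl
  right_inv w := rfl

/-- A further trace is absorbed by the pattern: the two leading free slots become the pair with
number 0 and the old pairs are shifted by one. -/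
theorem ctr_contrAlong {n p : ℕ} {ι κ : Type} (gi : Matrix (Fin n) (Fin n) ℝ)
    (π : ι ≃ Option (Option κ) ⊕ (Fin p × Bool)) (T : Arr n ι) :
    ctr gi (contrAlong gi π T) = contrAlong gi (π.trans (pairFirst κ p)) T := by
  funext I
  simp only [ctr, contrAlong, Finset.mul_sum]
  rw [← (splitPair n p).symm.sum_comp, Fintype.sum_prod_type]
  refine Finset.sum_congr rfl fun a _ => ?_
  rw [Fintype.sum_prod_type]
  refine Finset.sum_congr rfl fun b _ => Finset.sum_congr rfl fun v _ => ?_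
  rw [Fin.prod_univ_succ, ← mul_assoc]
  congr 2
  funext s
  simp only [Equiv.trans_apply]
  rcases π s with (_ | _ | k) | ⟨q, b⟩ <;> rfl

theorem reindex_contrAlong {n p : ℕ} {ι κ κ' : Type} (gi : Matrix (Fin n) (Fin n) ℝ)
    (π : ι ≃ κ ⊕ (Fin p × Bool)) (e : κ ≃ κ') (T : Arr n ι) :
    reindex e (contrAlong gi π T)
      = contrAlong gi (π.trans (e.sumCongr (Equiv.refl _))) T := by
  funext I
  simp only [reindex, contrAlong, Equiv.trans_apply]
  refine Finset.sum_congr rfl fun v _ => ?_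
  congr 2
  funext s
  rcases π s with k | x <;> rfl

/-- Normal form by structural induction. The vanishing alternative is needed because `zero` exists
between any two slot types, even if no number p of pairs fits them. -/
theorem IsContr.eq_list_sum {n : ℕ} {ι κ : Type} [Finite ι] {Φ : MOp n ι κ}
    (h : IsContr Φ) : Finite κ →
    (∃ (p : ℕ) (L : List (ℝ × (ι ≃ κ ⊕ (Fin p × Bool)))), Nat.card ι = Nat.card κ + 2 * p ∧
      ∀ gi T I, Φ gi T I = (L.map fun x => x.1 * contrAlong gi x.2 T I).sum) ∨
    ∀ gi T, Φ gi T = 0 := by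
  induction h with
  | id =>
    refine fun _ => .inl ⟨0, [(1, (Equiv.sumEmpty ι (Fin 0 × Bool)).symm)], by simp, fun gi T I => ?_⟩
    simp [contrAlong]
  | @reindex κ κ' Φ e _ ih =>
    intro hκ
    rcases ih (Finite.of_equiv _ e.symm) with ⟨p, L, hc, H⟩ | H
    · refine .inl ⟨p, L.map fun x => (x.1, x.2.trans (e.sumCongr (Equiv.refl _))),
        by rw [hc, Nat.card_congr e], fun gi T I => ?_⟩
      simp only [_root_.reindex, H, List.map_map]
      congr 2
      funext x
      simp only [Function.comp, ← reindex_contrAlong]; rfl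
    · exact .inr fun gi T => by simp only [H]; rfl
  | @ctr κ Φ _ ih =>
    intro hκ
    rcases ih inferInstance with ⟨p, L, hc, H⟩ | H
    · refine .inl ⟨p + 1, L.map fun x => (x.1, x.2.trans (pairFirst κ p)), ?_, fun gi T I => ?_⟩
      · rw [hc, Finite.card_option, Finite.card_option]; ring
      · simp only [_root_.ctr, H, List.map_map, Function.comp_def, ← ctr_contrAlong]
        clear hc H
        induction L with
        | nil => simp
        | cons x L ih =>
          simp only [List.map_cons, List.sum_cons, mul_add, Finset.sum_add_distrib, ih]
          congr 1
          simp only [Finset.mul_sum]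
          exact Finset.sum_congr rfl fun a _ => Finset.sum_congr rfl fun b _ => by ring
    · exact .inr fun gi T => by funext I; simp [H, _root_.ctr]
  | zero => exact fun _ => .inr fun _ _ => rfl
  | add _ _ ih₁ ih₂ =>
    intro hκ
    rcases ih₁ hκ with ⟨p, L, hc, H⟩ | H
    · rcases ih₂ hκ with ⟨p', L', hc', H'⟩ | H'
      -- The slot counts determine the number of contracted pairs, so both summands use patterns of
      -- the same kind.
      · obtain rfl : p = p' := by omega
        exact .inl ⟨p, L ++ L', hc, fun gi T I => by simp [H, H']⟩
      · exact .inl ⟨p, L, hc, fun gi T I => by simp [H, H']⟩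
    · rcases ih₂ hκ with ⟨p', L', hc', H'⟩ | H'
      · exact .inl ⟨p', L', hc', fun gi T I => by simp [H, H']⟩
      · exact .inr fun gi T => by simp [H, H']
  | smul c _ ih =>
    intro hκ
    rcases ih hκ with ⟨p, L, hc, H⟩ | H
    · refine .inl ⟨p, L.map fun x => (c * x.1, x.2), hc, fun gi T I => ?_⟩
      simp [H, ← List.sum_map_mul_left, mul_assoc, Function.comp_def]
    · exact .inr fun gi T => by simp [H]

theorem IsContr.eq_contractComb {n a r p : ℕ} (ha : a = r + 2 * p) {Φ : MOp n (Fin a) (Fin r)}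
    (h : IsContr Φ) : ∃ c : Pattern a r p → ℝ, ∀ gi T, Φ gi T = contractComb gi c T := by
  rcases h.eq_list_sum inferInstance with ⟨p', L, hc, H⟩ | H
  · obtain rfl : p = p' := by simp at hc; omega
    suffices hL : ∃ c : Pattern a r p → ℝ, ∀ gi (T : Comp n a) I,
        (L.map fun x => x.1 * contrAlong gi x.2 T I).sum = contractComb gi c T I by
      obtain ⟨c, hc⟩ := hL
      exact ⟨c, fun gi T => by funext I; rw [H, hc]⟩
    clear hc H
    induction L with
    | nil => exact ⟨0, fun gi T I => by simp [contractComb]⟩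
    | cons x L ih =>
      obtain ⟨c, hc⟩ := ih
      -- A pattern may occur several times in the list; its coefficients add up.
      refine ⟨c + Pi.single x.2 x.1, fun gi T I => ?_⟩
      simp only [List.map_cons, List.sum_cons, hc, contractComb, Pi.add_apply, add_mul,
        Finset.sum_add_distrib]
      rw [add_comm]
      congr 1
      rw [Finset.sum_eq_single x.2]
      · rw [Pi.single_eq_same]; rfl
      · intro π _ hπ; rw [Pi.single_eq_of_ne hπ, zero_mul]
      · simp
  · exact ⟨0, fun gi T => by funext I; simp [H, contractComb]⟩

/-! The action of an array with two distinguished slots on another array. -/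

/-- The slots involved in the action on the slot `s`. -/
def actEquiv (κ : Type) {ι : Type} [DecidableEq ι] (s : ι) :
    Option (Option κ) ⊕ ι ≃ Option (Option (κ ⊕ ι)) where
  toFun
    | .inl none => some none
    | .inl (some none) => some (some (.inr s))
    | .inl (some (some k)) => some (some (.inl k))
    | .inr r => if r = s then none else some (some (.inr r))
  invFun
    | none => .inr s
    | some none => .inl none
    | some (some (.inl k)) => .inl (some (some k))
    | some (some (.inr r)) => if r = s then .inl (some none) else .inr r
  left_inv := by
    rintro ((_ | _ | k) | r)
    · rfl
    · simp
    · rfl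
    · by_cases h : r = s <;> simp [h]
  right_inv := by
    rintro (_ | _ | k | r)
    · simp
    · rfl
    · rfl
    · by_cases h : r = s <;> simp [h]

/-- `∑_s g^{mc} B_{c I_s K} T_{... m ...}`, with `m` in the slot `s`. -/
def act {n : ℕ} {κ ι : Type} [Fintype ι] [DecidableEq ι] (gi : Matrix (Fin n) (Fin n) ℝ)
    (B : Arr n (Option (Option κ))) (T : Arr n ι) : Arr n (κ ⊕ ι) :=
  fun J => ∑ s, ∑ m, ∑ c, gi m c * B (icons c (icons (J (.inr s)) (J ∘ .inl)))
    * T (Function.update (J ∘ .inr) s m)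

/-- For each s, slot s of the second factor is traced against the first slot of the first factor,
whose second slot then takes over the free index of s. -/
theorem exists_act_eq (n : ℕ) (κ ι : Type) [Fintype ι] [DecidableEq ι] :
    ∃ Φ : MOp n (Option (Option κ) ⊕ ι) (κ ⊕ ι), IsContr Φ ∧
      ∀ gi B T, act gi B T = Φ gi (tmul B T) := by
  refine ⟨_, IsContr.sum Finset.univ (Φ := fun s gi T => ctr gi (reindex (actEquiv κ s) T))
    fun s _ => (IsContr.id.reindex _).ctr, fun gi B T => ?_⟩
  funext J
  simp only [act, Finset.sum_apply, ctr, reindex, tmul]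
  refine Finset.sum_congr rfl fun s _ => Finset.sum_congr rfl fun m _ =>
    Finset.sum_congr rfl fun c _ => ?_
  rw [mul_assoc]
  congr 3
  · funext o; rcases o with _ | _ | k <;> rfl
  · funext r
    by_cases h : r = s
    · subst h; simp [actEquiv]
    · simp [actEquiv, h]

/-! Norms. -/

theorem sum_rotate {α β γ M : Type*} [Fintype α] [Fintype β] [Fintype γ] [AddCommMonoid M]
    (f : α → β → γ → M) : ∑ a, ∑ b, ∑ c, f a b c = ∑ c, ∑ a, ∑ b, f a b c := by
  rw [Finset.sum_congr rfl fun a _ => Finset.sum_comm, Finset.sum_comm]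

/-- The inner product of arrays induced by the inverse metric. -/
def pairing {n : ℕ} {ι : Type} [Fintype ι] [DecidableEq ι] (gi : Matrix (Fin n) (Fin n) ℝ)
    (A B : Arr n ι) : ℝ :=
  ∑ I : ι → Fin n, ∑ J : ι → Fin n, (∏ s, gi (I s) (J s)) * A I * B J

/-- The norm of an array induced by the inverse metric. -/
def arrNorm {n : ℕ} {ι : Type} [Fintype ι] [DecidableEq ι] (gi : Matrix (Fin n) (Fin n) ℝ)
    (A : Arr n ι) : ℝ :=
  Real.sqrt (pairing gi A A)

/-- The components of an array in another frame. -/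
def frame {n : ℕ} {ι : Type} [Fintype ι] [DecidableEq ι] (Q : Matrix (Fin n) (Fin n) ℝ)
    (T : Arr n ι) : Arr n ι :=
  fun I => ∑ J : ι → Fin n, (∏ s, Q (I s) (J s)) * T J

theorem sum_option_arrow {n : ℕ} {ι : Type} [Fintype ι] [DecidableEq ι] {M : Type*}
    [AddCommMonoid M] (F : (Option ι → Fin n) → M) :
    ∑ I, F I = ∑ a, ∑ I : ι → Fin n, F (icons a I) := by
  rw [← Fintype.sum_prod_type']
  exact (Equiv.sum_comp (⟨fun x => icons x.1 x.2, fun J => (J none, J ∘ some), fun x => rfl,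
    fun J => icons_eta J⟩ : Fin n × (ι → Fin n) ≃ (Option ι → Fin n)) F).symm

section frame

variable {n : ℕ} {ι κ : Type} [Fintype ι] [Fintype κ] [DecidableEq ι] [DecidableEq κ]
  (Q : Matrix (Fin n) (Fin n) ℝ)

/-- With g^{-1} = QᵀQ, applying Q to every slot passes to an orthonormal frame, where the inner
product is the Euclidean one. All norm estimates below are read off there. -/
theorem pairing_eq_sum_frame (A B : Arr n ι) :
    pairing (Q.transpose * Q) A B = ∑ K, frame Q A K * frame Q B K := by
  have hprod : ∀ I J : ι → Fin n, ∏ s, (Q.transpose * Q) (I s) (J s)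
      = ∑ K : ι → Fin n, (∏ s, Q (K s) (I s)) * ∏ s, Q (K s) (J s) := by
    intro I J
    simp only [Matrix.mul_apply, Matrix.transpose_apply, Fintype.prod_sum,
      Finset.prod_mul_distrib]
  simp only [pairing, hprod, frame, Finset.sum_mul]
  rw [sum_rotate]
  refine Finset.sum_congr rfl fun K _ => Finset.sum_congr rfl fun I _ => ?_
  rw [Finset.mul_sum]
  exact Finset.sum_congr rfl fun J _ => by ring

theorem frame_reindex (e : ι ≃ κ) (T : Arr n ι) :
    frame Q (reindex e T) = reindex e (frame Q T) := by
  funext I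
  simp only [frame, reindex]
  rw [← (Equiv.arrowCongr e (Equiv.refl (Fin n))).sum_comp]
  refine Finset.sum_congr rfl fun J _ => ?_
  rw [← e.prod_comp]
  simp [Equiv.arrowCongr, Function.comp_def]

theorem frame_icons (T : Arr n (Option ι)) (a : Fin n) (I : ι → Fin n) :
    frame Q T (icons a I) = ∑ b, Q a b * frame Q (fun J => T (icons b J)) I := by
  simp only [frame, sum_option_arrow, Fintype.prod_option, icons_none, icons_some,
    Finset.mul_sum, mul_assoc]

/-- In an orthonormal frame a metric trace is a plain sum over the diagonal. -/
theorem frame_ctr (T : Arr n (Option (Option ι))) (I : ι → Fin n) :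
    frame Q (ctr (Q.transpose * Q) T) I = ∑ a, frame Q T (icons a (icons a I)) := by
  simp only [frame_icons, Finset.mul_sum]
  simp only [frame, ctr, Matrix.mul_apply, Matrix.transpose_apply, Finset.mul_sum, Finset.sum_mul]
  rw [Finset.sum_congr rfl fun J _ => sum_rotate _, Finset.sum_comm]
  refine Finset.sum_congr rfl fun c _ => ?_
  rw [← sum_rotate]
  exact Finset.sum_congr rfl fun a _ => Finset.sum_congr rfl fun b _ =>
    Finset.sum_congr rfl fun J _ => by ring

theorem frame_tmul (A : Arr n ι) (B : Arr n κ) :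
    frame Q (tmul A B) = tmul (frame Q A) (frame Q B) := by
  funext I
  simp only [frame, tmul, Finset.sum_mul_sum]
  rw [← (Equiv.sumArrowEquivProdArrow ι κ (Fin n)).symm.sum_comp, Fintype.sum_prod_type]
  refine Finset.sum_congr rfl fun J _ => Finset.sum_congr rfl fun K _ => ?_
  simp only [Fintype.prod_sum_type, Equiv.sumArrowEquivProdArrow, Equiv.coe_fn_symm_mk,
    Sum.elim_inl, Sum.elim_inr, Function.comp_def]
  ring

end frame

theorem exists_transpose_mul_self {n : ℕ} {gi : Matrix (Fin n) (Fin n) ℝ} (h : gi.PosDef) :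
    ∃ Q : Matrix (Fin n) (Fin n) ℝ, gi = Q.transpose * Q := by
  open scoped MatrixOrder ComplexOrder in
  obtain ⟨Q, hQ⟩ := CStarAlgebra.nonneg_iff_eq_star_mul_self.mp h.posSemidef.nonneg
  exact ⟨Q, by simpa [Matrix.star_eq_conjTranspose, Matrix.conjTranspose_eq_transpose_of_trivial] using hQ⟩
section norm

variable {n : ℕ} {ι κ : Type} [Fintype ι] [Fintype κ] [DecidableEq ι] [DecidableEq κ]
  {gi : Matrix (Fin n) (Fin n) ℝ}

theorem pairing_self_nonneg (h : gi.PosDef) (A : Arr n ι) : 0 ≤ pairing gi A A := by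
  obtain ⟨Q, rfl⟩ := exists_transpose_mul_self h
  rw [pairing_eq_sum_frame]
  exact Finset.sum_nonneg fun K _ => mul_self_nonneg _

theorem arrNorm_nonneg (A : Arr n ι) : 0 ≤ arrNorm gi A := Real.sqrt_nonneg _

theorem pairing_le_arrNorm_mul (h : gi.PosDef) (A B : Arr n ι) :
    pairing gi A B ≤ arrNorm gi A * arrNorm gi B := by
  obtain ⟨Q, rfl⟩ := exists_transpose_mul_self h
  simp only [arrNorm, pairing_eq_sum_frame, ← pow_two]
  exact Real.sum_mul_le_sqrt_mul_sqrt _ _ _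

theorem arrNorm_tmul (h : gi.PosDef) (A : Arr n ι) (B : Arr n κ) :
    arrNorm gi (tmul A B) = arrNorm gi A * arrNorm gi B := by
  rw [arrNorm, arrNorm, arrNorm, ← Real.sqrt_mul (pairing_self_nonneg h A)]
  congr 1
  obtain ⟨Q, rfl⟩ := exists_transpose_mul_self h
  simp only [pairing_eq_sum_frame, frame_tmul, tmul, Finset.sum_mul_sum]
  rw [← (Equiv.sumArrowEquivProdArrow ι κ (Fin n)).symm.sum_comp, Fintype.sum_prod_type]
  refine Finset.sum_congr rfl fun J _ => Finset.sum_congr rfl fun K _ => ?_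
  simp only [Equiv.sumArrowEquivProdArrow, Equiv.coe_fn_symm_mk, Function.comp_def,
    Sum.elim_inl, Sum.elim_inr]
  ring

theorem pairing_add_left (A A' B : Arr n ι) :
    pairing gi (A + A') B = pairing gi A B + pairing gi A' B := by
  simp only [pairing, Pi.add_apply, mul_add, add_mul, Finset.sum_add_distrib]

theorem pairing_smul_left (c : ℝ) (A B : Arr n ι) :
    pairing gi (c • A) B = c * pairing gi A B := by
  simp only [pairing, Pi.smul_apply, smul_eq_mul, Finset.mul_sum]
  exact Finset.sum_congr rfl fun I _ => Finset.sum_congr rfl fun J _ => by ring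

theorem pairing_comm (h : gi.IsSymm) (A B : Arr n ι) : pairing gi A B = pairing gi B A := by
  simp only [pairing]
  rw [Finset.sum_comm]
  refine Finset.sum_congr rfl fun I _ => Finset.sum_congr rfl fun J _ => ?_
  simp only [h.apply]
  ring

theorem arrNorm_smul (h : gi.PosDef) (c : ℝ) (A : Arr n ι) :
    arrNorm gi (c • A) = |c| * arrNorm gi A := by
  have hs : gi.IsSymm := by simpa using h.isHermitian
  rw [arrNorm, pairing_smul_left, pairing_comm hs, pairing_smul_left, ← mul_assoc, arrNorm,
    Real.sqrt_mul (mul_self_nonneg c), Real.sqrt_mul_self_eq_abs]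

theorem arrNorm_zero : arrNorm gi (0 : Arr n ι) = 0 := by simp [arrNorm, pairing]

theorem arrNorm_add_le (h : gi.PosDef) (A B : Arr n ι) :
    arrNorm gi (A + B) ≤ arrNorm gi A + arrNorm gi B := by
  have hs : gi.IsSymm := by simpa using h.isHermitian
  refine Real.sqrt_le_iff.2 ⟨add_nonneg (arrNorm_nonneg A) (arrNorm_nonneg B), ?_⟩
  have hA : arrNorm gi A ^ 2 = pairing gi A A := Real.sq_sqrt (pairing_self_nonneg h A)
  have hB : arrNorm gi B ^ 2 = pairing gi B B := Real.sq_sqrt (pairing_self_nonneg h B)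
  have hAB := pairing_le_arrNorm_mul h A B
  have e : pairing gi (A + B) (A + B)
      = pairing gi A A + 2 * pairing gi A B + pairing gi B B := by
    rw [pairing_add_left, pairing_comm hs A (A + B), pairing_comm hs B (A + B), pairing_add_left,
      pairing_add_left, pairing_comm hs B A]
    ring
  rw [e, add_sq, hA, hB]
  linarith

theorem arrNorm_reindex (h : gi.PosDef) (e : ι ≃ κ) (A : Arr n ι) :
    arrNorm gi (reindex e A) = arrNorm gi A := by
  rw [arrNorm, arrNorm]
  congr 1
  obtain ⟨Q, rfl⟩ := exists_transpose_mul_self h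
  simp only [pairing_eq_sum_frame, frame_reindex, reindex]
  exact (Equiv.arrowCongr e.symm (Equiv.refl (Fin n))).sum_comp
    fun K => frame Q A K * frame Q A K

/-- In an orthonormal frame the trace is a sum of n diagonal entries, so Cauchy-Schwarz gives the
factor √n; the cruder factor n is enough. -/
theorem arrNorm_ctr_le (h : gi.PosDef) (A : Arr n (Option (Option ι))) :
    arrNorm gi (ctr gi A) ≤ n * arrNorm gi A := by
  have h0 := pairing_self_nonneg h A
  refine Real.sqrt_le_iff.2 ⟨mul_nonneg n.cast_nonneg (arrNorm_nonneg A), ?_⟩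
  rw [mul_pow, arrNorm, Real.sq_sqrt h0]
  obtain ⟨Q, rfl⟩ := exists_transpose_mul_self h
  rw [pairing_eq_sum_frame] at h0 ⊢
  rw [pairing_eq_sum_frame]
  simp only [frame_ctr, ← pow_two] at h0 ⊢
  have h1 : ∀ K : ι → Fin n, (∑ a, frame Q A (icons a (icons a K))) ^ 2
      ≤ n * ∑ a, ∑ b, frame Q A (icons a (icons b K)) ^ 2 := fun K => by
    refine (sq_sum_le_card_mul_sum_sq).trans ?_
    rw [Finset.card_univ, Fintype.card_fin]
    refine mul_le_mul_of_nonneg_left (Finset.sum_le_sum fun a _ => ?_) n.cast_nonneg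
    exact Finset.single_le_sum (f := fun b => frame Q A (icons a (icons b K)) ^ 2)
      (fun b _ => sq_nonneg _) (Finset.mem_univ a)
  refine (Finset.sum_le_sum fun K _ => h1 K).trans ?_
  rw [← Finset.mul_sum, ← sum_rotate]
  rw [Finset.sum_congr rfl fun a _ =>
    (sum_option_arrow (fun K => frame Q A (icons a K) ^ 2)).symm]
  rw [← sum_option_arrow (fun K => frame Q A K ^ 2)]
  refine mul_le_mul_of_nonneg_right ?_ h0
  -- What remains is n ≤ n ^ 2.
  rcases Nat.eq_zero_or_pos n with rfl | hn
  · simp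
  · have : (1 : ℝ) ≤ n := by exact_mod_cast hn
    nlinarith

end norm

/-- Renaming slots is an isometry, a trace costs a factor n, and sums obey the triangle inequality;
hence the constant depends on the operator alone. The instances on κ are quantified inside the claim
because κ changes along the induction. -/
theorem IsContr.exists_bound {n : ℕ} {ι κ : Type} [Fintype ι] [DecidableEq ι] {Φ : MOp n ι κ}
    (h : IsContr Φ) : ∀ [Fintype κ] [DecidableEq κ], ∃ C : ℝ, 0 ≤ C ∧
      ∀ gi, gi.PosDef → ∀ T, arrNorm gi (Φ gi T) ≤ C * arrNorm gi T := by
  classical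
  induction h with
  | id =>
    intro _ _
    refine ⟨1, zero_le_one, fun gi _ T => ?_⟩
    rw [one_mul]
    exact le_of_eq (by congr!)
  | @reindex κ κ' Φ e _ ih =>
    intro _ _
    let _ : Fintype κ := Fintype.ofEquiv _ e.symm
    obtain ⟨C, hC, H⟩ := ih
    exact ⟨C, hC, fun gi hgi T => by rw [arrNorm_reindex hgi]; exact H gi hgi T⟩
  | @ctr κ Φ _ ih =>
    intro _ _
    obtain ⟨C, hC, H⟩ := ih
    refine ⟨n * C, mul_nonneg n.cast_nonneg hC, fun gi hgi T => (arrNorm_ctr_le hgi _).trans ?_⟩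
    rw [mul_assoc]
    exact mul_le_mul_of_nonneg_left (H gi hgi T) n.cast_nonneg
  | zero =>
    intro _ _
    exact ⟨0, le_rfl, fun gi _ T => by rw [arrNorm_zero, zero_mul]⟩
  | add _ _ ih₁ ih₂ =>
    intro _ _
    obtain ⟨C₁, hC₁, H₁⟩ := ih₁
    obtain ⟨C₂, hC₂, H₂⟩ := ih₂
    refine ⟨C₁ + C₂, add_nonneg hC₁ hC₂, fun gi hgi T => (arrNorm_add_le hgi _ _).trans ?_⟩
    rw [add_mul]
    exact add_le_add (H₁ gi hgi T) (H₂ gi hgi T)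
  | smul c _ ih =>
    intro _ _
    obtain ⟨C, hC, H⟩ := ih
    refine ⟨|c| * C, mul_nonneg (abs_nonneg c) hC, fun gi hgi T => ?_⟩
    rw [arrNorm_smul hgi, mul_assoc]
    exact mul_le_mul_of_nonneg_left (H gi hgi T) (abs_nonneg c)

/-! Partial derivatives and covariant derivatives in a coordinate domain. -/

theorem contDiffOn_matrix_det {n : ℕ} {E : Type*} [NormedAddCommGroup E] [NormedSpace ℝ E]
    {S : Set E} {A : E → Matrix (Fin n) (Fin n) ℝ}
    (hA : ∀ i j, ContDiffOn ℝ ∞ (fun x => A x i j) S) : ContDiffOn ℝ ∞ (fun x => (A x).det) S := by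
  simp only [Matrix.det_apply]
  exact ContDiffOn.sum fun σ _ => ContDiffOn.const_smul _ (contDiffOn_prod fun i _ => hA _ _)

/-- Cramer's rule: the entries of the adjugate are determinants in the entries of A. -/
theorem contDiffOn_matrix_inv {n : ℕ} {E : Type*} [NormedAddCommGroup E] [NormedSpace ℝ E]
    {S : Set E} {A : E → Matrix (Fin n) (Fin n) ℝ}
    (hA : ∀ i j, ContDiffOn ℝ ∞ (fun x => A x i j) S) (h : ∀ x ∈ S, (A x).det ≠ 0) (i j : Fin n) :
    ContDiffOn ℝ ∞ (fun x => (A x)⁻¹ i j) S := by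
  simp only [Matrix.inv_def, Matrix.smul_apply, Ring.inverse_eq_inv', smul_eq_mul]
  refine ((contDiffOn_matrix_det hA).inv h).mul ?_
  simp only [Matrix.adjugate_apply]
  refine contDiffOn_matrix_det fun k l => ?_
  by_cases hk : k = j
  · subst hk; simpa using contDiffOn_const
  · simpa [Matrix.updateRow_apply, hk] using hA k l

section pderiv

variable {n : ℕ} {U : Set (Coord n)} {f f' : Coord n → ℝ} {y : Coord n}

theorem ContDiffOn.diffAt (hf : ContDiffOn ℝ ∞ f U) (hU : IsOpen U) (hy : y ∈ U) :
    DifferentiableAt ℝ f y :=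
  (hf.differentiableOn (by simp)).differentiableAt (hU.mem_nhds hy)

theorem pderiv_congr (hU : IsOpen U) (h : ∀ z ∈ U, f z = f' z) (hy : y ∈ U) (i : Fin n) :
    pderiv i f y = pderiv i f' y := by
  rw [pderiv, pderiv, Filter.EventuallyEq.fderiv_eq]
  filter_upwards [hU.mem_nhds hy] with z hz using h z hz

theorem pderiv_add (hf : DifferentiableAt ℝ f y) (hf' : DifferentiableAt ℝ f' y) (i : Fin n) :
    pderiv i (fun z => f z + f' z) y = pderiv i f y + pderiv i f' y := by
  simp [pderiv, fderiv_fun_add hf hf']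

theorem pderiv_sub (hf : DifferentiableAt ℝ f y) (hf' : DifferentiableAt ℝ f' y) (i : Fin n) :
    pderiv i (fun z => f z - f' z) y = pderiv i f y - pderiv i f' y := by
  simp [pderiv, fderiv_fun_sub hf hf']

theorem pderiv_mul (hf : DifferentiableAt ℝ f y) (hf' : DifferentiableAt ℝ f' y) (i : Fin n) :
    pderiv i (fun z => f z * f' z) y = pderiv i f y * f' y + f y * pderiv i f' y := by
  simp [pderiv, fderiv_fun_mul hf hf']; ring

theorem pderiv_sum {α : Type*} (s : Finset α) {F : α → Coord n → ℝ}
    (hF : ∀ a ∈ s, DifferentiableAt ℝ (F a) y) (i : Fin n) :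
    pderiv i (fun z => ∑ a ∈ s, F a z) y = ∑ a ∈ s, pderiv i (F a) y := by
  simp [pderiv, fderiv_fun_sum hF]

theorem pderiv_const (c : ℝ) (i : Fin n) : pderiv i (fun _ => c) y = 0 := by
  simp [pderiv]

theorem ContDiffOn.pderiv (hf : ContDiffOn ℝ ∞ f U) (hU : IsOpen U) (i : Fin n) :
    ContDiffOn ℝ ∞ (pderiv i f) U :=
  (hf.fderiv_of_isOpen hU (by simp)).clm_apply contDiffOn_const

theorem pderiv_comm (hf : ContDiffOn ℝ ∞ f U) (hU : IsOpen U) (hy : y ∈ U) (i j : Fin n) :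
    pderiv i (pderiv j f) y = pderiv j (pderiv i f) y := by
  have hd : DifferentiableAt ℝ (fderiv ℝ f) y :=
    ((hf.fderiv_of_isOpen (m := ∞) hU (by simp)).differentiableOn (by simp)).differentiableAt
      (hU.mem_nhds hy)
  have h : ∀ i j : Fin n, pderiv i (pderiv j f) y
      = fderiv ℝ (fderiv ℝ f) y (EuclideanSpace.single i 1) (EuclideanSpace.single j 1) := by
    intro i j
    unfold _root_.pderiv
    rw [fderiv_clm_apply hd (differentiableAt_const _)]
    simp
  rw [h, h]
  exact ((hf.contDiffAt (hU.mem_nhds hy)).isSymmSndFDerivAt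
    (by simpa using WithTop.coe_le_coe.2 (le_top : (2 : ℕ∞) ≤ ⊤))).eq _ _

end pderiv

/-- A smooth Riemannian metric on an open subset of the model space. -/
structure IsMetricOn {n : ℕ} (g : MetricField n) (U : Set (Coord n)) : Prop where
  isOpen : IsOpen U
  smooth : ∀ i j, ContDiffOn ℝ ∞ (fun z => g z i j) U
  posDef : ∀ y ∈ U, (g y).PosDef

/-- Smoothness of all the components of a field of arrays. -/
def ArrSmoothOn {n : ℕ} {ι : Type} (T : Coord n → Arr n ι) (U : Set (Coord n)) : Prop :=
  ∀ I, ContDiffOn ℝ ∞ (fun z => T z I) U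

/-- The covariant derivative; the new slot is `none`. -/
def cov {n : ℕ} {ι : Type} [Fintype ι] [DecidableEq ι] (g : MetricField n) (T : Coord n → Arr n ι) :
    Coord n → Arr n (Option ι) :=
  fun y J => pderiv (J none) (fun z => T z (J ∘ some)) y
    - ∑ s, ∑ m, christoffel g m (J none) (J (some s)) y * T y (Function.update (J ∘ some) s m)

theorem cov_icons {n : ℕ} {ι : Type} [Fintype ι] [DecidableEq ι] (g : MetricField n)
    (T : Coord n → Arr n ι) (y : Coord n) (i : Fin n) (I : ι → Fin n) :
    cov g T y (icons i I) = pderiv i (fun z => T z I) y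
      - ∑ s, ∑ m, christoffel g m i (I s) y * T y (Function.update I s m) := rfl

theorem covDeriv_eq_reindex {n k : ℕ} (g : MetricField n) (T : CompField n k) (y : Coord n) :
    covDeriv g T y = reindex (finSuccEquiv k).symm (cov g T y) := rfl

/-- Differentiating AB = 1 gives dB = -B dA B. If dA is the infinitesimal action of P, this becomes
the dual action on B. It serves twice: with P the Christoffel symbols for spatial derivatives, and
with P = g^{-1}v/2 for the time derivative. -/
theorem matrix_deriv_inv {n : ℕ} {A B dA dB P : Matrix (Fin n) (Fin n) ℝ} (hAB : A * B = 1)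
    (hd : dA * B + A * dB = 0) (hP : dA = P.transpose * A + A * P) :
    dB = -(B * P.transpose + P * B) := by
  have hBA : B * A = 1 := mul_eq_one_comm.mp hAB
  have : B * (A * dB) = -(B * (dA * B)) := by
    rw [← mul_neg]; congr 1; exact eq_neg_of_add_eq_zero_right hd
  rw [← mul_assoc, hBA, one_mul] at this
  rw [this, hP]
  have e : B * ((P.transpose * A + A * P) * B)
      = B * P.transpose * (A * B) + (B * A) * P * B := by noncomm_ring
  rw [e, hAB, hBA]
  simp

/-! ### The inverse metric, the Christoffel symbols and metric compatibility. -/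

namespace IsMetricOn

variable {n : ℕ} {g : MetricField n} {U : Set (Coord n)} {y : Coord n}

theorem det_ne_zero (hg : IsMetricOn g U) (hy : y ∈ U) : (g y).det ≠ 0 := (hg.posDef y hy).det_pos.ne'

theorem mul_inv (hg : IsMetricOn g U) (hy : y ∈ U) : g y * (g y)⁻¹ = 1 :=
  Matrix.mul_nonsing_inv _ (hg.det_ne_zero hy).isUnit

theorem inv_mul (hg : IsMetricOn g U) (hy : y ∈ U) : (g y)⁻¹ * g y = 1 :=
  Matrix.nonsing_inv_mul _ (hg.det_ne_zero hy).isUnit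

theorem symm (hg : IsMetricOn g U) (hy : y ∈ U) (i j : Fin n) : g y i j = g y j i := by
  simpa using (hg.posDef y hy).isHermitian.apply j i

theorem inv_posDef (hg : IsMetricOn g U) (hy : y ∈ U) : (g y)⁻¹.PosDef := (hg.posDef y hy).inv

theorem inv_symm (hg : IsMetricOn g U) (hy : y ∈ U) (i j : Fin n) :
    (g y)⁻¹ i j = (g y)⁻¹ j i := by
  simpa using (hg.inv_posDef hy).isHermitian.apply j i

theorem sum_inv_mul (hg : IsMetricOn g U) (hy : y ∈ U) (i j : Fin n) :
    ∑ m, (g y)⁻¹ i m * g y m j = if i = j then 1 else 0 := by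
  rw [← Matrix.mul_apply, hg.inv_mul hy, Matrix.one_apply]

theorem sum_mul_inv (hg : IsMetricOn g U) (hy : y ∈ U) (i j : Fin n) :
    ∑ m, g y i m * (g y)⁻¹ m j = if i = j then 1 else 0 := by
  rw [← Matrix.mul_apply, hg.mul_inv hy, Matrix.one_apply]

theorem smooth_inv (hg : IsMetricOn g U) (i j : Fin n) :
    ContDiffOn ℝ ∞ (fun z => (g z)⁻¹ i j) U :=
  contDiffOn_matrix_inv hg.smooth (fun _ hx => hg.det_ne_zero hx) i j

theorem smooth_christoffel (hg : IsMetricOn g U) (m i j : Fin n) :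
    ContDiffOn ℝ ∞ (christoffel g m i j) U := by
  unfold christoffel
  refine contDiffOn_const.mul (ContDiffOn.sum fun p _ => (hg.smooth_inv m p).mul ?_)
  exact (((hg.smooth _ _).pderiv hg.isOpen _).add ((hg.smooth _ _).pderiv hg.isOpen _)).sub
    ((hg.smooth _ _).pderiv hg.isOpen _)

theorem smooth_riemannUp (hg : IsMetricOn g U) (h i j l : Fin n) :
    ContDiffOn ℝ ∞ (riemannUp g h i j l) U := by
  unfold riemannUp
  refine ContDiffOn.add (ContDiffOn.sub ?_ ?_) (ContDiffOn.sum fun p _ => ContDiffOn.sub ?_ ?_)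
  · exact (hg.smooth_christoffel _ _ _).pderiv hg.isOpen _
  · exact (hg.smooth_christoffel _ _ _).pderiv hg.isOpen _
  · exact (hg.smooth_christoffel _ _ _).mul (hg.smooth_christoffel _ _ _)
  · exact (hg.smooth_christoffel _ _ _).mul (hg.smooth_christoffel _ _ _)

theorem smooth_riemannTensor (hg : IsMetricOn g U) : ArrSmoothOn (riemannTensor g) U :=
  fun _ => ContDiffOn.sum fun _ _ => (hg.smooth _ _).mul (hg.smooth_riemannUp _ _ _ _)

theorem pderiv_symm (hg : IsMetricOn g U) (hy : y ∈ U) (i j k : Fin n) :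
    pderiv i (fun z => g z j k) y = pderiv i (fun z => g z k j) y :=
  pderiv_congr hg.isOpen (fun _ hz => hg.symm hz j k) hy i

theorem christoffel_symm (hg : IsMetricOn g U) (hy : y ∈ U) (m i j : Fin n) :
    christoffel g m i j y = christoffel g m j i y := by
  simp only [christoffel]
  congr 1
  refine Finset.sum_congr rfl fun p _ => ?_
  rw [hg.pderiv_symm hy p i j]
  ring

theorem sum_mul_christoffel (hg : IsMetricOn g U) (hy : y ∈ U) (k i j : Fin n) :
    ∑ m, g y k m * christoffel g m i j y = (1 / 2) * (pderiv i (fun z => g z j k) y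
      + pderiv j (fun z => g z i k) y - pderiv k (fun z => g z i j) y) := by
  simp only [christoffel]
  have h : ∀ F : Fin n → ℝ, ∑ m, g y k m * (1 / 2 * ∑ p, (g y)⁻¹ m p * F p) = 1 / 2 * F k := by
    intro F
    have : ∀ m, g y k m * (1 / 2 * ∑ p, (g y)⁻¹ m p * F p)
        = ∑ p, 1 / 2 * F p * (g y k m * (g y)⁻¹ m p) := fun m => by
      rw [Finset.mul_sum, Finset.mul_sum]
      exact Finset.sum_congr rfl fun p _ => by ring
    simp only [this]
    rw [Finset.sum_comm]
    simp only [← Finset.mul_sum, hg.sum_mul_inv hy]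
    simp
  exact h _

/-- This is ∇g = 0 written out: in the sum of the two lowered Christoffel symbols all derivatives
but one cancel. -/
theorem pderiv_metric (hg : IsMetricOn g U) (hy : y ∈ U) (i j k : Fin n) :
    pderiv i (fun z => g z j k) y
      = ∑ m, (christoffel g m i j y * g y m k + g y j m * christoffel g m i k y) := by
  rw [Finset.sum_add_distrib, hg.sum_mul_christoffel hy]
  have : ∑ m, christoffel g m i j y * g y m k = ∑ m, g y k m * christoffel g m i j y :=
    Finset.sum_congr rfl fun m _ => by rw [hg.symm hy m k]; ring
  rw [this, hg.sum_mul_christoffel hy, hg.pderiv_symm hy i k j, hg.pderiv_symm hy k i j,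
    hg.pderiv_symm hy j i k, hg.pderiv_symm hy k j i]
  ring

/-- This is ∇g^{-1} = 0 written out, obtained from ∇g = 0 by differentiating g g^{-1} = 1. -/
theorem pderiv_inv (hg : IsMetricOn g U) (hy : y ∈ U) (i a b : Fin n) :
    pderiv i (fun z => (g z)⁻¹ a b) y
      = -∑ m, ((g y)⁻¹ a m * christoffel g b i m y + christoffel g a i m y * (g y)⁻¹ m b) := by
  have key := matrix_deriv_inv (A := g y) (B := (g y)⁻¹)
    (dA := Matrix.of fun j k => pderiv i (fun z => g z j k) y)
    (dB := Matrix.of fun j k => pderiv i (fun z => (g z)⁻¹ j k) y)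
    (P := Matrix.of fun m c => christoffel g m i c y) (hg.mul_inv hy) ?_ ?_
  · have := congrFun (congrFun key a) b
    simpa [Matrix.mul_apply, Finset.sum_add_distrib] using this
  · ext j k
    simp only [Matrix.add_apply, Matrix.mul_apply, Matrix.of_apply, Matrix.zero_apply]
    rw [← Finset.sum_add_distrib]
    have h1 := pderiv_congr (f := fun z => ∑ m, g z j m * (g z)⁻¹ m k) hg.isOpen
      (fun z hz => hg.sum_mul_inv hz j k) hy i
    rw [pderiv_const, pderiv_sum _ fun m _ => ((hg.smooth j m).mul (hg.smooth_inv m k)).diffAt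
      hg.isOpen hy] at h1
    rw [← h1]
    exact Finset.sum_congr rfl fun m _ => (pderiv_mul ((hg.smooth j m).diffAt hg.isOpen hy)
      ((hg.smooth_inv m k).diffAt hg.isOpen hy) i).symm
  · ext j k
    simp only [Matrix.add_apply, Matrix.mul_apply, Matrix.of_apply, Matrix.transpose_apply]
    rw [hg.pderiv_metric hy, Finset.sum_add_distrib]

end IsMetricOn

/-! Rules for the covariant derivative. -/

@[simp] theorem update_icons_none {n : ℕ} {ι : Type} [DecidableEq ι] (a m : Fin n)
    (I : ι → Fin n) : Function.update (icons a I) none m = icons m I := by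
  funext o; cases o <;> simp

@[simp] theorem update_icons_some {n : ℕ} {ι : Type} [DecidableEq ι] (a m : Fin n) (s : ι)
    (I : ι → Fin n) :
    Function.update (icons a I) (some s) m = icons a (Function.update I s m) := by
  funext o; cases o <;> simp [Function.update_apply]

section cov

variable {n : ℕ} {ι κ : Type} {g : MetricField n} {U : Set (Coord n)} {T T' : Coord n → Arr n ι} {y : Coord n}

theorem ext_icons {A B : Arr n (Option ι)} (h : ∀ i I, A (icons i I) = B (icons i I)) : A = B := by
  funext J
  rw [← icons_eta J]
  exact h _ _

theorem ArrSmoothOn.diffAt (hT : ArrSmoothOn T U) (hU : IsOpen U) (hy : y ∈ U) (I : ι → Fin n) :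
    DifferentiableAt ℝ (fun z => T z I) y := ContDiffOn.diffAt (hT I) hU hy

theorem ArrSmoothOn.add (hT : ArrSmoothOn T U) (hT' : ArrSmoothOn T' U) :
    ArrSmoothOn (fun z => T z + T' z) U := fun I => (hT I).add (hT' I)

theorem ArrSmoothOn.const_smul (c : ℝ) (hT : ArrSmoothOn T U) :
    ArrSmoothOn (fun z => c • T z) U := fun I => contDiffOn_const.mul (hT I)

theorem ArrSmoothOn.congr (hT : ArrSmoothOn T U) (h : ∀ z ∈ U, T' z = T z) :
    ArrSmoothOn T' U := fun I => ContDiffOn.congr (hT I) fun z hz => by rw [h z hz]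

theorem ArrSmoothOn.tmul (hT : ArrSmoothOn T U) {S : Coord n → Arr n κ} (hS : ArrSmoothOn S U) :
    ArrSmoothOn (fun z => tmul (T z) (S z)) U := fun _ => (hT _).mul (hS _)

theorem ArrSmoothOn.reindex (e : ι ≃ κ) (hT : ArrSmoothOn T U) :
    ArrSmoothOn (fun z => reindex e (T z)) U := fun _ => hT _

variable [Fintype ι] [Fintype κ] [DecidableEq ι] [DecidableEq κ]

theorem ArrSmoothOn.cov (hg : IsMetricOn g U) (hT : ArrSmoothOn T U) :
    ArrSmoothOn (cov g T) U := fun _ =>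
  ((hT _).pderiv hg.isOpen _).sub (ContDiffOn.sum fun _ _ => ContDiffOn.sum fun _ _ =>
    (hg.smooth_christoffel _ _ _).mul (hT _))

theorem ArrSmoothOn.isContr (hg : IsMetricOn g U) {ι κ : Type} {T : Coord n → Arr n ι}
    (hT : ArrSmoothOn T U) {Φ : MOp n ι κ} (h : IsContr Φ) :
    ArrSmoothOn (fun z => Φ (g z)⁻¹ (T z)) U := by
  induction h with
  | id => exact hT
  | reindex e _ ih => exact fun _ => ih _
  | ctr _ ih => exact fun _ => ContDiffOn.sum fun _ _ => ContDiffOn.sum fun _ _ =>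
      (hg.smooth_inv _ _).mul (ih _)
  | zero => exact fun _ => contDiffOn_const
  | add _ _ ih₁ ih₂ => exact fun _ => (ih₁ _).add (ih₂ _)
  | smul c _ ih => exact fun _ => contDiffOn_const.mul (ih _)

theorem cov_congr (hU : IsOpen U) (h : ∀ z ∈ U, T z = T' z) (hy : y ∈ U) :
    cov g T y = cov g T' y := by
  funext J
  simp only [cov, h y hy]
  rw [pderiv_congr hU (fun z hz => by rw [h z hz]) hy]

theorem cov_add (hU : IsOpen U) (hT : ArrSmoothOn T U) (hT' : ArrSmoothOn T' U) (hy : y ∈ U) :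
    cov g (fun z => T z + T' z) y = cov g T y + cov g T' y := by
  funext J
  simp only [cov, Pi.add_apply, mul_add, Finset.sum_add_distrib]
  rw [pderiv_add (hT.diffAt hU hy _) (hT'.diffAt hU hy _)]
  ring

theorem cov_const_smul (hU : IsOpen U) (hT : ArrSmoothOn T U) (hy : y ∈ U) (c : ℝ) :
    cov g (fun z => c • T z) y = c • cov g T y := by
  funext J
  simp only [cov, Pi.smul_apply, smul_eq_mul]
  rw [pderiv_mul (differentiableAt_const c) (hT.diffAt hU hy _), pderiv_const, mul_sub,
    Finset.mul_sum]
  simp only [Finset.mul_sum]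
  rw [zero_mul, zero_add]
  congr 1
  exact Finset.sum_congr rfl fun s _ => Finset.sum_congr rfl fun m _ => by ring

theorem cov_zero : cov g (fun _ => (0 : Arr n ι)) y = 0 := by
  funext J; simp [cov, pderiv_const]

theorem cov_reindex (e : ι ≃ κ) :
    cov g (fun z => reindex e (T z)) y = reindex e.optionCongr (cov g T y) := by
  refine ext_icons fun i I => ?_
  simp only [reindex, icons_optionCongr, cov_icons]
  congr 1
  rw [← e.sum_comp]
  refine Finset.sum_congr rfl fun s _ => Finset.sum_congr rfl fun m _ => ?_
  rw [Function.update_comp_eq_of_injective _ e.injective]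
  rfl

/-- The Leibniz rule. The derivative slot arises in either factor, so each summand needs its own
renaming to bring it to the front. -/
theorem cov_tmul (hU : IsOpen U) (hT : ArrSmoothOn T U) {S : Coord n → Arr n κ}
    (hS : ArrSmoothOn S U) (hy : y ∈ U) :
    cov g (fun z => tmul (T z) (S z)) y
      = reindex (optionSumLeft ι κ) (tmul (cov g T y) (S y))
        + reindex (optionSumRight ι κ) (tmul (T y) (cov g S y)) := by
  refine ext_icons fun i I => ?_
  have h1 : icons i I ∘ optionSumLeft ι κ ∘ Sum.inl = icons i (I ∘ Sum.inl) := by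
    funext o; cases o <;> rfl
  have h2 : icons i I ∘ optionSumLeft ι κ ∘ Sum.inr = I ∘ Sum.inr := rfl
  have h3 : icons i I ∘ optionSumRight ι κ ∘ Sum.inr = icons i (I ∘ Sum.inr) := by
    funext o; cases o <;> rfl
  have h4 : icons i I ∘ optionSumRight ι κ ∘ Sum.inl = I ∘ Sum.inl := rfl
  simp only [Pi.add_apply, reindex, tmul, Function.comp_assoc, h1, h2, h3, h4, cov_icons]
  rw [pderiv_mul (hT.diffAt hU hy _) (hS.diffAt hU hy _), Fintype.sum_sum_type]
  have e1 : ∀ s m, Function.update I (Sum.inl s) m ∘ Sum.inl = Function.update (I ∘ Sum.inl) s m :=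
    fun s m => Function.update_comp_eq_of_injective I Sum.inl_injective s m
  have e2 : ∀ s m, Function.update I (Sum.inr s) m ∘ Sum.inr = Function.update (I ∘ Sum.inr) s m :=
    fun s m => Function.update_comp_eq_of_injective I Sum.inr_injective s m
  have e3 : ∀ s m, Function.update I (Sum.inl s) m ∘ Sum.inr = I ∘ Sum.inr := fun s m => by
    funext r; simp
  have e4 : ∀ s m, Function.update I (Sum.inr s) m ∘ Sum.inl = I ∘ Sum.inl := fun s m => by
    funext r; simp
  simp only [e1, e2, e3, e4, sub_mul, mul_sub, Finset.sum_mul, Finset.mul_sum, mul_assoc]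
  have : ∀ a b c d a' b' : ℝ, a = a' → b = b' → c + d - (a + b) = c - a' + (d - b') := by
    intros; subst_vars; ring
  refine this _ _ _ _ _ _ rfl (Finset.sum_congr rfl fun s _ => Finset.sum_congr rfl fun m _ => ?_)
  simp only [Function.comp_apply]
  ring

/-- Traces commute with ∇ because the inverse metric is parallel; only the derivative slot has to be
moved behind the two traced slots. -/
theorem cov_ctr (hg : IsMetricOn g U) {T : Coord n → Arr n (Option (Option ι))}
    (hT : ArrSmoothOn T U) (hy : y ∈ U) :
    cov g (fun z => ctr (g z)⁻¹ (T z)) y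
      = ctr (g y)⁻¹ (reindex (optionRotate ι) (cov g T y)) := by
  refine ext_icons fun i I => ?_
  simp only [cov_icons, ctr, reindex, icons_optionRotate]
  simp only [Fintype.sum_option, icons_none, icons_some, update_icons_none, update_icons_some]
  have hd : ∀ a b, DifferentiableAt ℝ (fun z => (g z)⁻¹ a b * T z (icons a (icons b I))) y :=
    fun a b => ((hg.smooth_inv a b).diffAt hg.isOpen hy).mul (hT.diffAt hg.isOpen hy _)
  rw [pderiv_sum _ fun a _ => DifferentiableAt.fun_sum fun b _ => hd a b]
  have e1 : ∀ a, pderiv i (fun z => ∑ b, (g z)⁻¹ a b * T z (icons a (icons b I))) y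
      = ∑ b, (pderiv i (fun z => (g z)⁻¹ a b) y * T y (icons a (icons b I))
        + (g y)⁻¹ a b * pderiv i (fun z => T z (icons a (icons b I))) y) := fun a => by
    rw [pderiv_sum _ fun b _ => hd a b]
    exact Finset.sum_congr rfl fun b _ => pderiv_mul ((hg.smooth_inv a b).diffAt hg.isOpen hy)
      (hT.diffAt hg.isOpen hy _) i
  simp only [e1]
  -- The derivative of the inverse metric supplies exactly the Christoffel corrections for the two
  -- traced slots.
  have e2 : ∑ a, ∑ b, pderiv i (fun z => (g z)⁻¹ a b) y * T y (icons a (icons b I))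
      = - ∑ a, ∑ b, (g y)⁻¹ a b * ∑ m, christoffel g m i b y * T y (icons a (icons m I))
        - ∑ a, ∑ b, (g y)⁻¹ a b * ∑ m, christoffel g m i a y * T y (icons m (icons b I)) := by
    simp only [hg.pderiv_inv hy, neg_mul, Finset.sum_neg_distrib, Finset.sum_add_distrib, add_mul, neg_add,
      Finset.sum_mul, Finset.mul_sum, sub_eq_add_neg]
    congr 2
    · refine Finset.sum_congr rfl fun a _ => ?_
      rw [Finset.sum_comm]
      exact Finset.sum_congr rfl fun b _ => Finset.sum_congr rfl fun m _ => by ring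
    · rw [sum_rotate, Finset.sum_congr rfl fun _ _ => Finset.sum_comm]
      exact Finset.sum_congr rfl fun a _ => Finset.sum_congr rfl fun b _ =>
        Finset.sum_congr rfl fun m _ => by ring
  have e3 : ∑ s, ∑ m, christoffel g m i (I s) y
        * ∑ a, ∑ b, (g y)⁻¹ a b * T y (icons a (icons b (Function.update I s m)))
      = ∑ a, ∑ b, (g y)⁻¹ a b * ∑ s, ∑ m, christoffel g m i (I s) y
        * T y (icons a (icons b (Function.update I s m))) := by
    simp only [Finset.mul_sum]
    rw [Finset.sum_congr rfl fun s _ => (sum_rotate _).symm, ← sum_rotate]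
    exact Finset.sum_congr rfl fun a _ => Finset.sum_congr rfl fun b _ =>
      Finset.sum_congr rfl fun s _ => Finset.sum_congr rfl fun m _ => by ring
  simp only [Finset.sum_add_distrib, e2, e3, mul_sub, mul_add, Finset.sum_sub_distrib]
  ring

end cov

/-- Contraction operators are parallel: Φ' performs the contraction Φ and carries the derivative
slot along. It depends neither on the metric nor on the field. -/
theorem IsContr.exists_cov {n : ℕ} {ι κ : Type} [Fintype ι] [DecidableEq ι] {Φ : MOp n ι κ}
    (h : IsContr Φ) : ∀ [Fintype κ] [DecidableEq κ],
    ∃ Φ' : MOp n (Option ι) (Option κ), IsContr Φ' ∧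
      ∀ (g : MetricField n) (U : Set (Coord n)) (T : Coord n → Arr n ι), IsMetricOn g U →
        ArrSmoothOn T U → ∀ y ∈ U, cov g (fun z => Φ (g z)⁻¹ (T z)) y = Φ' (g y)⁻¹ (cov g T y) := by
  classical
  induction h with
  | id =>
    intro _ _
    exact ⟨_, .id, fun g U T _ _ y _ => by congr!⟩
  | @reindex κ κ' Φ e _ ih =>
    intro _ _
    let _ : Fintype κ := Fintype.ofEquiv _ e.symm
    obtain ⟨Φ', h', H⟩ := ih
    refine ⟨_, h'.reindex e.optionCongr, fun g U T hg hT y hy => ?_⟩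
    rw [cov_reindex, H g U T hg hT y hy]
  | @ctr κ Φ hΦ ih =>
    intro _ _
    obtain ⟨Φ', h', H⟩ := ih
    refine ⟨_, (h'.reindex (optionRotate κ)).ctr, fun g U T hg hT y hy => ?_⟩
    rw [cov_ctr hg (hT.isContr hg hΦ) hy]
    rw [← H g U T hg hT y hy]
  | zero =>
    intro _ _
    exact ⟨_, .zero, fun g U T _ _ y _ => cov_zero⟩
  | add h₁ h₂ ih₁ ih₂ =>
    intro _ _
    obtain ⟨Φ₁, h₁', H₁⟩ := ih₁
    obtain ⟨Φ₂, h₂', H₂⟩ := ih₂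
    refine ⟨_, h₁'.add h₂', fun g U T hg hT y hy => ?_⟩
    rw [cov_add hg.isOpen (hT.isContr hg h₁) (hT.isContr hg h₂) hy, H₁ g U T hg hT y hy,
      H₂ g U T hg hT y hy]
  | smul c h ih =>
    intro _ _
    obtain ⟨Φ', h', H⟩ := ih
    refine ⟨_, h'.smul c, fun g U T hg hT y hy => ?_⟩
    rw [cov_const_smul hg.isOpen (hT.isContr hg h) hy, H g U T hg hT y hy]

/-! The Ricci identity and the symmetries of the curvature tensor. -/

section ricci

variable {n : ℕ} {ι : Type} [Fintype ι] [DecidableEq ι] {g : MetricField n} {U : Set (Coord n)}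
  {T : Coord n → Arr n ι} {y : Coord n}

/-- Actions of Γ and Γ' on two different slots commute and cancel in the difference. Only double
actions on the same slot survive, and these form the matrix commutator. -/
theorem sum_sum_update_antisymm (Γ Γ' : Fin n → Fin n → ℝ) (S : Arr n ι) (I : ι → Fin n) :
    (∑ s, ∑ m, Γ m (I s) * ∑ r, ∑ p, Γ' p (Function.update I s m r)
        * S (Function.update (Function.update I s m) r p))
      - (∑ s, ∑ m, Γ' m (I s) * ∑ r, ∑ p, Γ p (Function.update I s m r)
        * S (Function.update (Function.update I s m) r p))
      = -∑ s, ∑ m, (∑ p, (Γ m p * Γ' p (I s) - Γ' m p * Γ p (I s)))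
          * S (Function.update I s m) := by
  have split : ∀ Γ Γ' : Fin n → Fin n → ℝ, (∑ s, ∑ m, Γ m (I s)
        * ∑ r, ∑ p, Γ' p (Function.update I s m r)
        * S (Function.update (Function.update I s m) r p))
      = ∑ s, ∑ r, ∑ m, ∑ p, Γ m (I s) * (Γ' p (Function.update I s m r)
        * S (Function.update (Function.update I s m) r p)) := fun Γ Γ' => by
    refine Finset.sum_congr rfl fun s _ => ?_
    simp only [Finset.mul_sum]
    rw [Finset.sum_comm]
  rw [split Γ Γ', split Γ' Γ, Finset.sum_comm (f := fun s r => ∑ m, ∑ p, Γ' m (I s) * _),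
    ← Finset.sum_sub_distrib, ← Finset.sum_neg_distrib]
  refine Finset.sum_congr rfl fun s _ => ?_
  rw [← Finset.sum_sub_distrib, Finset.sum_eq_single s]
  · simp only [Function.update_self, Function.update_idem]
    rw [Finset.sum_comm, Finset.sum_comm (f := fun m p => Γ' m (I s) * _),
      ← Finset.sum_sub_distrib, ← Finset.sum_neg_distrib]
    refine Finset.sum_congr rfl fun m _ => ?_
    rw [← Finset.sum_sub_distrib, Finset.sum_mul, ← Finset.sum_neg_distrib]
    exact Finset.sum_congr rfl fun p _ => by ring
  · intro r _ hr
    rw [sub_eq_zero, Finset.sum_comm]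
    refine Finset.sum_congr rfl fun m _ => Finset.sum_congr rfl fun p _ => ?_
    rw [Function.update_of_ne hr, Function.update_of_ne hr.symm, Function.update_comm hr]
    ring
  · simp

/-- The expansion is arranged so that, on exchanging i and j, the pure second derivative and the
Γ^m_{ij} term are unchanged and the two sums Γ ∂T trade places. Only ∂Γ and the quadratic terms in Γ
contribute to the commutator. -/
theorem cov_cov_icons (hg : IsMetricOn g U) (hT : ArrSmoothOn T U) (hy : y ∈ U) (i j : Fin n)
    (I : ι → Fin n) :
    cov g (cov g T) y (icons i (icons j I)) =
      pderiv i (pderiv j fun z => T z I) y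
      - (∑ s, ∑ m, pderiv i (christoffel g m j (I s)) y * T y (Function.update I s m))
      - (∑ s, ∑ m, christoffel g m j (I s) y * pderiv i (fun z => T z (Function.update I s m)) y)
      - (∑ s, ∑ m, christoffel g m i (I s) y * pderiv j (fun z => T z (Function.update I s m)) y)
      - (∑ m, christoffel g m i j y * cov g T y (icons m I))
      + ∑ s, ∑ m, christoffel g m i (I s) y * ∑ r, ∑ p,
          christoffel g p j (Function.update I s m r) y
            * T y (Function.update (Function.update I s m) r p) := by
  rw [cov_icons]
  simp only [Fintype.sum_option, icons_none, icons_some, update_icons_none, update_icons_some]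
  have hd : ∀ s m, DifferentiableAt ℝ
      (fun z => christoffel g m j (I s) z * T z (Function.update I s m)) y := fun s m =>
    ((hg.smooth_christoffel _ _ _).diffAt hg.isOpen hy).mul (hT.diffAt hg.isOpen hy _)
  have e1 : pderiv i (fun z => cov g T z (icons j I)) y = pderiv i (pderiv j fun z => T z I) y
      - ((∑ s, ∑ m, pderiv i (christoffel g m j (I s)) y * T y (Function.update I s m))
      + ∑ s, ∑ m, christoffel g m j (I s) y
          * pderiv i (fun z => T z (Function.update I s m)) y) := by
    simp only [cov_icons]
    rw [pderiv_sub (((hT I).pderiv hg.isOpen j).diffAt hg.isOpen hy)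
      (DifferentiableAt.fun_sum fun s _ => DifferentiableAt.fun_sum fun m _ => hd s m),
      pderiv_sum _ fun s _ => DifferentiableAt.fun_sum fun m _ => hd s m,
      ← Finset.sum_add_distrib]
    congr 1
    refine Finset.sum_congr rfl fun s _ => ?_
    rw [pderiv_sum _ fun m _ => hd s m, ← Finset.sum_add_distrib]
    exact Finset.sum_congr rfl fun m _ => pderiv_mul
      ((hg.smooth_christoffel _ _ _).diffAt hg.isOpen hy) (hT.diffAt hg.isOpen hy _) i
  rw [e1]
  simp only [cov_icons _ _ _ j, mul_sub, Finset.sum_sub_distrib]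
  ring

/-- The Ricci identity. -/
theorem ricci_identity (hg : IsMetricOn g U) (hT : ArrSmoothOn T U) (hy : y ∈ U) (i j : Fin n)
    (I : ι → Fin n) :
    cov g (cov g T) y (icons i (icons j I)) - cov g (cov g T) y (icons j (icons i I))
      = -∑ s, ∑ m, riemannUp g m i j (I s) y * T y (Function.update I s m) := by
  rw [cov_cov_icons hg hT hy, cov_cov_icons hg hT hy, pderiv_comm (hT I) hg.isOpen hy i j]
  have e := sum_sum_update_antisymm (fun m p => christoffel g m i p y)
    (fun m p => christoffel g m j p y) (T y) I
  have h1 : ∀ m, christoffel g m i j y = christoffel g m j i y := fun m =>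
    hg.christoffel_symm hy m i j
  simp only [riemannUp, h1, add_mul, sub_mul _ _ (T y _), Finset.sum_add_distrib,
    Finset.sum_sub_distrib] at e ⊢
  linear_combination e

end ricci

section symmetries

variable {n : ℕ} {g : MetricField n} {U : Set (Coord n)} {y : Coord n}

theorem riemannUp_antisymm (g : MetricField n) (h i j l : Fin n) (y : Coord n) :
    riemannUp g h i j l y = -riemannUp g h j i l y := by
  simp only [riemannUp, Finset.sum_sub_distrib]; ring

theorem riemannTensor_apply (g : MetricField n) (y : Coord n) (i j k l : Fin n) :
    riemannTensor g y ![i, j, k, l] = ∑ h, g y k h * riemannUp g h i j l y := rfl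

theorem riemannTensor_antisymm_left (g : MetricField n) (y : Coord n) (i j k l : Fin n) :
    riemannTensor g y ![i, j, k, l] = -riemannTensor g y ![j, i, k, l] := by
  simp only [riemannTensor_apply, ← Finset.sum_neg_distrib]
  exact Finset.sum_congr rfl fun h _ => by rw [riemannUp_antisymm]; ring

namespace IsMetricOn

theorem riemannUp_eq (hg : IsMetricOn g U) (hy : y ∈ U) (m i j l : Fin n) :
    riemannUp g m i j l y = ∑ k, (g y)⁻¹ m k * riemannTensor g y ![i, j, k, l] := by
  simp only [riemannTensor_apply, Finset.mul_sum, ← mul_assoc]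
  rw [Finset.sum_comm]
  simp only [← Finset.sum_mul, hg.sum_inv_mul hy]
  simp

theorem cov_metric (hg : IsMetricOn g U) (hy : y ∈ U) :
    cov g (fun z (I : Fin 2 → Fin n) => g z (I 0) (I 1)) y = 0 := by
  refine ext_icons fun i I => ?_
  rw [cov_icons, hg.pderiv_metric hy, Fin.sum_univ_two, Finset.sum_add_distrib]
  simp [mul_comm]

/-- The Ricci identity applied to the parallel tensor g. -/
theorem riemannTensor_antisymm_right (hg : IsMetricOn g U) (hy : y ∈ U) (i j k l : Fin n) :
    riemannTensor g y ![i, j, k, l] = -riemannTensor g y ![i, j, l, k] := by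
  have hT : ArrSmoothOn (fun z (I : Fin 2 → Fin n) => g z (I 0) (I 1)) U := fun I => hg.smooth _ _
  have h := ricci_identity hg hT hy i j ![l, k]
  have h0 : cov g (cov g (fun z (I : Fin 2 → Fin n) => g z (I 0) (I 1))) y = 0 := by
    rw [cov_congr hg.isOpen (fun z hz => hg.cov_metric hz) hy, cov_zero]
  rw [h0, Fin.sum_univ_two] at h
  simp only [riemannTensor_apply]
  simp at h
  have : ∑ x, riemannUp g x i j l y * g y x k = ∑ x, g y k x * riemannUp g x i j l y :=
    Finset.sum_congr rfl fun x _ => by rw [hg.symm hy x k, mul_comm]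
  rw [this] at h
  have : ∑ x, riemannUp g x i j k y * g y l x = ∑ x, g y l x * riemannUp g x i j k y :=
    Finset.sum_congr rfl fun x _ => mul_comm _ _
  rw [this] at h
  linarith

/-- The connection is torsion-free: once the lower indices of Γ are put in a fixed order, all terms
of the cyclic sum cancel in pairs. -/
theorem riemannUp_bianchi (hg : IsMetricOn g U) (hy : y ∈ U) (h i j l : Fin n) :
    riemannUp g h i j l y + riemannUp g h j l i y + riemannUp g h l i j y = 0 := by
  have hp : ∀ a b c, pderiv a (christoffel g h b c) y = pderiv a (christoffel g h c b) y :=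
    fun a b c => pderiv_congr hg.isOpen (fun z hz => hg.christoffel_symm hz h b c) hy a
  simp only [riemannUp, Finset.sum_sub_distrib]
  rw [hp i j l, hp j i l, hp l i j]
  simp only [hg.christoffel_symm hy _ j l, hg.christoffel_symm hy _ i l,
    hg.christoffel_symm hy _ i j]
  ring

theorem riemannTensor_bianchi (hg : IsMetricOn g U) (hy : y ∈ U) (i j k l : Fin n) :
    riemannTensor g y ![i, j, k, l] + riemannTensor g y ![j, l, k, i]
      + riemannTensor g y ![l, i, k, j] = 0 := by
  simp only [riemannTensor_apply, ← Finset.sum_add_distrib, ← mul_add, hg.riemannUp_bianchi hy]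
  simp

/-- The classical combination of four first Bianchi identities with the two antisymmetries. -/
theorem riemannTensor_pair_symm (hg : IsMetricOn g U) (hy : y ∈ U) (i j k l : Fin n) :
    riemannTensor g y ![i, j, k, l] = riemannTensor g y ![k, l, i, j] := by
  have b := hg.riemannTensor_bianchi hy
  have a₁ := riemannTensor_antisymm_left g y
  have a₂ := hg.riemannTensor_antisymm_right hy
  have b₁ := b i j k l
  have b₂ := b j k l i
  have b₃ := b k l i j
  have b₄ := b l i j k
  linarith [a₁ i j k l, a₂ i j k l, a₁ j l k i, a₂ j l k i, a₁ l i k j, a₂ l i k j,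
    a₁ j k l i, a₂ j k l i, a₁ k i l j, a₂ k i l j, a₁ i j l k, a₂ i j l k, a₁ k l i j, a₂ k l i j,
    a₁ l j i k, a₂ l j i k, a₁ j k i l, a₂ j k i l, a₁ l i j k, a₂ l i j k, a₁ i k j l, a₂ i k j l,
    a₁ k l j i, a₂ k l j i, a₁ j i k l, a₁ i l k j, a₁ l j k i, a₁ k j l i, a₁ i k l j]

end IsMetricOn

end symmetries

/-! The second Bianchi identity and the derivatives of the curvature tensor. -/

section relations

variable {n : ℕ} {ι : Type} [Fintype ι] [DecidableEq ι] {g : MetricField n} {U : Set (Coord n)}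
  {T : Coord n → Arr n ι} {y : Coord n}

/-- Slot permutations and scalars commute with ∇, so a symmetry (c = 1) or antisymmetry (c = -1)
passes to the derivative. -/
theorem cov_eq_mul_of_eq_mul (hU : IsOpen U) (hT : ArrSmoothOn T U) (σ : ι ≃ ι) (c : ℝ)
    (h : ∀ z ∈ U, ∀ I, T z (I ∘ σ) = c * T z I) (hy : y ∈ U) (i : Fin n) (I : ι → Fin n) :
    cov g T y (icons i (I ∘ σ)) = c * cov g T y (icons i I) := by
  have e := cov_congr (g := g) (T := fun z => reindex σ (T z)) (T' := fun z => c • T z) hU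
    (fun z hz => funext fun I => h z hz I) hy
  rw [cov_reindex, cov_const_smul hU hT hy] at e
  have := congrFun e (icons i I)
  simpa [reindex, icons_optionCongr] using this

theorem cov_cyclic (hU : IsOpen U) (hT : ArrSmoothOn T U) (σ τ : ι ≃ ι)
    (h : ∀ z ∈ U, ∀ I, T z I + T z (I ∘ σ) + T z (I ∘ τ) = 0) (hy : y ∈ U) (i : Fin n)
    (I : ι → Fin n) : cov g T y (icons i I) + cov g T y (icons i (I ∘ σ))
      + cov g T y (icons i (I ∘ τ)) = 0 := by
  have e := cov_congr (g := g) (T := fun z => T z + reindex σ (T z) + reindex τ (T z))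
    (T' := fun z => 0) hU (fun z hz => funext fun I => h z hz I) hy
  rw [cov_zero, cov_add hU (hT.add (hT.reindex σ)) (hT.reindex τ) hy,
    cov_add hU hT (hT.reindex σ) hy, cov_reindex, cov_reindex] at e
  have := congrFun e (icons i I)
  simpa [reindex, icons_optionCongr] using this

end relations

theorem comp_vec4 {n : ℕ} (a b c d : Fin n) (σ : Fin 4 → Fin 4) :
    ![a, b, c, d] ∘ σ = ![![a, b, c, d] (σ 0), ![a, b, c, d] (σ 1), ![a, b, c, d] (σ 2),
      ![a, b, c, d] (σ 3)] := by
  funext s; fin_cases s <;> rfl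

theorem vec4_eta {n : ℕ} (I : Fin 4 → Fin n) : ![I 0, I 1, I 2, I 3] = I := by
  funext s; fin_cases s <;> rfl

/-- The slots used to pair the third slot of a `4`-tensor with a covector. -/
def pairThirdEquiv : Fin 4 ⊕ Unit ≃ Option (Option (Fin 3)) :=
  Equiv.ofBijective
    (Sum.elim ![some (some 0), some (some 1), none, some (some 2)] fun _ => some none) (by decide)

/-- Exchange the two pairs of slots of a `4`-tensor. -/
def pairSwap : Fin 4 ≃ Fin 4 := Equiv.ofBijective ![2, 3, 0, 1] (by decide)

/-- Exchange the first two slots of a `4`-tensor. -/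
def leftSwap : Fin 4 ≃ Fin 4 := Equiv.ofBijective ![1, 0, 2, 3] (by decide)

/-- The cyclic rotation of the first three slots of the derivative of a `4`-tensor. -/
def cycleThree : Option (Fin 4) ≃ Option (Fin 4) :=
  Equiv.ofBijective (fun o => o.elim (some 0) ![some 1, none, some 2, some 3]) (by decide)

theorem icons_cycleThree {n : ℕ} (a b c d e : Fin n) :
    icons a ![b, c, d, e] ∘ cycleThree = icons b ![c, a, d, e] := by
  funext o
  rcases o with _ | s
  · rfl
  · fin_cases s <;> rfl

theorem vec4_leftSwap {n : ℕ} (a b c d : Fin n) : ![a, b, c, d] ∘ leftSwap = ![b, a, c, d] :=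
  comp_vec4 a b c d leftSwap

theorem vec4_pairSwap {n : ℕ} (a b c d : Fin n) : ![a, b, c, d] ∘ pairSwap = ![c, d, a, b] :=
  comp_vec4 a b c d pairSwap

namespace IsMetricOn

variable {n : ℕ} {g : MetricField n} {U : Set (Coord n)} {y : Coord n}

/-- The Jacobi identity for covariant derivatives, applied to a covector field w; it replaces normal
coordinates. The antisymmetrisation of ∇∇∇w is computed in two ways: by commuting the two outer
derivatives, and by differentiating the Ricci identity for w. The terms Rm ∗ ∇w agree up to the
first Bianchi identity, which leaves the cyclic sum of ∇Rm contracted with w. -/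
theorem bianchi_contracted (hg : IsMetricOn g U) (hy : y ∈ U) (i j k l m : Fin n) :
    ∑ a, (g y)⁻¹ a m * (cov g (riemannTensor g) y (icons i ![j, k, a, l])
      + cov g (riemannTensor g) y (icons j ![k, i, a, l])
      + cov g (riemannTensor g) y (icons k ![i, j, a, l])) = 0 := by
  -- The coordinate covector dx^m: contraction with it picks out the raised index m.
  set w : Coord n → Arr n Unit := fun _ I => if I () = m then 1 else 0 with hw
  have hws : ArrSmoothOn w U := fun I => contDiffOn_const
  have hW1 := hws.cov hg
  have hW2 := hW1.cov hg
  set V : Coord n → Arr n (Fin 3) := fun z =>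
    ctr (g z)⁻¹ (reindex pairThirdEquiv (tmul (riemannTensor g z) (w z))) with hV
  have hRw := (hg.smooth_riemannTensor).tmul hws
  have hidx : ∀ a b j k l : Fin n,
      (icons a (icons b ![j, k, l]) ∘ pairThirdEquiv) ∘ Sum.inl = ![j, k, a, l] := by
    intro a b j k l; funext s; fin_cases s <;> rfl
  have hidx' : ∀ a b j k l : Fin n,
      (icons a (icons b ![j, k, l]) ∘ pairThirdEquiv) ∘ Sum.inr = fun _ => b := by
    intro a b j k l; funext s; rfl
  have hidx3 : ∀ j k l : Fin n, (icons j (icons k fun _ : Unit => l)) =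
      ![j, k, l] ∘ (fun o : Option (Option Unit) => o.elim 0 fun o => o.elim 1 fun _ => 2) := by
    intro j k l; funext o; rcases o with _ | _ | _ <;> rfl
  have hVapp : ∀ z ∈ U, ∀ j k l, V z ![j, k, l]
      = ∑ p, riemannUp g p j k l z * w z fun _ => p := by
    intro z hz j k l
    simp only [hV, ctr, reindex, tmul, hidx, hidx', hg.riemannUp_eq hz, Finset.sum_mul]
    rw [Finset.sum_comm]
    refine Finset.sum_congr rfl fun p _ => Finset.sum_congr rfl fun q _ => ?_
    rw [hg.inv_symm hz p q]; ring
  have hcomm : ∀ z ∈ U, ∀ j k l, cov g (cov g w) z (icons j (icons k fun _ => l))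
      - cov g (cov g w) z (icons k (icons j fun _ => l)) = -V z ![j, k, l] := by
    intro z hz j k l
    rw [ricci_identity hg hws hz, hVapp z hz]
    simp only [Finset.univ_unique, Finset.sum_singleton]
    congr 1
  have hVs : ArrSmoothOn V U := hRw.isContr hg (IsContr.id.reindex pairThirdEquiv).ctr
  let e3 : Option (Option Unit) ≃ Fin 3 := Equiv.ofBijective
    (fun o : Option (Option Unit) => o.elim 0 fun o => o.elim 1 fun _ => 2) (by decide)
  -- The Ricci identity for w holds on all of U, so it may be differentiated.
  have hdcomm : ∀ i j k l, cov g (cov g (cov g w)) y (icons i (icons j (icons k fun _ => l)))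
      - cov g (cov g (cov g w)) y (icons i (icons k (icons j fun _ => l)))
      = -cov g V y (icons i ![j, k, l]) := by
    intro i j k l
    have e := cov_congr (g := g)
      (T := fun z => reindex e3 (cov g (cov g w) z)
        + (-1 : ℝ) • reindex e3 (reindex (optionSwap Unit) (cov g (cov g w) z)))
      (T' := fun z => (-1 : ℝ) • V z) hg.isOpen (fun z hz => funext fun I => by
        have := hcomm z hz (I 0) (I 1) (I 2)
        have hI : ![I 0, I 1, I 2] = I := by funext s; fin_cases s <;> rfl
        have hI' : I ∘ e3 = icons (I 0) (icons (I 1) fun _ => I 2) := by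
          rw [hidx3, hI]; rfl
        rw [hI] at this
        simp only [Pi.add_apply, Pi.smul_apply, smul_eq_mul, reindex, hI', icons_optionSwap]
        linarith) hy
    rw [cov_const_smul hg.isOpen hVs hy, cov_add hg.isOpen (hW2.reindex e3)
      ((((hW2.reindex (optionSwap Unit))).reindex e3).const_smul (-1)) hy,
      cov_const_smul hg.isOpen ((hW2.reindex (optionSwap Unit)).reindex e3) hy,
      cov_reindex, cov_reindex, cov_reindex] at e
    have := congrFun e (icons i ![j, k, l])
    have hI' : ![j, k, l] ∘ e3 = icons j (icons k fun _ => l) := (hidx3 j k l).symm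
    simp only [Pi.add_apply, Pi.smul_apply, smul_eq_mul, reindex, icons_optionCongr, hI',
      icons_optionSwap] at this
    linarith
  have hcovV : ∀ i j k l, cov g V y (icons i ![j, k, l])
      = (∑ a, (g y)⁻¹ a m * cov g (riemannTensor g) y (icons i ![j, k, a, l]))
        + ∑ p, riemannUp g p j k l y * cov g w y (icons i fun _ => p) := by
    intro i j k l
    have e := cov_ctr hg (hRw.reindex pairThirdEquiv) hy
    rw [cov_reindex, cov_tmul hg.isOpen hg.smooth_riemannTensor hws hy] at e
    rw [hV, e]
    have h1 : ∀ a b, (((icons a (icons b (icons i ![j, k, l])) ∘ optionRotate (Fin 3)) ∘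
        pairThirdEquiv.optionCongr) ∘ optionSumLeft (Fin 4) Unit) ∘ Sum.inl
        = icons i ![j, k, a, l] := by
      intro a b; rw [icons_optionRotate, icons_optionCongr]
      funext o; rcases o with _ | s
      · rfl
      · fin_cases s <;> rfl
    have h2 : ∀ a b, (((icons a (icons b (icons i ![j, k, l])) ∘ optionRotate (Fin 3)) ∘
        pairThirdEquiv.optionCongr) ∘ optionSumLeft (Fin 4) Unit) ∘ Sum.inr = fun _ => b := by
      intro a b; funext o; rfl
    have h3 : ∀ a b, (((icons a (icons b (icons i ![j, k, l])) ∘ optionRotate (Fin 3)) ∘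
        pairThirdEquiv.optionCongr) ∘ optionSumRight (Fin 4) Unit) ∘ Sum.inl = ![j, k, a, l] := by
      intro a b; funext s; fin_cases s <;> rfl
    have h4 : ∀ a b, (((icons a (icons b (icons i ![j, k, l])) ∘ optionRotate (Fin 3)) ∘
        pairThirdEquiv.optionCongr) ∘ optionSumRight (Fin 4) Unit) ∘ Sum.inr
        = icons i fun _ => b := by
      intro a b; funext o; rcases o with _ | _ <;> rfl
    simp only [ctr, reindex, Pi.add_apply, tmul, h1, h2, h3, h4, mul_add, Finset.sum_add_distrib]
    congr 1
    · refine Finset.sum_congr rfl fun a _ => ?_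
      simp [hw]
    · simp only [hg.riemannUp_eq hy, Finset.sum_mul]
      rw [Finset.sum_comm]
      refine Finset.sum_congr rfl fun p _ => Finset.sum_congr rfl fun q _ => ?_
      rw [hg.inv_symm hy p q]; ring
  have hthird : ∀ i j k, cov g (cov g (cov g w)) y (icons i (icons j (icons k fun _ => l)))
      - cov g (cov g (cov g w)) y (icons j (icons i (icons k fun _ => l)))
      = -(∑ p, riemannUp g p i j k y * cov g w y (icons p fun _ => l))
        - ∑ p, riemannUp g p i j l y * cov g w y (icons k fun _ => p) := by
    intro i j k
    rw [ricci_identity hg hW1 hy]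
    simp only [Fintype.sum_option, icons_none, icons_some, update_icons_none, update_icons_some,
      Finset.univ_unique, Finset.sum_singleton, neg_add, sub_eq_add_neg]
    congr 2
  have hb : (∑ p, riemannUp g p i j k y * cov g w y (icons p fun _ => l))
      + (∑ p, riemannUp g p j k i y * cov g w y (icons p fun _ => l))
      + (∑ p, riemannUp g p k i j y * cov g w y (icons p fun _ => l)) = 0 := by
    simp only [← Finset.sum_add_distrib, ← add_mul, hg.riemannUp_bianchi hy]
    simp
  simp only [mul_add, Finset.sum_add_distrib]
  linarith [hthird i j k, hthird j k i, hthird k i j, hdcomm i j k l, hdcomm j k i l,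
    hdcomm k i j l, hcovV i j k l, hcovV j k i l, hcovV k i j l]

/-- The second Bianchi identity. -/
theorem cov_riemannTensor_bianchi (hg : IsMetricOn g U) (hy : y ∈ U) (i j k q l : Fin n) :
    cov g (riemannTensor g) y (icons i ![j, k, q, l])
      + cov g (riemannTensor g) y (icons j ![k, i, q, l])
      + cov g (riemannTensor g) y (icons k ![i, j, q, l]) = 0 := by
  have h : ∀ F : Fin n → ℝ, (∀ m, ∑ a, (g y)⁻¹ a m * F a = 0) → F q = 0 := by
    intro F hF
    have : ∑ m, g y m q * ∑ a, (g y)⁻¹ a m * F a = F q := by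
      simp only [Finset.mul_sum]
      rw [Finset.sum_comm]
      have : ∀ a, ∑ m, g y m q * ((g y)⁻¹ a m * F a) = (if a = q then 1 else 0) * F a := by
        intro a
        rw [← hg.sum_inv_mul hy, Finset.sum_mul]
        exact Finset.sum_congr rfl fun m _ => by ring
      simp [this]
    rw [← this]; simp [hF]
  exact h _ fun m => hg.bianchi_contracted hy i j k l m

theorem cov_riemannTensor_antisymm (hg : IsMetricOn g U) (hy : y ∈ U) (q i j k l : Fin n) :
    cov g (riemannTensor g) y (icons q ![i, j, k, l])
      = -cov g (riemannTensor g) y (icons q ![j, i, k, l]) := by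
  have := cov_eq_mul_of_eq_mul (g := g) hg.isOpen hg.smooth_riemannTensor leftSwap (-1)
    (fun z hz I => by
      rw [← vec4_eta I, vec4_leftSwap, riemannTensor_antisymm_left]; simp) hy q ![j, i, k, l]
  rw [vec4_leftSwap] at this
  simpa using this

theorem cov_riemannTensor_pair_symm (hg : IsMetricOn g U) (hy : y ∈ U) (q i j k l : Fin n) :
    cov g (riemannTensor g) y (icons q ![i, j, k, l])
      = cov g (riemannTensor g) y (icons q ![k, l, i, j]) := by
  have := cov_eq_mul_of_eq_mul (g := g) hg.isOpen hg.smooth_riemannTensor pairSwap 1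
    (fun z hz I => by
      rw [← vec4_eta I, vec4_pairSwap, hg.riemannTensor_pair_symm hz]; simp) hy q ![k, l, i, j]
  rw [vec4_pairSwap] at this
  simpa using this

theorem cov_cov_riemannTensor_antisymm (hg : IsMetricOn g U) (hy : y ∈ U) (p q i j k l : Fin n) :
    cov g (cov g (riemannTensor g)) y (icons p (icons q ![i, j, k, l]))
      = -cov g (cov g (riemannTensor g)) y (icons p (icons q ![j, i, k, l])) := by
  have := cov_eq_mul_of_eq_mul (g := g) hg.isOpen (hg.smooth_riemannTensor.cov hg)
    leftSwap.optionCongr (-1) (fun z hz I => by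
      rw [← icons_eta I, icons_optionCongr, ← vec4_eta (I ∘ some), vec4_leftSwap,
        hg.cov_riemannTensor_antisymm hz]; simp) hy p (icons q ![j, i, k, l])
  rw [icons_optionCongr, vec4_leftSwap] at this
  simpa using this

theorem cov_cov_riemannTensor_pair_symm (hg : IsMetricOn g U) (hy : y ∈ U) (p q i j k l : Fin n) :
    cov g (cov g (riemannTensor g)) y (icons p (icons q ![i, j, k, l]))
      = cov g (cov g (riemannTensor g)) y (icons p (icons q ![k, l, i, j])) := by
  have := cov_eq_mul_of_eq_mul (g := g) hg.isOpen (hg.smooth_riemannTensor.cov hg)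
    pairSwap.optionCongr 1 (fun z hz I => by
      rw [← icons_eta I, icons_optionCongr, ← vec4_eta (I ∘ some), vec4_pairSwap,
        hg.cov_riemannTensor_pair_symm hz]; simp) hy p (icons q ![k, l, i, j])
  rw [icons_optionCongr, vec4_pairSwap] at this
  simpa using this

theorem cov_cov_riemannTensor_bianchi (hg : IsMetricOn g U) (hy : y ∈ U) (p i j k q l : Fin n) :
    cov g (cov g (riemannTensor g)) y (icons p (icons i ![j, k, q, l]))
      + cov g (cov g (riemannTensor g)) y (icons p (icons j ![k, i, q, l]))
      + cov g (cov g (riemannTensor g)) y (icons p (icons k ![i, j, q, l])) = 0 := by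
  have := cov_cyclic (g := g) hg.isOpen (hg.smooth_riemannTensor.cov hg)
    cycleThree (cycleThree.trans cycleThree) (fun z hz I => by
      rw [Equiv.coe_trans, ← Function.comp_assoc, ← icons_eta I, ← vec4_eta (I ∘ some),
        icons_cycleThree, icons_cycleThree]
      exact hg.cov_riemannTensor_bianchi hz _ _ _ _ _) hy p (icons i ![j, k, q, l])
  rw [Equiv.coe_trans, ← Function.comp_assoc, icons_cycleThree, icons_cycleThree] at this
  exact this

end IsMetricOn

/-! Commutators of covariant derivatives as contractions. -/

/-- The slots of the curvature tensor acting as an endomorphism. -/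
def curvatureActEquiv : Fin 4 ≃ Option (Option (Fin 2)) :=
  Equiv.ofBijective ![some (some 0), some (some 1), none, some none] (by decide)

/-- Two additional slots in front. -/
def finTwoSumEquiv (ι : Type) : Fin 2 ⊕ ι ≃ Option (Option ι) where
  toFun
    | .inl 0 => none
    | .inl 1 => some none
    | .inr s => some (some s)
  invFun
    | none => .inl 0
    | some none => .inl 1
    | some (some s) => .inr s
  left_inv := by
    rintro (s | s)
    · fin_cases s <;> rfl
    · rfl
  right_inv := by rintro (_ | _ | s) <;> rfl

/-- Packages the commutator of two derivatives as one universal contraction of Rm ⊗ T, the form in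
which it enters the error calculus. -/
theorem exists_ricci_identity (n : ℕ) (ι : Type) [Fintype ι] [DecidableEq ι] :
    ∃ Φ : MOp n (Fin 4 ⊕ ι) (Option (Option ι)), IsContr Φ ∧
      ∀ (g : MetricField n) (U : Set (Coord n)) (T : Coord n → Arr n ι), IsMetricOn g U →
        ArrSmoothOn T U → ∀ y ∈ U,
          cov g (cov g T) y = reindex (optionSwap ι) (cov g (cov g T) y)
            + Φ (g y)⁻¹ (tmul (riemannTensor g y) (T y)) := by
  obtain ⟨Ψ, hΨ, H⟩ := exists_act_eq n (Fin 2) ι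
  refine ⟨_, ((hΨ.comp (IsContr.id.reindex (curvatureActEquiv.sumCongr (Equiv.refl ι)))).reindex
    (finTwoSumEquiv ι)).neg, fun g U T hg hT y hy => ?_⟩
  have e : reindex (curvatureActEquiv.sumCongr (Equiv.refl ι)) (tmul (riemannTensor g y) (T y))
      = tmul (reindex curvatureActEquiv (riemannTensor g y)) (T y) := rfl
  rw [e, ← H]
  refine ext_icons fun i J => ?_
  rw [← icons_eta J]
  have h := ricci_identity hg hT hy i (J none) (J ∘ some)
  simp only [Pi.add_apply, Pi.neg_apply, reindex, icons_optionSwap]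
  rw [← sub_eq_iff_eq_add', h]
  congr 1
  simp only [act, hg.riemannUp_eq hy, Finset.sum_mul]
  refine Finset.sum_congr rfl fun s _ => Finset.sum_congr rfl fun m _ =>
    Finset.sum_congr rfl fun c _ => ?_
  congr 3
  funext r
  fin_cases r <;> rfl

/-! Families depending on time. -/

/-- Joint smoothness in time and space. -/
def TSmooth {n : ℕ} (J : Set ℝ) (U : Set (Coord n)) (F : ℝ → Coord n → ℝ) : Prop :=
  ContDiffOn ℝ ∞ (fun q : ℝ × Coord n => F q.1 q.2) (J ×ˢ U)

/-- A time interval and a coordinate domain. -/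
structure IsCylinder {n : ℕ} (J : Set ℝ) (U : Set (Coord n)) : Prop where
  ordConnected : J.OrdConnected
  nontrivial : J.Nontrivial
  isOpen : IsOpen U

section time

variable {n : ℕ} {J : Set ℝ} {U : Set (Coord n)} {F F' : ℝ → Coord n → ℝ} {t : ℝ} {y : Coord n}

theorem IsCylinder.interior_nonempty (h : IsCylinder J U) : (interior J).Nonempty := by
  obtain ⟨a, ha, b, hb, hab⟩ := h.nontrivial.exists_lt
  obtain ⟨c, hc⟩ := exists_between hab
  exact ⟨c, mem_interior.2 ⟨Set.Ioo a b, fun x hx => h.ordConnected.out ha hb ⟨hx.1.le, hx.2.le⟩,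
    isOpen_Ioo, hc⟩⟩

theorem IsCylinder.uniqueDiffOn_time (h : IsCylinder J U) : UniqueDiffOn ℝ J :=
  uniqueDiffOn_convex h.ordConnected.convex h.interior_nonempty

theorem IsCylinder.uniqueDiffOn (h : IsCylinder J U) : UniqueDiffOn ℝ (J ×ˢ U) :=
  h.uniqueDiffOn_time.prod h.isOpen.uniqueDiffOn

/-- Second derivatives within a set are symmetric at points of the closure of its interior; this
makes endpoint times of J admissible. -/
theorem IsCylinder.subset_closure_interior (h : IsCylinder J U) :
    J ×ˢ U ⊆ closure (interior (J ×ˢ U)) := by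
  rw [interior_prod_eq, h.isOpen.interior_eq, closure_prod_eq,
    (h.ordConnected.convex : Convex ℝ J).closure_interior_eq_closure_of_nonempty_interior h.interior_nonempty]
  exact Set.prod_mono subset_closure subset_closure

theorem TSmooth.slice (hF : TSmooth J U F) (ht : t ∈ J) : ContDiffOn ℝ ∞ (F t) U :=
  ContDiffOn.comp (g := fun q : ℝ × Coord n => F q.1 q.2) (t := J ×ˢ U) hF
    (contDiff_prodMk_right t).contDiffOn fun _ hz => ⟨ht, hz⟩

theorem TSmooth.hasFDerivWithinAt (hF : TSmooth J U F) (ht : t ∈ J) (hy : y ∈ U) :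
    HasFDerivWithinAt (fun q : ℝ × Coord n => F q.1 q.2)
      (fderivWithin ℝ (fun q : ℝ × Coord n => F q.1 q.2) (J ×ˢ U) (t, y)) (J ×ˢ U) (t, y) :=
  (hF.differentiableOn (by simp) (t, y) ⟨ht, hy⟩).hasFDerivWithinAt

theorem TSmooth.hasDerivWithinAt (hF : TSmooth J U F) (ht : t ∈ J) (hy : y ∈ U) :
    HasDerivWithinAt (fun s => F s y)
      (fderivWithin ℝ (fun q : ℝ × Coord n => F q.1 q.2) (J ×ˢ U) (t, y) (1, 0)) J t := by
  have h := (hF.hasFDerivWithinAt ht hy).comp_hasDerivWithinAt (f := fun s => (s, y)) t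
    ((hasDerivWithinAt_id t J).prodMk (hasDerivWithinAt_const t J y))
    (fun s hs => (⟨hs, hy⟩ : (s, y) ∈ J ×ˢ U))
  exact h

theorem TSmooth.pderiv_eq (h : IsCylinder J U) (hF : TSmooth J U F) (ht : t ∈ J) (hy : y ∈ U)
    (i : Fin n) : pderiv i (F t) y
      = fderivWithin ℝ (fun q : ℝ × Coord n => F q.1 q.2) (J ×ˢ U) (t, y)
          (0, EuclideanSpace.single i 1) := by
  have h1 := (hF.hasFDerivWithinAt ht hy).comp (f := fun z => (t, z)) (s := U) y
    ((hasFDerivWithinAt_const t y U).prodMk (hasFDerivWithinAt_id y U))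
    (fun z hz => (⟨ht, hz⟩ : (t, z) ∈ J ×ˢ U))
  have h2 := h1.hasFDerivAt (h.isOpen.mem_nhds hy)
  rw [pderiv, show F t = (fun q : ℝ × Coord n => F q.1 q.2) ∘ fun z => (t, z) from rfl, h2.fderiv]
  simp

theorem TSmooth.fderivWithin (h : IsCylinder J U) (hF : TSmooth J U F) (w : ℝ × Coord n) :
    TSmooth J U fun t y =>
      fderivWithin ℝ (fun q : ℝ × Coord n => F q.1 q.2) (J ×ˢ U) (t, y) w :=
  (ContDiffOn.fderivWithin (m := ∞) hF h.uniqueDiffOn (by simp)).clm_apply contDiffOn_const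

theorem TSmooth.congr (hF : TSmooth J U F) (h : ∀ t ∈ J, ∀ y ∈ U, F' t y = F t y) :
    TSmooth J U F' := ContDiffOn.congr hF fun q hq => h q.1 hq.1 q.2 hq.2

theorem TSmooth.pderiv (h : IsCylinder J U) (hF : TSmooth J U F) (i : Fin n) :
    TSmooth J U fun t => pderiv i (F t) :=
  (hF.fderivWithin h _).congr fun _ ht _ hy => hF.pderiv_eq h ht hy i

/-- Time derivatives commute with partial derivatives. -/
theorem TSmooth.hasDerivWithinAt_pderiv (h : IsCylinder J U) (hF : TSmooth J U F)
    (hF' : ∀ t ∈ J, ∀ y ∈ U, HasDerivWithinAt (fun s => F s y) (F' t y) J t)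
    (ht : t ∈ J) (hy : y ∈ U) (i : Fin n) :
    HasDerivWithinAt (fun s => _root_.pderiv i (F s) y) (_root_.pderiv i (F' t) y) J t := by
  set f : ℝ × Coord n → ℝ := fun q => F q.1 q.2 with hf
  have hd : DifferentiableWithinAt ℝ (_root_.fderivWithin ℝ f (J ×ˢ U)) (J ×ˢ U) (t, y) :=
    (ContDiffOn.fderivWithin (m := ∞) hF h.uniqueDiffOn (by simp)).differentiableOn
      (by simp) (t, y) ⟨ht, hy⟩
  have hU : UniqueDiffWithinAt ℝ (J ×ˢ U) (t, y) := h.uniqueDiffOn (t, y) ⟨ht, hy⟩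
  have hsec : ∀ w w' : ℝ × Coord n,
      _root_.fderivWithin ℝ (fun q => _root_.fderivWithin ℝ f (J ×ˢ U) q w') (J ×ˢ U) (t, y) w
        = _root_.fderivWithin ℝ (_root_.fderivWithin ℝ f (J ×ˢ U)) (J ×ˢ U) (t, y) w w' := by
    intro w w'
    rw [fderivWithin_clm_apply hU hd (differentiableWithinAt_const _)]
    simp
  have hsymm := (ContDiffWithinAt.isSymmSndFDerivWithinAt (hF (t, y) ⟨ht, hy⟩)
    (by simpa using WithTop.coe_le_coe.2 (le_top : (2 : ℕ∞) ≤ ⊤)) h.uniqueDiffOn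
    (h.subset_closure_interior ⟨ht, hy⟩) ⟨ht, hy⟩).eq
  have e1 := (hF.fderivWithin h (0, EuclideanSpace.single i 1)).hasDerivWithinAt ht hy
  have e2 := (hF.fderivWithin h (1, 0)).pderiv_eq h ht hy i
  rw [hsec] at e1 e2
  -- Time derivatives within J are unique, so F' agrees on all of U with the derivative of F in the
  -- direction (1, 0) and can be replaced by it under ∂_i.
  have e3 : _root_.pderiv i (F' t) y
      = _root_.pderiv i (fun y => _root_.fderivWithin ℝ f (J ×ˢ U) (t, y) (1, 0)) y :=
    pderiv_congr h.isOpen (fun z hz => (h.uniqueDiffOn_time t ht).eq_deriv _ (hF' t ht z hz)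
      (hF.hasDerivWithinAt ht hz)) hy i
  rw [e3, e2, hsymm]
  exact e1.congr (fun s hs => hF.pderiv_eq h hs hy i) (hF.pderiv_eq h ht hy i)

end time

/-! Variation of the connection and of the curvature. -/

/-- A smooth family of Riemannian metrics on a coordinate domain. -/
structure IsMetricFamily {n : ℕ} (J : Set ℝ) (U : Set (Coord n)) (G : ℝ → MetricField n) : Prop
    extends IsCylinder J U where
  smooth : ∀ i j, TSmooth J U fun t z => G t z i j
  posDef : ∀ t ∈ J, ∀ y ∈ U, (G t y).PosDef

/-- `T` is a jointly smooth family of array fields with time derivative `T'`. -/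
structure HasTDeriv {n : ℕ} {ι : Type} (J : Set ℝ) (U : Set (Coord n))
    (T T' : ℝ → Coord n → Arr n ι) : Prop where
  smooth : ∀ I, TSmooth J U fun t z => T t z I
  deriv : ∀ t ∈ J, ∀ y ∈ U, ∀ I, HasDerivWithinAt (fun s => T s y I) (T' t y I) J t

/-- The slots of the three terms in the variation of the Christoffel symbols. -/
def christoffelEquiv₁ : Option (Fin 2) ≃ Option (Option Unit) :=
  Equiv.ofBijective (fun o => o.elim (some (some ())) ![some none, none]) (by decide)

/-- See `christoffelEquiv₁`. -/
def christoffelEquiv₂ : Option (Fin 2) ≃ Option (Option Unit) :=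
  Equiv.ofBijective (fun o => o.elim (some none) ![some (some ()), none]) (by decide)

/-- See `christoffelEquiv₁`. -/
def christoffelEquiv₃ : Option (Fin 2) ≃ Option (Option Unit) :=
  Equiv.ofBijective (fun o => o.elim none ![some (some ()), some none]) (by decide)

/-- The lowered variation of the Christoffel symbols in terms of the covariant derivative of the
variation of the metric. -/
def christoffelVar {n : ℕ} (W : Arr n (Option (Fin 2))) : Arr n (Option (Option Unit)) :=
  (1 / 2 : ℝ) • (reindex christoffelEquiv₁ W + reindex christoffelEquiv₂ W
    + (-1 : ℝ) • reindex christoffelEquiv₃ W)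

theorem christoffelVar_icons {n : ℕ} (W : Arr n (Option (Fin 2))) (p d i : Fin n) :
    christoffelVar W (icons p (icons d fun _ => i))
      = 1 / 2 * (W (icons i ![d, p]) + W (icons d ![i, p]) - W (icons p ![i, d])) := by
  have h1 : icons p (icons d fun _ => i) ∘ christoffelEquiv₁ = icons i ![d, p] := by
    funext o
    rcases o with _ | s
    · rfl
    · fin_cases s <;> rfl
  have h2 : icons p (icons d fun _ => i) ∘ christoffelEquiv₂ = icons d ![i, p] := by
    funext o
    rcases o with _ | s
    · rfl
    · fin_cases s <;> rfl
  have h3 : icons p (icons d fun _ => i) ∘ christoffelEquiv₃ = icons p ![i, d] := by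
    funext o
    rcases o with _ | s
    · rfl
    · fin_cases s <;> rfl
  simp only [christoffelVar, reindex, Pi.add_apply, Pi.smul_apply, smul_eq_mul, h1, h2, h3]
  ring

theorem isContr_christoffelVar {n : ℕ} :
    IsContr (n := n) (fun _ W => christoffelVar W) :=
  (((IsContr.id.reindex _).add (IsContr.id.reindex _)).add
    ((IsContr.id.reindex _).smul (-1))).smul (1 / 2)

/-- One additional slot in front. -/
def unitSumEquiv (ι : Type) : Unit ⊕ ι ≃ Option ι where
  toFun
    | .inl _ => none
    | .inr s => some s
  invFun
    | none => .inl ()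
    | some s => .inr s
  left_inv := by rintro (_ | s) <;> rfl
  right_inv := by rintro (_ | s) <;> rfl

namespace HasTDeriv

variable {n : ℕ} {ι κ : Type} {J : Set ℝ} {U : Set (Coord n)} {T T' S S' : ℝ → Coord n → Arr n ι}
  {t : ℝ}

theorem smooth' (hC : IsCylinder J U) (h : HasTDeriv J U T T') (I : ι → Fin n) :
    TSmooth J U fun t z => T' t z I :=
  ((h.smooth I).fderivWithin hC (1, 0)).congr fun t ht y hy =>
    (hC.uniqueDiffOn_time t ht).eq_deriv _ (h.deriv t ht y hy I)
      ((h.smooth I).hasDerivWithinAt ht hy)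

theorem slice' (hC : IsCylinder J U) (h : HasTDeriv J U T T') (ht : t ∈ J) :
    ArrSmoothOn (T' t) U := fun I => (h.smooth' hC I).slice ht

theorem congr_deriv (h : HasTDeriv J U T T') (e : ∀ t ∈ J, ∀ y ∈ U, T' t y = S' t y) :
    HasTDeriv J U T S' :=
  ⟨h.smooth, fun t ht y hy I => by rw [← e t ht y hy]; exact h.deriv t ht y hy I⟩

theorem reindex (e : ι ≃ κ) (h : HasTDeriv J U T T') :
    HasTDeriv J U (fun t z => reindex e (T t z)) (fun t z => _root_.reindex e (T' t z)) :=
  ⟨fun _ => h.smooth _, fun t ht y hy _ => h.deriv t ht y hy _⟩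

end HasTDeriv

namespace IsMetricFamily

variable {n : ℕ} {ι : Type} {J : Set ℝ} {U : Set (Coord n)} {G : ℝ → MetricField n}
  {v : ℝ → Coord n → Arr n (Fin 2)} {t : ℝ} {y : Coord n}

theorem isMetricOn (hG : IsMetricFamily J U G) (ht : t ∈ J) : IsMetricOn (G t) U :=
  ⟨hG.isOpen, fun i j => (hG.smooth i j).slice ht, hG.posDef t ht⟩

theorem smooth_inv (hG : IsMetricFamily J U G) (i j : Fin n) :
    TSmooth J U fun t z => (G t z)⁻¹ i j :=
  contDiffOn_matrix_inv (A := fun q : ℝ × Coord n => G q.1 q.2) hG.smooth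
    (fun _ hq => (hG.isMetricOn hq.1).det_ne_zero hq.2) i j

theorem smooth_christoffel (hG : IsMetricFamily J U G) (m i j : Fin n) :
    TSmooth J U fun t => christoffel (G t) m i j := by
  unfold christoffel TSmooth
  refine contDiffOn_const.mul (ContDiffOn.sum fun p _ => (hG.smooth_inv m p).mul ?_)
  exact (((hG.smooth _ _).pderiv hG.1 _).add ((hG.smooth _ _).pderiv hG.1 _)).sub
    ((hG.smooth _ _).pderiv hG.1 _)

theorem smooth_riemannUp (hG : IsMetricFamily J U G) (h i j l : Fin n) :
    TSmooth J U fun t => riemannUp (G t) h i j l := by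
  unfold riemannUp TSmooth
  refine ContDiffOn.add (ContDiffOn.sub ?_ ?_) (ContDiffOn.sum fun p _ => ContDiffOn.sub ?_ ?_)
  · exact (hG.smooth_christoffel _ _ _).pderiv hG.1 _
  · exact (hG.smooth_christoffel _ _ _).pderiv hG.1 _
  · exact (hG.smooth_christoffel _ _ _).mul (hG.smooth_christoffel _ _ _)
  · exact (hG.smooth_christoffel _ _ _).mul (hG.smooth_christoffel _ _ _)

/-- The variation of the metric is `v`. -/
def HasVar (J : Set ℝ) (U : Set (Coord n)) (G : ℝ → MetricField n)
    (v : ℝ → Coord n → Arr n (Fin 2)) : Prop :=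
  HasTDeriv J U (fun t z (I : Fin 2 → Fin n) => G t z (I 0) (I 1)) v

theorem HasVar.hasDeriv (hv : HasVar J U G v) (ht : t ∈ J) (hy : y ∈ U) (i j : Fin n) :
    HasDerivWithinAt (fun s => G s y i j) (v t y ![i, j]) J t :=
  hv.deriv t ht y hy ![i, j]

theorem HasVar.symm (hG : IsMetricFamily J U G) (hv : HasVar J U G v) (ht : t ∈ J) (hy : y ∈ U)
    (i j : Fin n) : v t y ![i, j] = v t y ![j, i] :=
  (hG.uniqueDiffOn_time t ht).eq_deriv _ (hv.hasDeriv ht hy i j)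
    ((hv.hasDeriv ht hy j i).congr (fun _ hs => (hG.isMetricOn hs).symm hy i j)
      ((hG.isMetricOn ht).symm hy i j))

theorem cov_vec2 (g : MetricField n) (w : Coord n → Arr n (Fin 2)) (y : Coord n) (p i j : Fin n) :
    cov g w y (icons p ![i, j]) = pderiv p (fun z => w z ![i, j]) y
      - ((∑ m, christoffel g m p i y * w y ![m, j]) + ∑ m, christoffel g m p j y * w y ![i, m]) := by
  rw [cov_icons, Fin.sum_univ_two]
  congr 2
  · refine Finset.sum_congr rfl fun m _ => ?_
    congr 2; funext s; fin_cases s <;> rfl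
  · refine Finset.sum_congr rfl fun m _ => ?_
    congr 2; funext s; fin_cases s <;> rfl

/-- The variation of the Christoffel symbols. -/
theorem hasDeriv_christoffel (hG : IsMetricFamily J U G) (hv : HasVar J U G v) (ht : t ∈ J)
    (hy : y ∈ U) (m i d : Fin n) :
    HasDerivWithinAt (fun s => christoffel (G s) m i d y)
      (∑ p, (G t y)⁻¹ m p * christoffelVar (cov (G t) (v t) y) (icons p (icons d fun _ => i)))
      J t := by
  have hg := hG.isMetricOn ht
  -- Joint smoothness provides some derivative c. Its value is found by differentiating the lowered
  -- identity `sum_mul_christoffel`, which does not involve the inverse metric.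
  have hsm : ∀ m, ∃ c, HasDerivWithinAt (fun s => christoffel (G s) m i d y) c J t := fun m =>
    ⟨_, (hG.smooth_christoffel m i d).hasDerivWithinAt ht hy⟩
  choose c hc using hsm
  have hp : ∀ k i j, HasDerivWithinAt (fun s => pderiv k (fun z => G s z i j) y)
      (pderiv k (fun z => v t z ![i, j]) y) J t := fun k i j =>
    (hG.smooth i j).hasDerivWithinAt_pderiv (F' := fun t z => v t z ![i, j]) hG.1
      (fun t ht y hy => hv.hasDeriv ht hy i j) ht hy k
  have key : ∀ k, ∑ m, (v t y ![k, m] * christoffel (G t) m i d y + G t y k m * c m)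
      = (1 / 2) * (pderiv i (fun z => v t z ![d, k]) y + pderiv d (fun z => v t z ![i, k]) y
        - pderiv k (fun z => v t z ![i, d]) y) := by
    intro k
    have h1 : HasDerivWithinAt (fun s => ∑ m, G s y k m * christoffel (G s) m i d y)
        (∑ m, (v t y ![k, m] * christoffel (G t) m i d y + G t y k m * c m)) J t :=
      HasDerivWithinAt.fun_sum fun m _ => (hv.hasDeriv ht hy k m).mul (hc m)
    have h2 := (((hp i d k).add (hp d i k)).sub (hp k i d)).const_mul (1 / 2)
    refine (hG.uniqueDiffOn_time t ht).eq_deriv _ h1 (h2.congr (fun s hs => ?_) ?_)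
    · exact (hG.isMetricOn hs).sum_mul_christoffel hy k i d
    · exact hg.sum_mul_christoffel hy k i d
  -- The term v ∗ Γ from the product rule combines with ∂v into covariant derivatives of v.
  have low : ∀ k, ∑ m, G t y k m * c m
      = christoffelVar (cov (G t) (v t) y) (icons k (icons d fun _ => i)) := by
    intro k
    have := key k
    rw [Finset.sum_add_distrib] at this
    rw [christoffelVar_icons, cov_vec2, cov_vec2, cov_vec2]
    simp only [hg.christoffel_symm hy _ d i, hg.christoffel_symm hy _ k i,
      hg.christoffel_symm hy _ k d, hv.symm hG ht hy d, hv.symm hG ht hy _ k,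
      hv.symm hG ht hy i] at this ⊢
    simp only [mul_comm (v t y _)] at this
    linarith
  have : ∑ p, (G t y)⁻¹ m p * christoffelVar (cov (G t) (v t) y) (icons p (icons d fun _ => i))
      = c m := by
    simp only [← low, Finset.mul_sum, ← mul_assoc]
    rw [Finset.sum_comm]
    simp only [← Finset.sum_mul, hg.sum_inv_mul hy]
    simp
  rw [this]
  exact hc m

/-- The variation of the inverse metric. -/
theorem hasDeriv_inv (hG : IsMetricFamily J U G) (hv : HasVar J U G v) (ht : t ∈ J)
    (hy : y ∈ U) (a b : Fin n) :
    HasDerivWithinAt (fun s => (G s y)⁻¹ a b)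
      (-∑ m, ((G t y)⁻¹ a m * (1 / 2 * ∑ c, (G t y)⁻¹ b c * v t y ![c, m])
        + (1 / 2 * ∑ c, (G t y)⁻¹ a c * v t y ![c, m]) * (G t y)⁻¹ m b)) J t := by
  have hg := hG.isMetricOn ht
  have hsm : ∀ a b, ∃ c, HasDerivWithinAt (fun s => (G s y)⁻¹ a b) c J t := fun a b =>
    ⟨_, (hG.smooth_inv a b).hasDerivWithinAt ht hy⟩
  choose c hc using hsm
  set V : Matrix (Fin n) (Fin n) ℝ := Matrix.of fun i j => v t y ![i, j] with hV
  have hVs : V.transpose = V := by ext i j; exact hv.symm hG ht hy j i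
  have hBs : (G t y)⁻¹.transpose = (G t y)⁻¹ := by ext i j; exact hg.inv_symm hy j i
  -- Since v is symmetric, PᵀA and AP each equal v/2. The result then has the shape that
  -- `hasDerivWithinAt_pairing` expects.
  have key := matrix_deriv_inv (A := G t y) (B := (G t y)⁻¹) (dA := V) (dB := Matrix.of c)
    (P := (1 / 2 : ℝ) • ((G t y)⁻¹ * V)) (hg.mul_inv hy) ?_ ?_
  · have := congrFun (congrFun key a) b
    convert hc a b using 1
    rw [show c a b = Matrix.of c a b from rfl, this]
    simp only [Matrix.neg_apply, Matrix.add_apply, Matrix.mul_apply, Matrix.transpose_apply,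
      Matrix.smul_apply, smul_eq_mul, hV, Matrix.of_apply, Finset.sum_add_distrib]
  · ext i j
    simp only [Matrix.add_apply, Matrix.mul_apply, Matrix.of_apply, Matrix.zero_apply]
    rw [← Finset.sum_add_distrib]
    have h1 : HasDerivWithinAt (fun s => ∑ m, G s y i m * (G s y)⁻¹ m j)
        (∑ m, (V i m * (G t y)⁻¹ m j + G t y i m * c m j)) J t :=
      HasDerivWithinAt.fun_sum fun m _ => (hv.hasDeriv ht hy i m).mul (hc m j)
    exact (hG.uniqueDiffOn_time t ht).eq_deriv _ h1 ((hasDerivWithinAt_const t J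
      (if i = j then (1 : ℝ) else 0)).congr (fun s hs => (hG.isMetricOn hs).sum_mul_inv hy i j)
      (hg.sum_mul_inv hy i j))
  · rw [Matrix.transpose_smul, Matrix.transpose_mul, hVs, hBs, Matrix.smul_mul, Matrix.mul_smul,
      Matrix.mul_assoc, hg.inv_mul hy, ← Matrix.mul_assoc, hg.mul_inv hy, mul_one, one_mul,
      ← add_smul]
    norm_num

/-- The variation of a covariant derivative. -/
theorem hasTDeriv_cov [Fintype ι] [DecidableEq ι] (hG : IsMetricFamily J U G)
    (hv : HasVar J U G v) {T T' : ℝ → Coord n → Arr n ι} (hT : HasTDeriv J U T T') :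
    HasTDeriv J U (fun t => cov (G t) (T t)) (fun t y => cov (G t) (T' t) y
      + (-1 : ℝ) • reindex (unitSumEquiv ι)
        (act (G t y)⁻¹ (christoffelVar (cov (G t) (v t) y)) (T t y))) := by
  refine ⟨fun I => ?_, fun t ht y hy I => ?_⟩
  · exact ContDiffOn.sub ((hT.smooth _).pderiv hG.1 _) (ContDiffOn.sum fun s _ =>
      ContDiffOn.sum fun m _ => (hG.smooth_christoffel _ _ _).mul (hT.smooth _))
  · have h := ((hT.smooth (I ∘ some)).hasDerivWithinAt_pderiv hG.1
      (fun t ht y hy => hT.deriv t ht y hy _) ht hy (I none)).sub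
      (HasDerivWithinAt.fun_sum fun s (_ : s ∈ Finset.univ) => HasDerivWithinAt.fun_sum
        fun m (_ : m ∈ Finset.univ) => (hG.hasDeriv_christoffel hv ht hy m (I none)
          (I (some s))).mul (hT.deriv t ht y hy (Function.update (I ∘ some) s m)))
    refine h.congr_deriv ?_
    simp only [cov, Pi.add_apply, Pi.smul_apply, smul_eq_mul, reindex, act,
      Finset.sum_add_distrib, Finset.sum_mul]
    have e2 : (I ∘ unitSumEquiv ι) ∘ Sum.inr = I ∘ some := rfl
    have e3 : ∀ s : ι, (I ∘ unitSumEquiv ι) (Sum.inr s) = I (some s) := fun s => rfl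
    have e4 : (I ∘ unitSumEquiv ι) ∘ Sum.inl = fun _ => I none := rfl
    simp only [e2, e3, e4]
    ring

end IsMetricFamily

section raise

variable {n : ℕ} {g : MetricField n} {U : Set (Coord n)} {y : Coord n}

theorem cov_three_slots (g : MetricField n) (S : Coord n → Arr n (Option (Option Unit)))
    (y : Coord n) (i k l j : Fin n) :
    cov g S y (icons i (icons k (icons l fun _ => j)))
      = pderiv i (fun z => S z (icons k (icons l fun _ => j))) y
        - ((∑ m, christoffel g m i k y * S y (icons m (icons l fun _ => j)))
          + (∑ m, christoffel g m i l y * S y (icons k (icons m fun _ => j)))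
          + ∑ m, christoffel g m i j y * S y (icons k (icons l fun _ => m))) := by
  rw [cov_icons]
  simp only [Fintype.sum_option, icons_none, icons_some, update_icons_none, update_icons_some,
    Finset.univ_unique, Finset.sum_singleton]
  have : ∀ m, Function.update (fun _ : Unit => j) default m = fun _ => m := fun m => by
    funext r; simp
  simp only [this, add_assoc]

/-- The partial derivative of a tensor with one raised slot. -/
theorem pderiv_raise (hg : IsMetricOn g U) {S : Coord n → Arr n (Option (Option Unit))}
    (hS : ArrSmoothOn S U) (hy : y ∈ U) (h i l j : Fin n) :
    pderiv i (fun z => ∑ k, (g z)⁻¹ h k * S z (icons k (icons l fun _ => j))) y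
      = ∑ k, (g y)⁻¹ h k * cov g S y (icons i (icons k (icons l fun _ => j)))
        - ∑ m, christoffel g h i m y * ∑ k, (g y)⁻¹ m k * S y (icons k (icons l fun _ => j))
        + ∑ m, christoffel g m i l y * ∑ k, (g y)⁻¹ h k * S y (icons k (icons m fun _ => j))
        + ∑ m, christoffel g m i j y * ∑ k, (g y)⁻¹ h k * S y (icons k (icons l fun _ => m)) := by
  have hi := fun k => (hg.smooth_inv h k).diffAt hg.isOpen hy
  have hs := fun k => hS.diffAt hg.isOpen hy (icons k (icons l fun _ => j))
  rw [pderiv_sum _ fun k _ => (hi k).fun_mul (hs k)]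
  simp only [fun k => pderiv_mul (hi k) (hs k) i, hg.pderiv_inv hy, cov_three_slots,
    Finset.sum_add_distrib, mul_sub, mul_add, Finset.sum_sub_distrib, neg_add, add_mul, neg_mul]
  have c1 : ∑ k, (∑ m, (g y)⁻¹ h m * christoffel g k i m y) * S y (icons k (icons l fun _ => j))
      = ∑ k, (g y)⁻¹ h k * ∑ m, christoffel g m i k y * S y (icons m (icons l fun _ => j)) := by
    simp only [Finset.sum_mul, Finset.mul_sum]
    rw [Finset.sum_comm]
    exact Finset.sum_congr rfl fun k _ => Finset.sum_congr rfl fun m _ => by ring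
  have c2 : ∑ k, (∑ m, christoffel g h i m y * (g y)⁻¹ m k) * S y (icons k (icons l fun _ => j))
      = ∑ m, christoffel g h i m y * ∑ k, (g y)⁻¹ m k * S y (icons k (icons l fun _ => j)) := by
    simp only [Finset.sum_mul, Finset.mul_sum]
    rw [Finset.sum_comm]
    exact Finset.sum_congr rfl fun k _ => Finset.sum_congr rfl fun m _ => by ring
  have c3 : ∑ k, (g y)⁻¹ h k * ∑ m, christoffel g m i l y * S y (icons k (icons m fun _ => j))
      = ∑ m, christoffel g m i l y * ∑ k, (g y)⁻¹ h k * S y (icons k (icons m fun _ => j)) := by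
    simp only [Finset.mul_sum]
    rw [Finset.sum_comm]
    exact Finset.sum_congr rfl fun k _ => Finset.sum_congr rfl fun m _ => by ring
  have c4 : ∑ k, (g y)⁻¹ h k * ∑ m, christoffel g m i j y * S y (icons k (icons l fun _ => m))
      = ∑ m, christoffel g m i j y * ∑ k, (g y)⁻¹ h k * S y (icons k (icons l fun _ => m)) := by
    simp only [Finset.mul_sum]
    rw [Finset.sum_comm]
    exact Finset.sum_congr rfl fun k _ => Finset.sum_congr rfl fun m _ => by ring
  simp only [Finset.sum_neg_distrib, c1, c2, c3, c4]
  ring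

end raise

namespace IsMetricFamily

variable {n : ℕ} {J : Set ℝ} {U : Set (Coord n)} {G : ℝ → MetricField n}
  {v : ℝ → Coord n → Arr n (Fin 2)} {t : ℝ} {y : Coord n}

theorem smooth_christoffelVar (hG : IsMetricFamily J U G) (hv : HasVar J U G v) (ht : t ∈ J) :
    ArrSmoothOn (fun z => christoffelVar (cov (G t) (v t) z)) U :=
  ((hv.slice' hG.1 ht).cov (hG.isMetricOn ht)).isContr (hG.isMetricOn ht) isContr_christoffelVar

/-- The variation of the curvature. -/
theorem hasDeriv_riemannUp (hG : IsMetricFamily J U G) (hv : HasVar J U G v) (ht : t ∈ J)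
    (hy : y ∈ U) (h i j l : Fin n) :
    HasDerivWithinAt (fun s => riemannUp (G s) h i j l y)
      (∑ k, (G t y)⁻¹ h k *
        (cov (G t) (fun z => christoffelVar (cov (G t) (v t) z)) y
            (icons i (icons k (icons l fun _ => j)))
          - cov (G t) (fun z => christoffelVar (cov (G t) (v t) z)) y
            (icons j (icons k (icons l fun _ => i))))) J t := by
  have hg := hG.isMetricOn ht
  have hS := hG.smooth_christoffelVar hv ht
  have hp : ∀ i j l, HasDerivWithinAt (fun s => pderiv i (christoffel (G s) h j l) y)
      (pderiv i (fun z => ∑ k, (G t z)⁻¹ h k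
        * christoffelVar (cov (G t) (v t) z) (icons k (icons l fun _ => j))) y) J t := fun i j l =>
    (hG.smooth_christoffel h j l).hasDerivWithinAt_pderiv (F' := fun t z => ∑ k, (G t z)⁻¹ h k
        * christoffelVar (cov (G t) (v t) z) (icons k (icons l fun _ => j))) hG.1
      (fun t ht y hy => hG.hasDeriv_christoffel hv ht hy h j l) ht hy i
  have hΓ := hG.hasDeriv_christoffel hv ht hy
  have key := ((hp i j l).sub (hp j i l)).add (HasDerivWithinAt.fun_sum
    fun p (_ : p ∈ Finset.univ) => ((hΓ h i p).mul (hΓ p j l)).sub ((hΓ h j p).mul (hΓ p i l)))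
  refine key.congr_deriv ?_
  -- Palatini's identity: the Christoffel corrections for the raised slot and for the last lower
  -- slot cancel the product rule for ΓΓ, and those for the derivative index cancel by symmetry of
  -- Γ.
  rw [pderiv_raise hg hS hy, pderiv_raise hg hS hy]
  simp only [Finset.sum_sub_distrib, Finset.sum_add_distrib, mul_sub,
    fun m => hg.christoffel_symm hy m j i]
  simp only [mul_comm (∑ k, (G t y)⁻¹ h k * _)]
  ring

theorem cov_christoffelVar (hG : IsMetricFamily J U G) (hv : HasVar J U G v) (ht : t ∈ J)
    (hy : y ∈ U) (i p d j : Fin n) :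
    cov (G t) (fun z => christoffelVar (cov (G t) (v t) z)) y
        (icons i (icons p (icons d fun _ => j)))
      = 1 / 2 * (cov (G t) (cov (G t) (v t)) y (icons i (icons j ![d, p]))
        + cov (G t) (cov (G t) (v t)) y (icons i (icons d ![j, p]))
        - cov (G t) (cov (G t) (v t)) y (icons i (icons p ![j, d]))) := by
  have hg := hG.isMetricOn ht
  have hW := (hv.slice' hG.1 ht).cov hg
  simp only [christoffelVar]
  rw [cov_const_smul hg.isOpen (((hW.reindex _).add (hW.reindex _)).add
      ((hW.reindex _).const_smul _)) hy,
    cov_add hg.isOpen ((hW.reindex _).add (hW.reindex _)) ((hW.reindex _).const_smul _) hy,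
    cov_add hg.isOpen (hW.reindex _) (hW.reindex _) hy,
    cov_const_smul hg.isOpen (hW.reindex _) hy, cov_reindex, cov_reindex, cov_reindex]
  have h1 : icons p (icons d fun _ => j) ∘ christoffelEquiv₁ = icons j ![d, p] := by
    funext o
    rcases o with _ | s
    · rfl
    · fin_cases s <;> rfl
  have h2 : icons p (icons d fun _ => j) ∘ christoffelEquiv₂ = icons d ![j, p] := by
    funext o
    rcases o with _ | s
    · rfl
    · fin_cases s <;> rfl
  have h3 : icons p (icons d fun _ => j) ∘ christoffelEquiv₃ = icons p ![j, d] := by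
    funext o
    rcases o with _ | s
    · rfl
    · fin_cases s <;> rfl
  simp only [Pi.smul_apply, Pi.add_apply, reindex, smul_eq_mul, icons_optionCongr, h1, h2, h3]
  ring

/-- The undifferentiated v comes from lowering an index with the moving metric; the rest is
Palatini's identity. The two terms containing v_{lk} together form a commutator of derivatives. -/
theorem hasDeriv_riemannTensor (hG : IsMetricFamily J U G) (hv : HasVar J U G v) (ht : t ∈ J)
    (hy : y ∈ U) (i j k l : Fin n) :
    HasDerivWithinAt (fun s => riemannTensor (G s) y ![i, j, k, l])
      ((∑ h, v t y ![k, h] * riemannUp (G t) h i j l y)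
        + 1 / 2 * (cov (G t) (cov (G t) (v t)) y (icons i (icons j ![l, k]))
          + cov (G t) (cov (G t) (v t)) y (icons i (icons l ![j, k]))
          - cov (G t) (cov (G t) (v t)) y (icons i (icons k ![j, l]))
          - cov (G t) (cov (G t) (v t)) y (icons j (icons i ![l, k]))
          - cov (G t) (cov (G t) (v t)) y (icons j (icons l ![i, k]))
          + cov (G t) (cov (G t) (v t)) y (icons j (icons k ![i, l])))) J t := by
  have hg := hG.isMetricOn ht
  have key := HasDerivWithinAt.fun_sum fun h (_ : h ∈ Finset.univ) =>
    (hv.hasDeriv ht hy k h).mul (hG.hasDeriv_riemannUp hv ht hy h i j l)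
  refine key.congr_deriv ?_
  rw [Finset.sum_add_distrib]
  congr 1
  have : ∀ F : Fin n → ℝ, ∑ h, G t y k h * ∑ m, (G t y)⁻¹ h m * F m = F k := by
    intro F
    simp only [Finset.mul_sum, ← mul_assoc]
    rw [Finset.sum_comm]
    simp only [← Finset.sum_mul, hg.sum_mul_inv hy]
    simp
  rw [this, cov_christoffelVar hG hv ht hy, cov_christoffelVar hG hv ht hy]
  ring

theorem smooth_riemannTensor (hG : IsMetricFamily J U G) (I : Fin 4 → Fin n) :
    TSmooth J U fun t z => riemannTensor (G t) z I :=
  ContDiffOn.sum fun _ _ => (hG.smooth _ _).mul (hG.smooth_riemannUp _ _ _ _)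

end IsMetricFamily

/-! Solutions of the generalized Ricci flow in a chart and schematic terms. -/

/-- A solution of the metric equation of the generalized Ricci flow in a coordinate domain. -/
structure LocalFlow (n : ℕ) where
  /-- The time interval. -/
  time : Set ℝ
  /-- The coordinate domain. -/
  dom : Set (Coord n)
  /-- The metrics. -/
  met : ℝ → MetricField n
  /-- The forms. -/
  form : ℝ → CompField n 3
  isFamily : IsMetricFamily time dom met
  smooth_form : ∀ t ∈ time, ArrSmoothOn (form t) dom
  evolve : IsMetricFamily.HasVar time dom met fun t y I =>
    -2 * ricciTensor (met t) y (I 0) (I 1) + 1 / 2 * formSquare (met t) (form t) y (I 0) (I 1)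

theorem LocalFlow.isMetricOn {n : ℕ} (X : LocalFlow n) {t : ℝ} (ht : t ∈ X.time) :
    IsMetricOn (X.met t) X.dom := X.isFamily.isMetricOn ht

/-- Array fields that are defined for every solution. -/
abbrev FlowField (n : ℕ) (ι : Type) : Type := LocalFlow n → ℝ → Coord n → Arr n ι

/-- `∇^i Rm`. -/
def curvField (n i : ℕ) : FlowField n (Fin (4 + i)) := fun X t =>
  covDerivIter (X.met t) (riemannTensor (X.met t)) i

/-- `∇^i H`. -/
def formField (n i : ℕ) : FlowField n (Fin (3 + i)) := fun X t =>
  covDerivIter (X.met t) (X.form t) i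

/-- The types of products: `∇^i Rm ⊗ ∇^j Rm`, `∇^i H ⊗ ∇^j H ⊗ ∇^k Rm` and `∇^i H ⊗ ∇^j H`. -/
abbrev ProdType : Type := (ℕ × ℕ) ⊕ (Σ _ : ℕ × ℕ, ℕ × ℕ) ⊕ (ℕ × ℕ)

/-- The slots of a product. -/
def ProdType.Slots : ProdType → Type
  | .inl p => Fin (4 + p.1) ⊕ Fin (4 + p.2)
  | .inr (.inl x) => (Fin (3 + x.1.1) ⊕ Fin (3 + x.2.1)) ⊕ Fin (4 + x.2.2)
  | .inr (.inr p) => Fin (3 + p.1) ⊕ Fin (3 + p.2)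

instance : ∀ s : ProdType, Fintype s.Slots
  | .inl p => inferInstanceAs (Fintype (Fin (4 + p.1) ⊕ Fin (4 + p.2)))
  | .inr (.inl x) =>
    inferInstanceAs (Fintype ((Fin (3 + x.1.1) ⊕ Fin (3 + x.2.1)) ⊕ Fin (4 + x.2.2)))
  | .inr (.inr p) => inferInstanceAs (Fintype (Fin (3 + p.1) ⊕ Fin (3 + p.2)))

instance : ∀ s : ProdType, DecidableEq s.Slots
  | .inl p => inferInstanceAs (DecidableEq (Fin (4 + p.1) ⊕ Fin (4 + p.2)))
  | .inr (.inl x) =>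
    inferInstanceAs (DecidableEq ((Fin (3 + x.1.1) ⊕ Fin (3 + x.2.1)) ⊕ Fin (4 + x.2.2)))
  | .inr (.inr p) => inferInstanceAs (DecidableEq (Fin (3 + p.1) ⊕ Fin (3 + p.2)))

/-- The products. -/
def prodField (n : ℕ) : (s : ProdType) → FlowField n s.Slots
  | .inl p => fun X t y => tmul (curvField n p.1 X t y) (curvField n p.2 X t y)
  | .inr (.inl x) => fun X t y => tmul (tmul (formField n x.1.1 X t y) (formField n x.2.1 X t y))
      (curvField n x.2.2 X t y)
  | .inr (.inr p) => fun X t y => tmul (formField n p.1 X t y) (formField n p.2 X t y)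

/-- The span, with coefficients that do not depend on the solution, of the contractions of the
products of the types in `S`. -/
inductive Schematic {n : ℕ} (S : Set ProdType) {κ : Type} : FlowField n κ → Prop
  | of (s : ProdType) (hs : s ∈ S) {Φ : MOp n s.Slots κ} (h : IsContr Φ) :
      Schematic S fun X t y => Φ (X.met t y)⁻¹ (prodField n s X t y)
  | zero : Schematic S fun _ _ _ => 0
  | add {F F' : FlowField n κ} :
      Schematic S F → Schematic S F' → Schematic S fun X t y => F X t y + F' X t y
  | congr {F F' : FlowField n κ} : Schematic S F →
      (∀ X : LocalFlow n, ∀ t ∈ X.time, ∀ y ∈ X.dom, F' X t y = F X t y) → Schematic S F'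

section fields

variable {n : ℕ} (X : LocalFlow n) {t : ℝ} {y : Coord n}

theorem covDeriv_smooth {k : ℕ} {g : MetricField n} {U : Set (Coord n)} (hg : IsMetricOn g U)
    {T : CompField n k} (hT : ArrSmoothOn T U) : ArrSmoothOn (covDeriv g T) U :=
  (hT.cov hg).reindex (finSuccEquiv k).symm

theorem covDerivIter_smooth {k : ℕ} {g : MetricField n} {U : Set (Coord n)} (hg : IsMetricOn g U)
    {T : CompField n k} (hT : ArrSmoothOn T U) : ∀ l, ArrSmoothOn (covDerivIter g T l) U
  | 0 => hT
  | l + 1 => covDeriv_smooth hg (covDerivIter_smooth hg hT l)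

theorem curvField_smooth (i : ℕ) (ht : t ∈ X.time) : ArrSmoothOn (curvField n i X t) X.dom :=
  covDerivIter_smooth (X.isMetricOn ht) (X.isMetricOn ht).smooth_riemannTensor i

theorem formField_smooth (i : ℕ) (ht : t ∈ X.time) : ArrSmoothOn (formField n i X t) X.dom :=
  covDerivIter_smooth (X.isMetricOn ht) (X.smooth_form t ht) i

theorem prodField_smooth (ht : t ∈ X.time) :
    ∀ s, ArrSmoothOn (prodField n s X t) X.dom
  | .inl _ => (curvField_smooth X _ ht).tmul (curvField_smooth X _ ht)
  | .inr (.inl _) => ((formField_smooth X _ ht).tmul (formField_smooth X _ ht)).tmul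
      (curvField_smooth X _ ht)
  | .inr (.inr _) => (formField_smooth X _ ht).tmul (formField_smooth X _ ht)

theorem cov_curvField (i : ℕ) :
    cov (X.met t) (curvField n i X t) y
      = reindex (finSuccEquiv (4 + i)) (curvField n (i + 1) X t y) := by
  have : curvField n (i + 1) X t y
      = reindex (finSuccEquiv (4 + i)).symm (cov (X.met t) (curvField n i X t) y) := rfl
  rw [this]
  funext I
  simp [reindex, Function.comp_assoc]

theorem cov_formField (i : ℕ) :
    cov (X.met t) (formField n i X t) y
      = reindex (finSuccEquiv (3 + i)) (formField n (i + 1) X t y) := by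
  have : formField n (i + 1) X t y
      = reindex (finSuccEquiv (3 + i)).symm (cov (X.met t) (formField n i X t) y) := rfl
  rw [this]
  funext I
  simp [reindex, Function.comp_assoc]

end fields

theorem tmul_add_left {n : ℕ} {ι κ : Type} (A A' : Arr n ι) (B : Arr n κ) :
    tmul (A + A') B = tmul A B + tmul A' B := by
  funext I; exact add_mul _ _ _

theorem tmul_smul_left {n : ℕ} {ι κ : Type} (c : ℝ) (A : Arr n ι) (B : Arr n κ) :
    tmul (c • A) B = c • tmul A B := by
  funext I; exact mul_assoc _ _ _

/-! ### Closure properties of schematic terms. -/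

namespace Schematic

variable {n : ℕ} {S S' : Set ProdType} {κ μ : Type} {F F' : FlowField n κ}

theorem map (hF : Schematic S F) {Ψ : MOp n κ μ} (hΨ : IsContr Ψ) :
    Schematic S fun X t y => Ψ (X.met t y)⁻¹ (F X t y) := by
  induction hF with
  | of s hs h => exact .of s hs (hΨ.comp h)
  | zero => simpa only [hΨ.map_zero] using .zero
  | add _ _ ih₁ ih₂ => simpa only [hΨ.map_add] using ih₁.add ih₂
  | congr _ e ih => exact ih.congr fun X t ht y hy => by rw [e X t ht y hy]

theorem reindex (hF : Schematic S F) (e : κ ≃ μ) :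
    Schematic S fun X t y => reindex e (F X t y) := hF.map (IsContr.id.reindex e)

theorem ctr {F : FlowField n (Option (Option κ))} (hF : Schematic S F) :
    Schematic S fun X t y => ctr (X.met t y)⁻¹ (F X t y) := hF.map IsContr.id.ctr

theorem smul (c : ℝ) (hF : Schematic S F) : Schematic S fun X t y => c • F X t y :=
  hF.map (IsContr.id.smul c)

theorem mono (h : S ⊆ S') (hF : Schematic S F) : Schematic S' F := by
  induction hF with
  | of s hs hΦ => exact .of s (h hs) hΦ
  | zero => exact .zero
  | add _ _ ih₁ ih₂ => exact ih₁.add ih₂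
  | congr _ e ih => exact ih.congr e

theorem smooth (hF : Schematic S F) (X : LocalFlow n) {t : ℝ} (ht : t ∈ X.time) :
    ArrSmoothOn (F X t) X.dom := by
  induction hF with
  | of s hs hΦ => exact (prodField_smooth X ht s).isContr (X.isMetricOn ht) hΦ
  | zero => exact fun _ => contDiffOn_const
  | add _ _ ih₁ ih₂ => exact ih₁.add ih₂
  | congr _ e ih => exact ih.congr fun z hz => e X t ht z hz

/-- By `tmul_left` it is enough to treat the generating products. -/
theorem tmul_right {ν : Type} (B : FlowField n ν)
    (hS : ∀ s ∈ S, Schematic S' fun X t y => tmul (prodField n s X t y) (B X t y))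
    (hF : Schematic S F) : Schematic S' fun X t y => tmul (F X t y) (B X t y) := by
  induction hF with
  | of s hs hΦ =>
    obtain ⟨Φ', h', H⟩ := hΦ.tmul_left ν
    simpa only [H] using (hS s hs).map h'
  | zero => exact zero.congr fun _ _ _ _ _ => by funext I; simp [tmul]
  | add _ _ ih₁ ih₂ => simpa only [tmul_add_left] using ih₁.add ih₂
  | congr _ e ih => exact ih.congr fun X t ht y hy => by rw [e X t ht y hy]

/-- By `exists_cov` the derivative passes through contractions, so only the Leibniz rule for the
generating products has to be checked. -/
theorem cov_of [Fintype κ] [DecidableEq κ]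
    (hS : ∀ s ∈ S, Schematic S' fun X t => cov (X.met t) (prodField n s X t))
    (hF : Schematic S F) : Schematic S' fun X t => cov (X.met t) (F X t) := by
  induction hF with
  | of s hs hΦ =>
    obtain ⟨Φ', h', H⟩ := hΦ.exists_cov
    exact ((hS s hs).map h').congr fun X t ht y hy =>
      H _ _ _ (X.isMetricOn ht) (prodField_smooth X ht s) y hy
  | zero => exact zero.congr fun _ _ _ _ _ => cov_zero
  | add h₁ h₂ ih₁ ih₂ =>
    exact (ih₁.add ih₂).congr fun X t ht y hy =>
      cov_add (X.isMetricOn ht).isOpen (h₁.smooth X ht) (h₂.smooth X ht) hy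
  | congr _ e ih =>
    exact ih.congr fun X t ht y hy =>
      cov_congr (X.isMetricOn ht).isOpen (fun z hz => e X t ht z hz) hy

end Schematic

/-- The types `∇^i Rm ∗ ∇^j Rm` with `i + j = l`. -/
def curvCurv (l : ℕ) : Set ProdType := {s | ∃ i j, i + j = l ∧ s = .inl (i, j)}

/-- The types `∇^i H ∗ ∇^j H ∗ ∇^k Rm` with `i + j + k = l`. -/
def formFormCurv (l : ℕ) : Set ProdType :=
  {s | ∃ i j k, i + j + k = l ∧ s = .inr (.inl ⟨(i, j + k), (j, k)⟩)}

/-- The types `∇^i H ∗ ∇^j H` with `i + j = l`. -/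
def formForm (l : ℕ) : Set ProdType := {s | ∃ i j, i + j = l ∧ s = .inr (.inr (i, j))}

/-- The types of the error terms in the evolution of `∇^l Rm`. -/
def errorTypes (l : ℕ) : Set ProdType := curvCurv l ∪ formFormCurv l ∪ formForm (l + 2)

namespace Schematic

variable {n : ℕ} {κ μ : Type} {F : FlowField n κ} {l : ℕ}

theorem curv_mul_curv {i j : ℕ} (h : i + j = l) :
    Schematic (n := n) (curvCurv l)
      fun X t y => tmul (curvField n i X t y) (curvField n j X t y) :=
  Schematic.of (S := curvCurv l) (.inl (i, j)) ⟨i, j, h, rfl⟩ .id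

theorem form_mul_form {i j : ℕ} (h : i + j = l) :
    Schematic (n := n) (formForm l)
      fun X t y => tmul (formField n i X t y) (formField n j X t y) :=
  Schematic.of (S := formForm l) (.inr (.inr (i, j))) ⟨i, j, h, rfl⟩ .id

theorem form_mul_form_mul_curv {i j k : ℕ} (h : i + j + k = l) :
    Schematic (n := n) (formFormCurv l) fun X t y =>
      tmul (tmul (formField n i X t y) (formField n j X t y)) (curvField n k X t y) :=
  -- The redundant entry j + k makes these types match nested sums over antidiagonals.
  Schematic.of (S := formFormCurv l) (.inr (.inl ⟨(i, j + k), (j, k)⟩)) ⟨i, j, k, h, rfl⟩ .id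

theorem cov_curvCurv [Fintype κ] [DecidableEq κ] (hF : Schematic (curvCurv l) F) :
    Schematic (curvCurv (l + 1)) fun X t => cov (X.met t) (F X t) := by
  refine hF.cov_of ?_
  rintro _ ⟨i, j, h, rfl⟩
  refine Schematic.congr (((curv_mul_curv (n := n) (i := i + 1) (j := j) (l := l + 1)
    (by omega)).reindex (((finSuccEquiv (4 + i)).sumCongr (Equiv.refl _)).trans
      (optionSumLeft _ _))).add
    ((curv_mul_curv (n := n) (i := i) (j := j + 1) (l := l + 1) (by omega)).reindex
      (((Equiv.refl _).sumCongr (finSuccEquiv (4 + j))).trans (optionSumRight _ _)))) ?_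
  intro X t ht y hy
  refine (cov_tmul (X.isMetricOn ht).isOpen (curvField_smooth X i ht)
    (curvField_smooth X j ht) hy).trans ?_
  rw [cov_curvField, cov_curvField]
  rfl

theorem cov_formForm [Fintype κ] [DecidableEq κ] (hF : Schematic (formForm l) F) :
    Schematic (formForm (l + 1)) fun X t => cov (X.met t) (F X t) := by
  refine hF.cov_of ?_
  rintro _ ⟨i, j, h, rfl⟩
  refine Schematic.congr (((form_mul_form (n := n) (i := i + 1) (j := j) (l := l + 1)
    (by omega)).reindex (((finSuccEquiv (3 + i)).sumCongr (Equiv.refl _)).trans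
      (optionSumLeft _ _))).add
    ((form_mul_form (n := n) (i := i) (j := j + 1) (l := l + 1) (by omega)).reindex
      (((Equiv.refl _).sumCongr (finSuccEquiv (3 + j))).trans (optionSumRight _ _)))) ?_
  intro X t ht y hy
  refine (cov_tmul (X.isMetricOn ht).isOpen (formField_smooth X i ht)
    (formField_smooth X j ht) hy).trans ?_
  rw [cov_formField, cov_formField]
  rfl

/-- The product of a schematic term of type `∇^i H ∗ ∇^j H` with `∇^k Rm`. -/
theorem formForm_mul_curv (hF : Schematic (formForm l) F) (k : ℕ) :
    Schematic (formFormCurv (l + k)) fun X t y => tmul (F X t y) (curvField n k X t y) := by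
  refine hF.tmul_right (curvField n k) ?_
  rintro _ ⟨i, j, h, rfl⟩
  exact form_mul_form_mul_curv (by omega)

theorem cov_formFormCurv [Fintype κ] [DecidableEq κ] (hF : Schematic (formFormCurv l) F) :
    Schematic (formFormCurv (l + 1)) fun X t => cov (X.met t) (F X t) := by
  refine hF.cov_of ?_
  rintro _ ⟨i, j, k, h, rfl⟩
  have h₁ := (cov_formForm (form_mul_form (n := n) (i := i) (j := j) rfl)).formForm_mul_curv k
  rw [show i + j + 1 + k = l + 1 by omega] at h₁
  refine Schematic.congr ((h₁.reindex (optionSumLeft _ _)).add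
    ((form_mul_form_mul_curv (n := n) (i := i) (j := j) (k := k + 1) (l := l + 1)
      (by omega)).reindex
      (((Equiv.refl _).sumCongr (finSuccEquiv (4 + k))).trans (optionSumRight _ _)))) ?_
  intro X t ht y hy
  refine (cov_tmul (X.isMetricOn ht).isOpen ((formField_smooth X i ht).tmul
    (formField_smooth X j ht)) (curvField_smooth X k ht) hy).trans ?_
  rw [cov_curvField]
  rfl

theorem cov_errorTypes [Fintype κ] [DecidableEq κ] (hF : Schematic (errorTypes l) F) :
    Schematic (errorTypes (l + 1)) fun X t => cov (X.met t) (F X t) := by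
  refine hF.cov_of ?_
  rintro s ((hs | hs) | hs)
  · exact (cov_curvCurv (.of s hs .id)).mono fun x hx => .inl (.inl hx)
  · exact (cov_formFormCurv (.of s hs .id)).mono fun x hx => .inl (.inr hx)
  · exact (cov_formForm (.of s hs .id)).mono fun x hx => .inr hx

end Schematic

/-! The evolution of the curvature tensor. -/

/-- The Ricci tensor of a solution. -/
def ricciField (n : ℕ) : FlowField n (Fin 2) := fun X t y I => ricciTensor (X.met t) y (I 0) (I 1)

/-- The square `H_{ikl} H_j^{kl}` of the form of a solution. -/
def squareField (n : ℕ) : FlowField n (Fin 2) := fun X t y I =>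
  formSquare (X.met t) (X.form t) y (I 0) (I 1)

/-- The time derivative of the metric. -/
def metricVar (n : ℕ) : FlowField n (Fin 2) := fun X t y =>
  (-2 : ℝ) • ricciField n X t y + (1 / 2 : ℝ) • squareField n X t y

theorem hasVar_metricVar {n : ℕ} (X : LocalFlow n) :
    IsMetricFamily.HasVar X.time X.dom X.met (metricVar n X) := X.evolve

/-- The slots contracted in the Ricci tensor. -/
def ricciEquiv : Fin 4 ≃ Option (Option (Fin 2)) :=
  Equiv.ofBijective ![some (some 0), none, some (some 1), some none] (by decide)

theorem icons_ricciEquiv {n : ℕ} (k l : Fin n) (I : Fin 2 → Fin n) :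
    icons k (icons l I) ∘ ricciEquiv = ![I 0, k, I 1, l] := by
  funext s; fin_cases s <;> rfl

theorem ricciField_eq {n : ℕ} (X : LocalFlow n) (t : ℝ) (y : Coord n) :
    ricciField n X t y = ctr (X.met t y)⁻¹ (reindex ricciEquiv (riemannTensor (X.met t) y)) := by
  funext I
  simp only [ricciField, ricciTensor, ctr, reindex, icons_ricciEquiv]

/-- The slots contracted in the square of a `3`-form. -/
def squareEquiv : Fin 3 ⊕ Fin 3 ≃ Option (Option (Option (Option (Fin 2)))) :=
  Equiv.ofBijective (Sum.elim ![some (some (some (some 0))), some (some none), none]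
    ![some (some (some (some 1))), some (some (some none)), some none]) (by decide)

theorem squareField_eq {n : ℕ} (X : LocalFlow n) (t : ℝ) (y : Coord n) :
    squareField n X t y = ctr (X.met t y)⁻¹ (ctr (X.met t y)⁻¹
      (reindex squareEquiv (tmul (X.form t y) (X.form t y)))) := by
  funext I
  have h1 : ∀ k p l q : Fin n, (icons l (icons q (icons k (icons p I))) ∘ squareEquiv) ∘ Sum.inl
      = ![I 0, k, l] := by
    intro k p l q; funext s; fin_cases s <;> rfl
  have h2 : ∀ k p l q : Fin n, (icons l (icons q (icons k (icons p I))) ∘ squareEquiv) ∘ Sum.inr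
      = ![I 1, p, q] := by
    intro k p l q; funext s; fin_cases s <;> rfl
  simp only [squareField, formSquare, ctr, reindex, tmul, h1, h2, Finset.mul_sum]
  refine Finset.sum_congr rfl fun k _ => ?_
  rw [Finset.sum_comm]
  exact Finset.sum_congr rfl fun p _ => Finset.sum_congr rfl fun l _ =>
    Finset.sum_congr rfl fun q _ => by ring

theorem schematic_squareField (n : ℕ) : Schematic (formForm 0) (squareField n) :=
  ((((Schematic.form_mul_form (n := n) (i := 0) (j := 0) rfl).reindex squareEquiv).ctr).ctr).congr
    fun X t _ y _ => squareField_eq X t y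

section smooth

variable {n : ℕ} (X : LocalFlow n) {t : ℝ} {y : Coord n}

theorem ricciField_smooth (ht : t ∈ X.time) : ArrSmoothOn (ricciField n X t) X.dom :=
  ((X.isMetricOn ht).smooth_riemannTensor.isContr (X.isMetricOn ht)
    (IsContr.id.reindex ricciEquiv).ctr).congr fun z _ => ricciField_eq X t z

theorem squareField_smooth (ht : t ∈ X.time) : ArrSmoothOn (squareField n X t) X.dom :=
  (schematic_squareField n).smooth X ht

theorem metricVar_smooth (ht : t ∈ X.time) : ArrSmoothOn (metricVar n X t) X.dom :=
  ((ricciField_smooth X ht).const_smul _).add ((squareField_smooth X ht).const_smul _)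

theorem cov_metricVar (ht : t ∈ X.time) (hy : y ∈ X.dom) :
    cov (X.met t) (metricVar n X t) y = (-2 : ℝ) • cov (X.met t) (ricciField n X t) y
      + (1 / 2 : ℝ) • cov (X.met t) (squareField n X t) y := by
  have hU := (X.isMetricOn ht).isOpen
  have hr := ricciField_smooth X ht
  have hs := squareField_smooth X ht
  change cov (X.met t) (fun z => (-2 : ℝ) • ricciField n X t z
    + (1 / 2 : ℝ) • squareField n X t z) y = _
  rw [cov_add hU (hr.const_smul _) (hs.const_smul _) hy, cov_const_smul hU hr hy,
    cov_const_smul hU hs hy]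

theorem cov_cov_metricVar (ht : t ∈ X.time) (hy : y ∈ X.dom) :
    cov (X.met t) (cov (X.met t) (metricVar n X t)) y
      = (-2 : ℝ) • cov (X.met t) (cov (X.met t) (ricciField n X t)) y
      + (1 / 2 : ℝ) • cov (X.met t) (cov (X.met t) (squareField n X t)) y := by
  have hg := X.isMetricOn ht
  have hr := (ricciField_smooth X ht).cov hg
  have hs := (squareField_smooth X ht).cov hg
  rw [cov_congr hg.isOpen (fun z hz => cov_metricVar X ht hz) hy,
    cov_add hg.isOpen (hr.const_smul _) (hs.const_smul _) hy, cov_const_smul hg.isOpen hr hy,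
    cov_const_smul hg.isOpen hs hy]

theorem cov_cov_ricciField (ht : t ∈ X.time) (hy : y ∈ X.dom) (a b c d : Fin n) :
    cov (X.met t) (cov (X.met t) (ricciField n X t)) y (icons a (icons b ![c, d]))
      = ∑ p, ∑ q, (X.met t y)⁻¹ p q *
          cov (X.met t) (cov (X.met t) (riemannTensor (X.met t))) y
            (icons a (icons b ![c, p, d, q])) := by
  have hg := X.isMetricOn ht
  have hR := hg.smooth_riemannTensor
  have h1 : ∀ z ∈ X.dom, cov (X.met t) (ricciField n X t) z = ctr (X.met t z)⁻¹
      (reindex (optionRotate (Fin 2)) (reindex ricciEquiv.optionCongr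
        (cov (X.met t) (riemannTensor (X.met t)) z))) := by
    intro z hz
    rw [cov_congr hg.isOpen (fun w _ => ricciField_eq X t w) hz, cov_ctr hg (hR.reindex _) hz,
      cov_reindex]
  rw [cov_congr hg.isOpen h1 hy, cov_ctr hg (((hR.cov hg).reindex _).reindex _) hy, cov_reindex,
    cov_reindex]
  simp only [ctr, reindex, icons_optionRotate, icons_optionCongr, icons_ricciEquiv]
  rfl

theorem cov_cov_ricciField_symm (ht : t ∈ X.time) (hy : y ∈ X.dom) (a b c d : Fin n) :
    cov (X.met t) (cov (X.met t) (ricciField n X t)) y (icons a (icons b ![c, d]))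
      = cov (X.met t) (cov (X.met t) (ricciField n X t)) y (icons a (icons b ![d, c])) := by
  have hg := X.isMetricOn ht
  rw [cov_cov_ricciField X ht hy, cov_cov_ricciField X ht hy, Finset.sum_comm]
  refine Finset.sum_congr rfl fun p _ => Finset.sum_congr rfl fun q _ => ?_
  rw [hg.cov_cov_riemannTensor_pair_symm hy, hg.inv_symm hy]

end smooth

/-! Products with the variation of the metric. -/

/-- The Ricci part of v gives Rm ∗ ∇^k Rm, the part quadratic in H gives H ∗ H ∗ ∇^k Rm. -/
theorem schematic_metricVar_mul_curv (n k : ℕ) :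
    Schematic (errorTypes k) fun X t y => tmul (metricVar n X t y) (curvField n k X t y) := by
  obtain ⟨Φ, hΦ, H⟩ := (IsContr.id.reindex ricciEquiv).ctr.tmul_left (n := n) (Fin (4 + k))
  have h₁ : Schematic (errorTypes k)
      fun X t y => tmul (ricciField n X t y) (curvField n k X t y) :=
    (((Schematic.curv_mul_curv (n := n) (i := 0) (j := k) (zero_add k)).map hΦ).mono
      fun x hx => .inl (.inl hx)).congr fun X t _ y _ => by rw [ricciField_eq, H]; rfl
  have h₂ : Schematic (errorTypes k)
      fun X t y => tmul (squareField n X t y) (curvField n k X t y) :=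
    ((schematic_squareField n).formForm_mul_curv k).mono fun x hx => .inl (.inr (by simpa using hx))
  refine ((h₁.smul (-2)).add (h₂.smul (1 / 2))).congr fun X t _ y _ => ?_
  rw [metricVar, tmul_add_left, tmul_smul_left, tmul_smul_left]

/-- Controls the action of ∂_tΓ on ∇^k Rm: ∇v contributes ∇Rm or ∇(H ∗ H), hence total order k + 1.
-/
theorem schematic_cov_metricVar_mul_curv (n k : ℕ) :
    Schematic (errorTypes (k + 1))
      fun X t y => tmul (cov (X.met t) (metricVar n X t) y) (curvField n k X t y) := by
  obtain ⟨Ψ, hΨ, HΨ⟩ := (IsContr.id.reindex ricciEquiv).ctr.exists_cov (n := n)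
  obtain ⟨Φ, hΦ, H⟩ := hΨ.tmul_left (Fin (4 + k))
  have h₁ : Schematic (errorTypes (k + 1))
      fun X t y => tmul (cov (X.met t) (ricciField n X t) y) (curvField n k X t y) := by
    refine ((((Schematic.curv_mul_curv (n := n) (i := 1) (j := k) (add_comm 1 k)).reindex
      ((finSuccEquiv 4).sumCongr (Equiv.refl _))).map hΦ).mono
      fun x hx => .inl (.inl hx)).congr fun X t ht y hy => ?_
    have hg := X.isMetricOn ht
    rw [cov_congr hg.isOpen (fun z _ => ricciField_eq X t z) hy,
      HΨ _ _ _ hg hg.smooth_riemannTensor y hy, H]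
    congr 1
  have h₂ : Schematic (errorTypes (k + 1))
      fun X t y => tmul (cov (X.met t) (squareField n X t) y) (curvField n k X t y) :=
    ((schematic_squareField n).cov_formForm.formForm_mul_curv k).mono
      fun x hx => .inl (.inr (by simpa [add_comm] using hx))
  refine ((h₁.smul (-2)).add (h₂.smul (1 / 2))).congr fun X t ht y hy => ?_
  rw [cov_metricVar X ht hy, tmul_add_left, tmul_smul_left, tmul_smul_left]

/-! The curvature tensor. -/

/-- Placement of the slots of a second derivative of a `2`-tensor. -/
def hessMap (a b c d : Fin 4) : Option (Option (Fin 2)) → Fin 4 :=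
  fun o => o.elim a fun o => o.elim b ![c, d]

theorem comp_hessMap {n : ℕ} (I : Fin 4 → Fin n) (a b c d : Fin 4) :
    I ∘ hessMap a b c d = icons (I a) (icons (I b) ![I c, I d]) := by
  funext o
  rcases o with _ | _ | s
  · rfl
  · rfl
  · fin_cases s <;> rfl

/-- The slots contracted in `v_k^m R_{ijml}`. -/
def lowerVarEquiv : Fin 2 ⊕ Fin 4 ≃ Option (Option (Fin 4)) :=
  Equiv.ofBijective (Sum.elim ![some (some 2), none]
    ![some (some 0), some (some 1), some none, some (some 3)]) (by decide)

/-- The slots contracted in the commutator terms of the Laplacian of the curvature. -/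
def commEquiv₁ : Option (Option (Fin 4)) ≃ Option (Option (Fin 4)) :=
  Equiv.ofBijective (fun o => o.elim none fun o => o.elim (some (some 0))
    ![some (some 1), some none, some (some 2), some (some 3)]) (by decide)

/-- See `commEquiv₁`. -/
def commEquiv₂ : Option (Option (Fin 4)) ≃ Option (Option (Fin 4)) :=
  Equiv.ofBijective (fun o => o.elim none fun o => o.elim (some (some 1))
    ![some (some 0), some none, some (some 2), some (some 3)]) (by decide)

theorem icons_commEquiv₁ {n : ℕ} (p q i j k l : Fin n) :
    icons p (icons q ![i, j, k, l]) ∘ commEquiv₁ = icons p (icons i ![j, q, k, l]) := by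
  funext o
  rcases o with _ | _ | s
  · rfl
  · rfl
  · fin_cases s <;> rfl

theorem icons_commEquiv₂ {n : ℕ} (p q i j k l : Fin n) :
    icons p (icons q ![i, j, k, l]) ∘ commEquiv₂ = icons p (icons j ![i, q, k, l]) := by
  funext o
  rcases o with _ | _ | s
  · rfl
  · rfl
  · fin_cases s <;> rfl

/-- The Laplacian of the curvature tensor in terms of second derivatives of the Ricci tensor,
up to the commutators `K_{pi}`. -/
theorem laplacian_riemannTensor {n : ℕ} (X : LocalFlow n) {t : ℝ} {y : Coord n} (ht : t ∈ X.time)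
    (hy : y ∈ X.dom) (K : Arr n (Option (Option (Fin 4))))
    (hK : cov (X.met t) (cov (X.met t) (riemannTensor (X.met t))) y
      = reindex (optionSwap (Fin 4)) (cov (X.met t) (cov (X.met t) (riemannTensor (X.met t))) y) + K)
    (i j k l : Fin n) :
    ctr (X.met t y)⁻¹ (cov (X.met t) (cov (X.met t) (riemannTensor (X.met t))) y) ![i, j, k, l]
      + ctr (X.met t y)⁻¹ (reindex commEquiv₁ K) ![i, j, k, l]
      - ctr (X.met t y)⁻¹ (reindex commEquiv₂ K) ![i, j, k, l]
      = cov (X.met t) (cov (X.met t) (ricciField n X t)) y (icons i (icons k ![l, j]))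
        - cov (X.met t) (cov (X.met t) (ricciField n X t)) y (icons i (icons l ![k, j]))
        - cov (X.met t) (cov (X.met t) (ricciField n X t)) y (icons j (icons k ![l, i]))
        + cov (X.met t) (cov (X.met t) (ricciField n X t)) y (icons j (icons l ![k, i])) := by
  have hg := X.isMetricOn ht
  simp only [cov_cov_ricciField X ht hy]
  simp only [ctr, reindex, icons_commEquiv₁, icons_commEquiv₂]
  simp only [← Finset.sum_add_distrib, ← Finset.sum_sub_distrib]
  refine Finset.sum_congr rfl fun p _ => Finset.sum_congr rfl fun q _ => ?_
  have h : ∀ a b I, cov (X.met t) (cov (X.met t) (riemannTensor (X.met t))) y (icons a (icons b I))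
      = cov (X.met t) (cov (X.met t) (riemannTensor (X.met t))) y (icons b (icons a I))
        + K (icons a (icons b I)) := fun a b I => by
    have := congrFun hK (icons a (icons b I))
    simpa only [Pi.add_apply, reindex, icons_optionSwap] using this
  -- The second Bianchi identity moves the inner derivative of ∇_p∇_q R_{ijkl} to the indices i and
  -- j, and p is commuted past them at the cost of K. Pair symmetry and a second use of the Bianchi
  -- identity turn the divergence into derivatives of traces over p and q, that is of Ricci.
  have b₀ := hg.cov_cov_riemannTensor_bianchi hy p q i j k l
  have a₀ := hg.cov_cov_riemannTensor_antisymm hy p j q i k l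
  have c₁ := h p i ![j, q, k, l]
  have c₂ := h p j ![i, q, k, l]
  have s₁ := hg.cov_cov_riemannTensor_pair_symm hy i p j q k l
  have s₂ := hg.cov_cov_riemannTensor_pair_symm hy j p i q k l
  have b₁ := hg.cov_cov_riemannTensor_bianchi hy i p k l j q
  have b₂ := hg.cov_cov_riemannTensor_bianchi hy j p k l i q
  have a₁ := hg.cov_cov_riemannTensor_antisymm hy i l p k j q
  have a₂ := hg.cov_cov_riemannTensor_antisymm hy j l p k i q
  simp only [← mul_add, ← mul_sub]
  congr 1
  linarith

theorem exists_evolution_curvature (n : ℕ) :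
    ∃ E : FlowField n (Fin 4), Schematic (errorTypes 0) E ∧ ∀ X : LocalFlow n,
      HasTDeriv X.time X.dom (fun t => riemannTensor (X.met t)) fun t y =>
        ctr (X.met t y)⁻¹ (cov (X.met t) (cov (X.met t) (riemannTensor (X.met t))) y)
          + E X t y := by
  obtain ⟨Φ, hΦ, H⟩ := exists_ricci_identity n (Fin 4)
  obtain ⟨Ψ, hΨ, HΨ⟩ := exists_ricci_identity n (Fin 2)
  have hvR := schematic_metricVar_mul_curv n 0
  have hRv : Schematic (errorTypes 0)
      fun X t y => tmul (riemannTensor (X.met t) y) (metricVar n X t y) :=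
    (hvR.reindex (Equiv.sumComm _ _)).congr fun X t _ y _ => IsContr.tmul_comm_eq _ _
  have hRR : Schematic (errorTypes 0)
      fun X t y => tmul (riemannTensor (X.met t) y) (riemannTensor (X.met t) y) :=
    (Schematic.curv_mul_curv (n := n) (i := 0) (j := 0) rfl).mono fun x hx => .inl (.inl hx)
  have hHH : Schematic (errorTypes 0)
      fun X t => cov (X.met t) (cov (X.met t) (squareField n X t)) :=
    (schematic_squareField n).cov_formForm.cov_formForm.mono fun x hx => .inr hx
  have hKK := hRR.map hΦ
  -- The error consists of the lowered-index term v ∗ Rm, half the commutator on v, the commutators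
  -- from the Laplacian, and the four second derivatives of h. The factor 1/4 of the last is 1/2
  -- from the variation of Γ times 1/2 from v.
  refine ⟨_, (((hvR.reindex lowerVarEquiv).ctr).add
    (((hRv.map hΨ).reindex (Equiv.ofBijective (hessMap 0 1 3 2) (by decide))).smul (1 / 2))).add
    (((hKK.reindex commEquiv₁).ctr.add ((hKK.reindex commEquiv₂).ctr.smul (-1))).add
    ((((hHH.reindex (Equiv.ofBijective (hessMap 0 3 1 2) (by decide))).add
      ((hHH.reindex (Equiv.ofBijective (hessMap 0 2 1 3) (by decide))).smul (-1))).add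
      (((hHH.reindex (Equiv.ofBijective (hessMap 1 3 0 2) (by decide))).smul (-1)).add
      (hHH.reindex (Equiv.ofBijective (hessMap 1 2 0 3) (by decide))))).smul (1 / 4))), fun X =>
    ⟨fun I => X.isFamily.smooth_riemannTensor I, fun t ht y hy I => ?_⟩⟩
  have hg := X.isMetricOn ht
  have key := X.isFamily.hasDeriv_riemannTensor (hasVar_metricVar X) ht hy (I 0) (I 1) (I 2) (I 3)
  rw [vec4_eta] at key
  refine key.congr_deriv ?_
  have hlap := laplacian_riemannTensor X ht hy _ (H _ _ _ hg hg.smooth_riemannTensor y hy)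
    (I 0) (I 1) (I 2) (I 3)
  rw [vec4_eta] at hlap
  have hcomm := congrFun (HΨ _ _ _ hg (metricVar_smooth X ht) y hy)
    (icons (I 0) (icons (I 1) ![I 3, I 2]))
  have hlow : ctr (X.met t y)⁻¹ (reindex lowerVarEquiv
      (tmul (metricVar n X t y) (riemannTensor (X.met t) y))) I
      = ∑ h, metricVar n X t y ![I 2, h] * riemannUp (X.met t) h (I 0) (I 1) (I 3) y := by
    have h1 : ∀ a b : Fin n, (icons a (icons b I) ∘ lowerVarEquiv) ∘ Sum.inl = ![I 2, a] := by
      intro a b; funext s; fin_cases s <;> rfl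
    have h2 : ∀ a b : Fin n, (icons a (icons b I) ∘ lowerVarEquiv) ∘ Sum.inr
        = ![I 0, I 1, b, I 3] := by
      intro a b; funext s; fin_cases s <;> rfl
    simp only [ctr, reindex, tmul, h1, h2, hg.riemannUp_eq hy, Finset.mul_sum]
    exact Finset.sum_congr rfl fun a _ => Finset.sum_congr rfl fun b _ => by ring
  simp only [Pi.add_apply, reindex, icons_optionSwap] at hcomm
  have hlow' : ctr (X.met t y)⁻¹ (reindex lowerVarEquiv
      (tmul (metricVar n X t y) (curvField n 0 X t y))) I = _ := hlow
  simp only [Pi.add_apply, Pi.smul_apply, smul_eq_mul, hlow']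
  simp only [reindex, Equiv.coe_ofBijective, comp_hessMap] at hlap ⊢
  have e := fun a b c d => congrFun (cov_cov_metricVar X ht hy) (icons a (icons b ![c, d]))
  simp only [Pi.add_apply, Pi.smul_apply, smul_eq_mul] at e
  -- Symmetry of Ricci reconciles the orders in which its two slots appear in `key` and `hlap`.
  have r := cov_cov_ricciField_symm X ht hy
  linarith [e (I 0) (I 3) (I 1) (I 2), e (I 0) (I 2) (I 1) (I 3), e (I 1) (I 3) (I 0) (I 2),
    e (I 1) (I 2) (I 0) (I 3), r (I 0) (I 3) (I 1) (I 2), r (I 0) (I 2) (I 1) (I 3),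
    r (I 1) (I 3) (I 0) (I 2), r (I 1) (I 2) (I 0) (I 3)]

/-! The evolution of the derivatives of the curvature tensor. -/

theorem ctr_cov_cov_reindex {n : ℕ} {ι κ : Type} [Fintype ι] [Fintype κ] [DecidableEq ι]
    [DecidableEq κ] (g : MetricField n) (T : Coord n → Arr n ι) (e : ι ≃ κ) (y : Coord n) :
    ctr (g y)⁻¹ (cov g (cov g fun z => reindex e (T z)) y)
      = reindex e (ctr (g y)⁻¹ (cov g (cov g T) y)) := by
  have h : (cov g fun z => reindex e (T z)) = fun z => reindex e.optionCongr (cov g T z) :=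
    funext fun z => cov_reindex e
  rw [h, cov_reindex]
  funext I
  simp only [ctr, reindex, icons_optionCongr]

/-- In g^{ab}∇_i∇_a∇_b T the index i moves inwards in two exchanges: past a, with the commutator L
on ∇T, and then past b under ∇_a, with the derivative of the commutator K on T. -/
theorem cov_laplacian {n : ℕ} {ι : Type} [Fintype ι] [DecidableEq ι] {g : MetricField n}
    {U : Set (Coord n)} (hg : IsMetricOn g U) {T : Coord n → Arr n ι} (hT : ArrSmoothOn T U)
    {y : Coord n} (hy : y ∈ U) {K : Coord n → Arr n (Option (Option ι))} (hKs : ArrSmoothOn K U)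
    (hK : ∀ z ∈ U, cov g (cov g T) z = reindex (optionSwap ι) (cov g (cov g T) z) + K z)
    {L : Arr n (Option (Option (Option ι)))}
    (hL : cov g (cov g (cov g T)) y
      = reindex (optionSwap (Option ι)) (cov g (cov g (cov g T)) y) + L) :
    cov g (fun z => ctr (g z)⁻¹ (cov g (cov g T) z)) y
      = ctr (g y)⁻¹ (cov g (cov g (cov g T)) y) + (ctr (g y)⁻¹ (reindex (optionRotate ι) L)
        + ctr (g y)⁻¹ (reindex (optionSwap ι).optionCongr (cov g K y))) := by
  have h2 := (hT.cov hg).cov hg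
  rw [cov_ctr hg h2 hy]
  have hK' : cov g (cov g (cov g T)) y
      = reindex (optionSwap ι).optionCongr (cov g (cov g (cov g T)) y) + cov g K y := by
    conv_lhs => rw [cov_congr hg.isOpen hK hy, cov_add hg.isOpen (h2.reindex _) hKs hy, cov_reindex]
  refine ext_icons fun i I => ?_
  simp only [ctr, reindex, Pi.add_apply, icons_optionRotate, icons_optionCongr,
    ← Finset.sum_add_distrib, ← mul_add, icons_optionSwap]
  refine Finset.sum_congr rfl fun a _ => Finset.sum_congr rfl fun b _ => ?_
  have e1 := congrFun hL (icons i (icons a (icons b I)))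
  have e2 := congrFun hK' (icons a (icons i (icons b I)))
  simp only [Pi.add_apply, reindex, icons_optionSwap, icons_optionCongr] at e1 e2
  rw [e1, e2]
  ring

/-- The induction step adds to the derivative of the old error two new ones: the commutator of ∇
with Δ (`hL`, `hK`) and the action of ∂_tΓ on ∇^l Rm (`hA`). -/
theorem exists_evolution_curvField (n l : ℕ) :
    ∃ E : FlowField n (Fin (4 + l)), Schematic (errorTypes l) E ∧ ∀ X : LocalFlow n,
      HasTDeriv X.time X.dom (curvField n l X) fun t y =>
        ctr (X.met t y)⁻¹ (cov (X.met t) (cov (X.met t) (curvField n l X t)) y) + E X t y := by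
  induction l with
  | zero => exact exists_evolution_curvature n
  | succ l ih =>
    obtain ⟨E, hE, ih⟩ := ih
    obtain ⟨Φ, hΦ, HΦ⟩ := exists_ricci_identity n (Fin (4 + l))
    obtain ⟨Ψ, hΨ, HΨ⟩ := exists_ricci_identity n (Option (Fin (4 + l)))
    obtain ⟨Θ, hΘ, HΘ⟩ := exists_act_eq n Unit (Fin (4 + l))
    obtain ⟨Ξ, hΞ, HΞ⟩ := (isContr_christoffelVar (n := n)).tmul_left (Fin (4 + l))
    have hK : Schematic (curvCurv l) fun X t y => Φ (X.met t y)⁻¹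
        (tmul (riemannTensor (X.met t) y) (curvField n l X t y)) :=
      (Schematic.curv_mul_curv (n := n) (i := 0) (j := l) (zero_add l)).map hΦ
    have hL : Schematic (curvCurv (l + 1)) fun X t y => Ψ (X.met t y)⁻¹
        (tmul (riemannTensor (X.met t) y) (cov (X.met t) (curvField n l X t) y)) :=
      (((Schematic.curv_mul_curv (n := n) (i := 0) (j := l + 1) (zero_add _)).reindex
        ((Equiv.refl _).sumCongr (finSuccEquiv (4 + l)))).map hΨ).congr fun X t _ y _ => by
          rw [cov_curvField]; rfl
    have hA : Schematic (errorTypes (l + 1)) fun X t y => act (X.met t y)⁻¹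
        (christoffelVar (cov (X.met t) (metricVar n X t) y)) (curvField n l X t y) :=
      (((schematic_cov_metricVar_mul_curv n l).map hΞ).map hΘ).congr fun X t _ y _ => by
        rw [HΘ, HΞ]
    have hsub : curvCurv (l + 1) ⊆ errorTypes (l + 1) := fun x hx => .inl (.inl hx)
    refine ⟨_, ((((hL.mono hsub).reindex (optionRotate _)).ctr.add
      ((hK.cov_curvCurv.mono hsub).reindex (optionSwap _).optionCongr).ctr).add
      (hE.cov_errorTypes.add ((hA.reindex (unitSumEquiv _)).smul (-1)))).reindex
      (finSuccEquiv (4 + l)).symm, fun X => ?_⟩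
    have key := (X.isFamily.hasTDeriv_cov (hasVar_metricVar X) (ih X)).reindex
      (finSuccEquiv (4 + l)).symm
    refine key.congr_deriv fun t ht y hy => ?_
    have hg := X.isMetricOn ht
    have hT := curvField_smooth X l ht
    have e : curvField n (l + 1) X t
        = fun z => reindex (finSuccEquiv (4 + l)).symm (cov (X.met t) (curvField n l X t) z) := rfl
    rw [e, ctr_cov_cov_reindex, cov_add hg.isOpen (((hT.cov hg).cov hg).isContr hg IsContr.id.ctr)
      (hE.smooth X ht) hy, cov_laplacian hg hT hy (hK.smooth X ht)
      (fun z hz => HΦ _ _ _ hg hT z hz) (HΨ _ _ _ hg (hT.cov hg) y hy)]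
    funext I
    simp only [reindex, Pi.add_apply]
    ring

/-! Derivatives of inner products. -/

section pairing

variable {n : ℕ} {ι κ : Type} [Fintype ι] [Fintype κ] [DecidableEq ι] [DecidableEq κ]

/-- The derivation action `∑_s P^m_{I_s} A_{... m ...}` of a matrix on an array. -/
def endoAct (P : Matrix (Fin n) (Fin n) ℝ) (A : Arr n ι) : Arr n ι :=
  fun I => ∑ s, ∑ m, P m (I s) * A (Function.update I s m)

/-- Exchanging m with the value in slot s is an involution on pairs (I, m). It transfers an
endomorphism from a slot of the array to the corresponding factor of the metric. -/
theorem sum_update_swap (s : ι) (F : (ι → Fin n) → Fin n → ℝ) :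
    ∑ I, ∑ m, F I m = ∑ I : ι → Fin n, ∑ m, F (Function.update I s m) (I s) := by
  rw [← Fintype.sum_prod_type', ← Fintype.sum_prod_type']
  refine (Equiv.sum_comp (Function.Involutive.toPerm
    (fun x : (ι → Fin n) × Fin n => (Function.update x.1 s x.2, x.1 s)) fun x => ?_)
    fun x => F x.1 x.2).symm
  simp

theorem pairing_endoAct_left (gi P : Matrix (Fin n) (Fin n) ℝ) (A B : Arr n ι) :
    pairing gi (endoAct P A) B = ∑ I : ι → Fin n, ∑ J : ι → Fin n,
      (∑ s, (∏ r ∈ Finset.univ.erase s, gi (I r) (J r)) * ∑ m, P (I s) m * gi m (J s))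
        * A I * B J := by
  have h : ∀ J : ι → Fin n, ∀ s : ι, ∑ I : ι → Fin n, ∑ m,
        (∏ r, gi (I r) (J r)) * (P m (I s) * A (Function.update I s m)) * B J
      = ∑ I : ι → Fin n, ∑ m, (∏ r ∈ Finset.univ.erase s, gi (I r) (J r))
        * (P (I s) m * gi m (J s)) * A I * B J := by
    intro J s
    rw [sum_update_swap s fun I m => (∏ r ∈ Finset.univ.erase s, gi (I r) (J r))
        * (P (I s) m * gi m (J s)) * A I * B J]
    refine Finset.sum_congr rfl fun I _ => Finset.sum_congr rfl fun m _ => ?_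
    have e : ∏ r ∈ Finset.univ.erase s, gi (Function.update I s m r) (J r)
        = ∏ r ∈ Finset.univ.erase s, gi (I r) (J r) :=
      Finset.prod_congr rfl fun r hr => by rw [Function.update_of_ne (Finset.ne_of_mem_erase hr)]
    rw [e, Function.update_self, ← Finset.mul_prod_erase Finset.univ _ (Finset.mem_univ s)]
    ring
  simp only [pairing, endoAct, Finset.mul_sum, Finset.sum_mul, ← mul_assoc] at h ⊢
  rw [Finset.sum_comm]
  conv_rhs => rw [Finset.sum_comm]
  refine Finset.sum_congr rfl fun J _ => ?_
  rw [Finset.sum_comm]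
  conv_rhs => rw [Finset.sum_comm]
  exact Finset.sum_congr rfl fun s _ => h J s

theorem pairing_transpose (gi : Matrix (Fin n) (Fin n) ℝ) (A B : Arr n ι) :
    pairing gi A B = pairing gi.transpose B A := by
  simp only [pairing, Matrix.transpose_apply]
  rw [Finset.sum_comm]
  exact Finset.sum_congr rfl fun I _ => Finset.sum_congr rfl fun J _ => by ring

theorem pairing_endoAct_right (gi P : Matrix (Fin n) (Fin n) ℝ) (A B : Arr n ι) :
    pairing gi A (endoAct P B) = ∑ I : ι → Fin n, ∑ J : ι → Fin n,
      (∑ s, (∏ r ∈ Finset.univ.erase s, gi (I r) (J r)) * ∑ m, gi (I s) m * P (J s) m)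
        * A I * B J := by
  rw [pairing_transpose, pairing_endoAct_left, Finset.sum_comm]
  refine Finset.sum_congr rfl fun I _ => Finset.sum_congr rfl fun J _ => ?_
  simp only [Matrix.transpose_apply, mul_comm (P _ _)]
  ring

theorem pairing_add_right (gi : Matrix (Fin n) (Fin n) ℝ) (A B B' : Arr n ι) :
    pairing gi A (B + B') = pairing gi A B + pairing gi A B' := by
  rw [pairing_transpose, pairing_add_left, ← pairing_transpose, ← pairing_transpose]

theorem pairing_smul_right (gi : Matrix (Fin n) (Fin n) ℝ) (c : ℝ) (A B : Arr n ι) :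
    pairing gi A (c • B) = c * pairing gi A B := by
  rw [pairing_transpose, pairing_smul_left, ← pairing_transpose]

theorem pairing_sum_left {α : Type*} (gi : Matrix (Fin n) (Fin n) ℝ) (s : Finset α)
    (A : α → Arr n ι) (B : Arr n ι) :
    pairing gi (∑ a ∈ s, A a) B = ∑ a ∈ s, pairing gi (A a) B := by
  classical
  induction s using Finset.induction_on with
  | empty => simp [pairing]
  | insert a s ha ih => rw [Finset.sum_insert ha, Finset.sum_insert ha, pairing_add_left, ih]

theorem pairing_reindex (gi : Matrix (Fin n) (Fin n) ℝ) (e : ι ≃ κ) (A B : Arr n ι) :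
    pairing gi (reindex e A) (reindex e B) = pairing gi A B := by
  simp only [pairing, reindex]
  rw [← (Equiv.arrowCongr e (Equiv.refl (Fin n))).sum_comp]
  refine Finset.sum_congr rfl fun I _ => ?_
  rw [← (Equiv.arrowCongr e (Equiv.refl (Fin n))).sum_comp]
  refine Finset.sum_congr rfl fun J _ => ?_
  rw [← e.prod_comp]
  simp [Equiv.arrowCongr, Function.comp_def]

theorem pairing_option (gi : Matrix (Fin n) (Fin n) ℝ) (A B : Arr n (Option ι)) :
    pairing gi A B = ∑ a, ∑ b, gi a b
      * pairing gi (fun I => A (icons a I)) (fun J => B (icons b J)) := by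
  simp only [pairing, sum_option_arrow, Fintype.prod_option, icons_none, icons_some,
    Finset.mul_sum]
  refine Finset.sum_congr rfl fun a _ => ?_
  rw [Finset.sum_comm]
  exact Finset.sum_congr rfl fun b _ => Finset.sum_congr rfl fun I _ =>
    Finset.sum_congr rfl fun J _ => by ring

/-- The derivative of an inner product, for a connection that is compatible with the metric. -/
theorem hasDerivWithinAt_pairing {S : Set ℝ} {t : ℝ} {gi : ℝ → Matrix (Fin n) (Fin n) ℝ}
    {P : Matrix (Fin n) (Fin n) ℝ} {A B : ℝ → Arr n ι} {A' B' : Arr n ι}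
    (hgi : ∀ a b, HasDerivWithinAt (fun s => gi s a b)
      (-∑ m, (gi t a m * P b m + P a m * gi t m b)) S t)
    (hA : ∀ I, HasDerivWithinAt (fun s => A s I) (A' I) S t)
    (hB : ∀ I, HasDerivWithinAt (fun s => B s I) (B' I) S t) :
    HasDerivWithinAt (fun s => pairing (gi s) (A s) (B s))
      (pairing (gi t) (A' + (-1 : ℝ) • endoAct P (A t)) (B t)
        + pairing (gi t) (A t) (B' + (-1 : ℝ) • endoAct P (B t))) S t := by
  have key := HasDerivWithinAt.fun_sum fun I (_ : I ∈ (Finset.univ : Finset (ι → Fin n))) =>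
    HasDerivWithinAt.fun_sum fun J (_ : J ∈ (Finset.univ : Finset (ι → Fin n))) =>
      ((HasDerivWithinAt.fun_finsetProd fun s (_ : s ∈ (Finset.univ : Finset ι)) =>
        hgi (I s) (J s)).mul (hA I)).mul (hB J)
  refine key.congr_deriv ?_
  -- Once moved onto the metric factors, the two `endoAct` terms are exactly the product rule for ∏
  -- g^{ab}.
  rw [pairing_add_left, pairing_add_right, pairing_smul_left, pairing_smul_right,
    pairing_endoAct_left, pairing_endoAct_right]
  simp only [pairing, Pi.mul_apply, smul_eq_mul, mul_neg, Finset.sum_neg_distrib, mul_add, add_mul,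
    Finset.sum_add_distrib, neg_mul, one_mul, neg_add]
  ring

end pairing

/-! ### The Laplacian of a squared norm. -/

section laplacian

variable {n : ℕ} {ι : Type} [Fintype ι] [DecidableEq ι] {g : MetricField n} {U : Set (Coord n)}
  {y : Coord n}

theorem smooth_pairing (hg : IsMetricOn g U) {A B : Coord n → Arr n ι} (hA : ArrSmoothOn A U)
    (hB : ArrSmoothOn B U) : ContDiffOn ℝ ∞ (fun z => pairing (g z)⁻¹ (A z) (B z)) U :=
  ContDiffOn.sum fun I _ => ContDiffOn.sum fun J _ =>
    ((contDiffOn_prod fun s _ => hg.smooth_inv (I s) (J s)).mul (hA I)).mul (hB J)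

theorem hasDerivAt_line {f : Coord n → ℝ} (hf : DifferentiableAt ℝ f y) (i : Fin n) :
    HasDerivAt (fun s : ℝ => f (y + s • EuclideanSpace.single i (1 : ℝ))) (pderiv i f y) 0 :=
  hf.hasFDerivAt.hasLineDerivAt _

/-- Restriction to a coordinate line reduces this to the one-variable `hasDerivWithinAt_pairing`,
which also yields the time derivative of the norm. -/
theorem pderiv_pairing (hg : IsMetricOn g U) {A B : Coord n → Arr n ι} (hA : ArrSmoothOn A U)
    (hB : ArrSmoothOn B U) (hy : y ∈ U) (i : Fin n) :
    pderiv i (fun z => pairing (g z)⁻¹ (A z) (B z)) y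
      = pairing (g y)⁻¹ (fun I => cov g A y (icons i I)) (B y)
        + pairing (g y)⁻¹ (A y) (fun I => cov g B y (icons i I)) := by
  have h1 := hasDerivAt_line ((smooth_pairing hg hA hB).diffAt hg.isOpen hy) i
  have h0 : y + (0 : ℝ) • EuclideanSpace.single i (1 : ℝ) = y := by simp
  have h2 := hasDerivWithinAt_pairing (S := Set.univ) (t := 0)
    (gi := fun s : ℝ => (g (y + s • EuclideanSpace.single i (1 : ℝ)))⁻¹)
    (P := Matrix.of fun a m => christoffel g a i m y)
    (A := fun s : ℝ => A (y + s • EuclideanSpace.single i (1 : ℝ)))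
    (B := fun s : ℝ => B (y + s • EuclideanSpace.single i (1 : ℝ)))
    (A' := fun I => pderiv i (fun z => A z I) y) (B' := fun I => pderiv i (fun z => B z I) y)
    (fun a b => by
      rw [h0]
      simp only [Matrix.of_apply]
      rw [← hg.pderiv_inv hy]
      exact (hasDerivAt_line ((hg.smooth_inv a b).diffAt hg.isOpen hy) i).hasDerivWithinAt)
    (fun I => (hasDerivAt_line (hA.diffAt hg.isOpen hy I) i).hasDerivWithinAt)
    (fun I => (hasDerivAt_line (hB.diffAt hg.isOpen hy I) i).hasDerivWithinAt)
  rw [hasDerivWithinAt_univ] at h2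
  rw [h1.unique h2, h0]
  have e : ∀ T : Coord n → Arr n ι, (fun I => pderiv i (fun z => T z I) y)
      + (-1 : ℝ) • endoAct (Matrix.of fun a m => christoffel g a i m y) (T y)
      = fun I => cov g T y (icons i I) := by
    intro T
    funext I
    simp only [Pi.add_apply, Pi.smul_apply, smul_eq_mul, endoAct, Matrix.of_apply, cov_icons]
    ring
  rw [e, e]

/-- Freezing the derivative index j drops its Christoffel correction, which reappears here as an
extra term. -/
theorem cov_slice (g : MetricField n) (T : Coord n → Arr n ι) (y : Coord n) (i j : Fin n) :
    (fun I => cov g (fun z I => cov g T z (icons j I)) y (icons i I))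
      = (fun I => cov g (cov g T) y (icons i (icons j I)))
        + ∑ m, christoffel g m i j y • fun I => cov g T y (icons m I) := by
  funext I
  rw [cov_icons]
  simp only [Pi.add_apply, Finset.sum_apply, Pi.smul_apply, smul_eq_mul]
  rw [cov_icons g (cov g T)]
  simp only [Fintype.sum_option, icons_none, icons_some, update_icons_none, update_icons_some]
  ring

theorem scalarLaplacian_eq (g : MetricField n) (f : Coord n → ℝ) (y : Coord n) :
    scalarLaplacian g f y = ∑ i, ∑ j, (g y)⁻¹ i j
      * (pderiv i (pderiv j f) y - ∑ m, christoffel g m i j y * pderiv m f y) := by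
  simp only [scalarLaplacian, tensorLaplacian]
  refine Finset.sum_congr rfl fun i _ => Finset.sum_congr rfl fun j _ => ?_
  congr 1
  have h : ∀ z (J : Fin 1 → Fin n), covDeriv g (fun z (_ : Fin 0 → Fin n) => f z) z J
      = pderiv (J 0) f z := by
    intro z J
    simp [covDeriv]
  rw [covDeriv]
  simp only [h, Fin.sum_univ_succ, Finset.univ_eq_empty, Finset.sum_empty, add_zero]
  rfl

/-- Metric compatibility is used for both derivatives; the correction from `cov_slice` cancels the
Christoffel term in the Hessian of the function. -/
theorem scalarLaplacian_pairing_self (hg : IsMetricOn g U) {T : Coord n → Arr n ι}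
    (hT : ArrSmoothOn T U) (hy : y ∈ U) :
    scalarLaplacian g (fun z => pairing (g z)⁻¹ (T z) (T z)) y
      = 2 * pairing (g y)⁻¹ (ctr (g y)⁻¹ (cov g (cov g T) y)) (T y)
        + 2 * pairing (g y)⁻¹ (cov g T y) (cov g T y) := by
  have hsymm : ∀ z ∈ U, (g z)⁻¹.IsSymm := fun z hz => by
    ext i j; exact hg.inv_symm hz j i
  have hslice : ∀ j, ArrSmoothOn (fun z I => cov g T z (icons j I)) U := fun j I => hT.cov hg _
  have hfirst : ∀ z ∈ U, ∀ j, pderiv j (fun z => pairing (g z)⁻¹ (T z) (T z)) z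
      = 2 * pairing (g z)⁻¹ (fun I => cov g T z (icons j I)) (T z) := fun z hz j => by
    rw [pderiv_pairing hg hT hT hz, pairing_comm (hsymm z hz) (T z)]; ring
  rw [scalarLaplacian_eq]
  have hsecond : ∀ i j, pderiv i (pderiv j fun z => pairing (g z)⁻¹ (T z) (T z)) y
      - ∑ m, christoffel g m i j y * pderiv m (fun z => pairing (g z)⁻¹ (T z) (T z)) y
      = 2 * pairing (g y)⁻¹ (fun I => cov g (cov g T) y (icons i (icons j I))) (T y)
        + 2 * pairing (g y)⁻¹ (fun I => cov g T y (icons i I))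
          (fun I => cov g T y (icons j I)) := by
    intro i j
    rw [pderiv_congr hg.isOpen (fun z hz => hfirst z hz j) hy,
      pderiv_mul (differentiableAt_const _) ((smooth_pairing hg (hslice j) hT).diffAt hg.isOpen hy),
      pderiv_const, pderiv_pairing hg (hslice j) hT hy, cov_slice g T y, pairing_add_left,
      pairing_sum_left, pairing_comm (hsymm y hy) (fun I => cov g T y (icons j I))
        (fun I => cov g T y (icons i I))]
    simp only [hfirst y hy, pairing_smul_left]
    have : ∑ m, christoffel g m i j y * (2 * pairing (g y)⁻¹ (fun I => cov g T y (icons m I)) (T y))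
        = 2 * ∑ m, christoffel g m i j y
          * pairing (g y)⁻¹ (fun I => cov g T y (icons m I)) (T y) := by
      rw [Finset.mul_sum]
      exact Finset.sum_congr rfl fun m _ => by ring
    rw [this]
    ring
  simp only [hsecond]
  have hctr : ctr (g y)⁻¹ (cov g (cov g T) y) = ∑ i, ∑ j, (g y)⁻¹ i j •
      fun I => cov g (cov g T) y (icons i (icons j I)) := by
    funext I
    simp only [ctr, Finset.sum_apply, Pi.smul_apply, smul_eq_mul]
  rw [hctr, pairing_sum_left, pairing_option]
  simp only [pairing_sum_left, pairing_smul_left, Finset.mul_sum, ← Finset.sum_add_distrib]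
  exact Finset.sum_congr rfl fun i _ => Finset.sum_congr rfl fun j _ => by ring

end laplacian

/-! The norm of the derivatives of the curvature tensor. -/

/-- The two slots of a matrix acting on an array. -/
def matrixActEquiv : Fin 2 ≃ Option (Option Empty) :=
  Equiv.ofBijective ![none, some none] (by decide)

theorem exists_evolution_normSq (n l : ℕ) :
    ∃ F : FlowField n (Fin (4 + l)), Schematic (errorTypes l) F ∧
      ∀ X : LocalFlow n, ∀ t ∈ X.time, ∀ y ∈ X.dom,
        HasDerivWithinAt
          (fun s => pairing (X.met s y)⁻¹ (curvField n l X s y) (curvField n l X s y))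
          (scalarLaplacian (X.met t)
              (fun z => pairing (X.met t z)⁻¹ (curvField n l X t z) (curvField n l X t z)) y
            - 2 * pairing (X.met t y)⁻¹ (curvField n (l + 1) X t y) (curvField n (l + 1) X t y)
            + 2 * pairing (X.met t y)⁻¹ (F X t y) (curvField n l X t y)) X.time t := by
  obtain ⟨E, hE, H⟩ := exists_evolution_curvField n l
  obtain ⟨Θ, hΘ, HΘ⟩ := exists_act_eq n Empty (Fin (4 + l))
  have hA : Schematic (errorTypes l) fun X t y =>
      act (X.met t y)⁻¹ (reindex matrixActEquiv (metricVar n X t y)) (curvField n l X t y) :=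
    (((schematic_metricVar_mul_curv n l).reindex
      (matrixActEquiv.sumCongr (Equiv.refl _))).map hΘ).congr fun X t _ y _ => by
        rw [HΘ]; rfl
  -- The coefficient -1/2 combines P = g^{-1}v/2 with the minus sign in `hasDerivWithinAt_pairing`.
  refine ⟨_, hE.add ((hA.reindex (Equiv.emptySum Empty _)).smul (-(1 / 2))),
    fun X t ht y hy => ?_⟩
  have hg := X.isMetricOn ht
  have hT := curvField_smooth X l ht
  have key := hasDerivWithinAt_pairing
    (P := Matrix.of fun a m => 1 / 2 * ∑ c, (X.met t y)⁻¹ a c * metricVar n X t y ![c, m])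
    (X.isFamily.hasDeriv_inv (hasVar_metricVar X) ht hy) ((H X).deriv t ht y hy)
    ((H X).deriv t ht y hy)
  refine key.congr_deriv ?_
  have hact : endoAct (Matrix.of fun a m => 1 / 2 * ∑ c, (X.met t y)⁻¹ a c
      * metricVar n X t y ![c, m]) (curvField n l X t y)
      = (1 / 2 : ℝ) • reindex (Equiv.emptySum Empty _) (act (X.met t y)⁻¹
        (reindex matrixActEquiv (metricVar n X t y)) (curvField n l X t y)) := by
    funext I
    have h1 : ∀ (c d : Fin n) (K : Empty → Fin n),
        icons c (icons d K) ∘ matrixActEquiv = ![c, d] := by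
      intro c d K; funext s; fin_cases s <;> rfl
    have h2 : (I ∘ Equiv.emptySum Empty (Fin (4 + l))) ∘ Sum.inr = I := rfl
    simp only [endoAct, Pi.smul_apply, smul_eq_mul, reindex, act, h1, h2, Finset.mul_sum,
      Finset.sum_mul, Matrix.of_apply, mul_assoc]
    rfl
  have hs : (X.met t y)⁻¹.IsSymm := by ext i j; exact hg.inv_symm hy j i
  rw [scalarLaplacian_pairing_self hg hT hy, cov_curvField, pairing_reindex, hact]
  rw [pairing_comm hs (curvField n l X t y)]
  simp only [pairing_add_left, pairing_smul_left]
  ring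

/-! Universal coefficients. -/

/-- The finite set of the types of the error terms in the evolution of `∇^l Rm`. -/
def errorFinset (l : ℕ) : Finset ProdType :=
  (Finset.HasAntidiagonal.antidiagonal l).disjSum
    (((Finset.HasAntidiagonal.antidiagonal l).sigma
        fun p => Finset.HasAntidiagonal.antidiagonal p.2).disjSum
      (Finset.HasAntidiagonal.antidiagonal (l + 2)))

theorem errorTypes_subset (l : ℕ) : errorTypes l ⊆ ↑(errorFinset l) := by
  rintro s ((⟨i, j, h, rfl⟩ | ⟨i, j, k, h, rfl⟩) | ⟨i, j, h, rfl⟩)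
  · simp [errorFinset, h]
  · simp [errorFinset, ← h, add_assoc]
  · simp [errorFinset, h]

namespace Schematic

variable {n : ℕ} {κ : Type} {S : Set ProdType} {F : FlowField n κ} {l : ℕ}

/-- Collects the summands by product type, leaving one universal operator per type. -/
theorem exists_operators (hF : Schematic S F) {W : Finset ProdType} (hW : S ⊆ ↑W) :
    ∃ Φ : (s : ProdType) → MOp n s.Slots κ, (∀ s, IsContr (Φ s)) ∧
      ∀ X : LocalFlow n, ∀ t ∈ X.time, ∀ y ∈ X.dom,
        F X t y = ∑ s ∈ W, Φ s (X.met t y)⁻¹ (prodField n s X t y) := by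
  classical
  induction hF with
  | of s hs h =>
    rename_i Φ
    refine ⟨Function.update (fun _ _ _ => 0) s Φ, fun r => ?_, fun X t ht y hy => ?_⟩
    · by_cases hr : r = s
      · subst hr; rwa [Function.update_self]
      · rw [Function.update_of_ne hr]; exact .zero
    · rw [Finset.sum_eq_single s]
      · rw [Function.update_self]
      · intro r _ hr; rw [Function.update_of_ne hr]
      · exact fun h => absurd (hW hs) h
  | zero => exact ⟨fun _ _ _ => 0, fun _ => .zero, fun X t ht y hy => by simp⟩
  | add _ _ ih₁ ih₂ =>
    obtain ⟨Φ₁, h₁, H₁⟩ := ih₁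
    obtain ⟨Φ₂, h₂, H₂⟩ := ih₂
    exact ⟨_, fun s => (h₁ s).add (h₂ s), fun X t ht y hy =>
      (congrArg₂ (· + ·) (H₁ X t ht y hy) (H₂ X t ht y hy)).trans
        Finset.sum_add_distrib.symm⟩
  | congr _ e ih =>
    obtain ⟨Φ, h, H⟩ := ih
    exact ⟨Φ, h, fun X t ht y hy => by rw [e X t ht y hy, H X t ht y hy]⟩

theorem exists_coefficients {F : FlowField n (Fin (4 + l))} (hF : Schematic (errorTypes l) F) :
    ∃ (a : (i j : ℕ) → Pattern ((4 + i) + (4 + j)) (4 + l) 2 → ℝ)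
      (b : (i j k : ℕ) → Pattern (((3 + i) + (3 + j)) + (4 + k)) (4 + l) 3 → ℝ)
      (c : (i j : ℕ) → Pattern ((3 + i) + (3 + j)) (4 + l) 2 → ℝ),
      ∀ X : LocalFlow n, ∀ t ∈ X.time, ∀ y ∈ X.dom, F X t y =
        (∑ p ∈ Finset.HasAntidiagonal.antidiagonal l,
          contractComb (X.met t y)⁻¹ (a p.1 p.2)
            (tensorMul (curvField n p.1 X t y) (curvField n p.2 X t y)))
        + (∑ p ∈ Finset.HasAntidiagonal.antidiagonal l,
            ∑ q ∈ Finset.HasAntidiagonal.antidiagonal p.2,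
              contractComb (X.met t y)⁻¹ (b p.1 q.1 q.2)
                (tensorMul (tensorMul (formField n p.1 X t y) (formField n q.1 X t y))
                  (curvField n q.2 X t y)))
        + ∑ p ∈ Finset.HasAntidiagonal.antidiagonal (l + 2),
            contractComb (X.met t y)⁻¹ (c p.1 p.2)
              (tensorMul (formField n p.1 X t y) (formField n p.2 X t y)) := by
  obtain ⟨Φ, hΦ, H⟩ := hF.exists_operators (errorTypes_subset l)
  have ha : ∀ i j, ∃ a : Pattern ((4 + i) + (4 + j)) (4 + l) 2 → ℝ, i + j = l →
      ∀ gi (A : Comp n (4 + i)) (B : Comp n (4 + j)),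
        Φ (.inl (i, j)) gi (tmul A B) = contractComb gi a (tensorMul A B) := by
    intro i j
    by_cases h : i + j = l
    · obtain ⟨a, ha⟩ := ((hΦ (.inl (i, j))).comp
        (IsContr.id.reindex finSumFinEquiv.symm)).eq_contractComb
        (show (4 + i) + (4 + j) = 4 + l + 2 * 2 by omega)
      refine ⟨a, fun _ gi A B => ?_⟩
      rw [← ha]
      congr 1
      funext I
      simp [tmul, tensorMul, _root_.reindex, Function.comp_def]
    -- Off the antidiagonal the value is arbitrary; such coefficients never enter the sums.
    · exact ⟨0, fun h' => absurd h' h⟩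
  have hb : ∀ i j k, ∃ b : Pattern (((3 + i) + (3 + j)) + (4 + k)) (4 + l) 3 → ℝ,
      i + j + k = l → ∀ gi (A : Comp n (3 + i)) (B : Comp n (3 + j)) (D : Comp n (4 + k)),
        Φ (.inr (.inl ⟨(i, j + k), (j, k)⟩)) gi (tmul (tmul A B) D)
          = contractComb gi b (tensorMul (tensorMul A B) D) := by
    intro i j k
    by_cases h : i + j + k = l
    · obtain ⟨b, hb⟩ := ((hΦ (.inr (.inl ⟨(i, j + k), (j, k)⟩))).comp
        (IsContr.id.reindex ((finSumFinEquiv.symm).trans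
          (finSumFinEquiv.symm.sumCongr (Equiv.refl _))))).eq_contractComb
        (show ((3 + i) + (3 + j)) + (4 + k) = 4 + l + 2 * 3 by omega)
      refine ⟨b, fun _ gi A B D => ?_⟩
      rw [← hb]
      congr 1
      funext I
      simp [tmul, tensorMul, _root_.reindex, Function.comp_def]
    · exact ⟨0, fun h' => absurd h' h⟩
  have hc : ∀ i j, ∃ c : Pattern ((3 + i) + (3 + j)) (4 + l) 2 → ℝ, i + j = l + 2 →
      ∀ gi (A : Comp n (3 + i)) (B : Comp n (3 + j)),
        Φ (.inr (.inr (i, j))) gi (tmul A B) = contractComb gi c (tensorMul A B) := by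
    intro i j
    by_cases h : i + j = l + 2
    · obtain ⟨c, hc⟩ := ((hΦ (.inr (.inr (i, j)))).comp
        (IsContr.id.reindex finSumFinEquiv.symm)).eq_contractComb
        (show (3 + i) + (3 + j) = 4 + l + 2 * 2 by omega)
      refine ⟨c, fun _ gi A B => ?_⟩
      rw [← hc]
      congr 1
      funext I
      simp [tmul, tensorMul, _root_.reindex, Function.comp_def]
    · exact ⟨0, fun h' => absurd h' h⟩
  choose a ha using ha
  choose b hb using hb
  choose c hc using hc
  refine ⟨a, b, c, fun X t ht y hy => ?_⟩
  rw [H X t ht y hy, errorFinset, Finset.sum_disjSum, Finset.sum_disjSum, Finset.sum_sigma,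
    add_assoc]
  congr 1
  · exact Finset.sum_congr rfl fun p hp =>
      ha p.1 p.2 (Finset.HasAntidiagonal.mem_antidiagonal.1 hp) _ _ _
  congr 1
  · refine Finset.sum_congr rfl fun p hp => Finset.sum_congr rfl fun q hq => ?_
    have hp' := Finset.HasAntidiagonal.mem_antidiagonal.1 hp
    have hq' := Finset.HasAntidiagonal.mem_antidiagonal.1 hq
    obtain ⟨p₁, p₂⟩ := p
    obtain ⟨q₁, q₂⟩ := q
    obtain rfl : q₁ + q₂ = p₂ := hq'
    exact hb p₁ q₁ q₂ (by simpa [add_assoc] using hp') _ _ _ _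
  · exact Finset.sum_congr rfl fun p hp =>
      hc p.1 p.2 (Finset.HasAntidiagonal.mem_antidiagonal.1 hp) _ _ _

theorem exists_bound [Fintype κ] [DecidableEq κ] (hF : Schematic (errorTypes l) F) :
    ∃ C : ℝ, 0 ≤ C ∧ ∀ X : LocalFlow n, ∀ t ∈ X.time, ∀ y ∈ X.dom,
      arrNorm (X.met t y)⁻¹ (F X t y) ≤ C *
        ((∑ p ∈ Finset.HasAntidiagonal.antidiagonal l,
            arrNorm (X.met t y)⁻¹ (curvField n p.1 X t y)
              * arrNorm (X.met t y)⁻¹ (curvField n p.2 X t y))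
          + (∑ p ∈ Finset.HasAntidiagonal.antidiagonal l,
              ∑ q ∈ Finset.HasAntidiagonal.antidiagonal p.2,
                arrNorm (X.met t y)⁻¹ (formField n p.1 X t y)
                  * arrNorm (X.met t y)⁻¹ (formField n q.1 X t y)
                  * arrNorm (X.met t y)⁻¹ (curvField n q.2 X t y))
          + ∑ p ∈ Finset.HasAntidiagonal.antidiagonal (l + 2),
              arrNorm (X.met t y)⁻¹ (formField n p.1 X t y)
                * arrNorm (X.met t y)⁻¹ (formField n p.2 X t y)) := by
  suffices h : ∃ C : ℝ, 0 ≤ C ∧ ∀ X : LocalFlow n, ∀ t ∈ X.time, ∀ y ∈ X.dom,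
      arrNorm (X.met t y)⁻¹ (F X t y)
        ≤ C * ∑ s ∈ errorFinset l, arrNorm (X.met t y)⁻¹ (prodField n s X t y) by
    obtain ⟨C, hC, h⟩ := h
    refine ⟨C, hC, fun X t ht y hy => (h X t ht y hy).trans (le_of_eq ?_)⟩
    have hgi := (X.isMetricOn ht).inv_posDef hy
    rw [errorFinset, Finset.sum_disjSum, Finset.sum_disjSum, Finset.sum_sigma, add_assoc]
    congr 2
    · exact Finset.sum_congr rfl fun p _ => arrNorm_tmul hgi _ _
    congr 1
    · exact Finset.sum_congr rfl fun p _ => Finset.sum_congr rfl fun q _ =>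
        (arrNorm_tmul hgi _ _).trans (by rw [arrNorm_tmul hgi])
    · exact Finset.sum_congr rfl fun p _ => arrNorm_tmul hgi _ _
  have hsub := errorTypes_subset l
  -- The set of types must be a variable for the induction on `hF`; only its inclusion in the finite
  -- set W matters.
  generalize errorTypes l = S at hF hsub
  generalize errorFinset l = W at hsub
  have hpos : ∀ (X : LocalFlow n) (t : ℝ) (y : Coord n),
      0 ≤ ∑ s ∈ W, arrNorm (X.met t y)⁻¹ (prodField n s X t y) := fun X t y =>
    Finset.sum_nonneg fun _ _ => arrNorm_nonneg _
  induction hF with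
  | of s hs h =>
    obtain ⟨C, hC, H⟩ := h.exists_bound
    refine ⟨C, hC, fun X t ht y hy => (H _ ((X.isMetricOn ht).inv_posDef hy) _).trans ?_⟩
    exact mul_le_mul_of_nonneg_left (Finset.single_le_sum
      (f := fun s => arrNorm (X.met t y)⁻¹ (prodField n s X t y))
      (fun _ _ => arrNorm_nonneg _) (hsub hs)) hC
  | zero => exact ⟨0, le_rfl, fun X t ht y hy => by rw [arrNorm_zero, zero_mul]⟩
  | add _ _ ih₁ ih₂ =>
    obtain ⟨C₁, hC₁, H₁⟩ := ih₁
    obtain ⟨C₂, hC₂, H₂⟩ := ih₂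
    refine ⟨C₁ + C₂, add_nonneg hC₁ hC₂, fun X t ht y hy =>
      (arrNorm_add_le ((X.isMetricOn ht).inv_posDef hy) _ _).trans ?_⟩
    rw [add_mul]
    exact add_le_add (H₁ X t ht y hy) (H₂ X t ht y hy)
  | congr _ e ih =>
    obtain ⟨C, hC, H⟩ := ih
    exact ⟨C, hC, fun X t ht y hy => by rw [e X t ht y hy]; exact H X t ht y hy⟩

end Schematic

/-! From the manifold to coordinate domains. -/

theorem tensorLaplacian_eq {n k : ℕ} (g : MetricField n) (T : CompField n k) (y : Coord n) :
    tensorLaplacian g T y = ctr (g y)⁻¹ (cov g (cov g T) y) := by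
  have h : covDeriv g (covDeriv g T) y = reindex (finSuccEquiv (k + 1)).symm
      (reindex (finSuccEquiv k).symm.optionCongr (cov g (cov g T) y)) := by
    rw [covDeriv_eq_reindex, ← cov_reindex]
    rfl
  funext I
  simp only [tensorLaplacian, ctr, h, reindex]
  refine Finset.sum_congr rfl fun i _ => Finset.sum_congr rfl fun j _ => ?_
  congr 2
  funext o
  rcases o with _ | _ | s <;> rfl

section chart

variable {n : ℕ} {M : Type u} [TopologicalSpace M] [ChartedSpace (Coord n) M]
  {e : OpenPartialHomeomorph M (Coord n)}

theorem mfderiv_symm_injective (he : e ∈ IsManifold.maximalAtlas 𝓘(ℝ, Coord n) ∞ M) {y : Coord n}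
    (hy : y ∈ e.target) :
    Function.Injective (mfderiv 𝓘(ℝ, Coord n) 𝓘(ℝ, Coord n) e.symm y) := by
  have h : e.MDifferentiable 𝓘(ℝ, Coord n) 𝓘(ℝ, Coord n) :=
    ⟨(contMDiffOn_of_mem_maximalAtlas he).mdifferentiableOn (by simp),
      (contMDiffOn_symm_of_mem_maximalAtlas he).mdifferentiableOn (by simp)⟩
  exact h.symm.mfderiv_injective hy

variable [IsManifold 𝓘(ℝ, Coord n) ∞ M]

/-- The differential of the inverse chart is injective, so a nonzero coefficient vector gives a
nonzero tangent vector. -/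
theorem posDef_metricIn (g : SmoothMetric n M)
    (he : e ∈ IsManifold.maximalAtlas 𝓘(ℝ, Coord n) ∞ M) {y : Coord n} (hy : y ∈ e.target) :
    (metricIn g e y).PosDef := by
  rw [Matrix.posDef_iff_dotProduct_mulVec]
  refine ⟨by ext i j; exact g.symm _ _ _, fun {x} hx => ?_⟩
  have hv : mfderiv 𝓘(ℝ, Coord n) 𝓘(ℝ, Coord n) e.symm y (WithLp.toLp 2 x : Coord n) ≠ 0 := by
    intro h
    have := mfderiv_symm_injective he hy (h.trans (map_zero _).symm)
    exact hx (congrArg WithLp.ofLp this)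
  have hsum : mfderiv 𝓘(ℝ, Coord n) 𝓘(ℝ, Coord n) e.symm y (WithLp.toLp 2 x : Coord n)
      = ∑ i, x i • coordVector e y i := by
    have h : (WithLp.toLp 2 x : Coord n) = ∑ i, x i • EuclideanSpace.single i (1 : ℝ) := by
      ext j
      simp [Finset.sum_apply, Pi.single_apply]
    rw [h]
    exact (map_sum (mfderiv 𝓘(ℝ, Coord n) 𝓘(ℝ, Coord n) e.symm y) _ _).trans
      (Finset.sum_congr rfl fun i _ => map_smul _ _ _)
  refine (g.pos _ _ hv).trans_eq ?_
  rw [hsum]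
  simp only [map_sum, map_smul, _root_.sum_apply, _root_.smul_apply,
    smul_eq_mul, dotProduct, Matrix.mulVec, metricIn, Finset.mul_sum, star_trivial,
    Matrix.of_apply]
  rw [Finset.sum_comm]
  exact Finset.sum_congr rfl fun i _ => Finset.sum_congr rfl fun j _ => by ring

/-- The solution in a chart. -/
def IsGRF.localFlow {J : Set ℝ} {g : ℝ → SmoothMetric n M} {H : ℝ → ThreeForm n M}
    (hgH : IsGRF J g H) (hJ : J.OrdConnected) (hJ' : J.Nontrivial)
    (he : e ∈ IsManifold.maximalAtlas 𝓘(ℝ, Coord n) ∞ M) : LocalFlow n where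
  time := J
  dom := e.target
  met s := metricIn (g s) e
  form s := formIn (H s) e
  isFamily :=
    { ordConnected := hJ
      nontrivial := hJ'
      isOpen := e.open_target
      smooth := hgH.smooth_metric e he
      posDef := fun _ _ _ hy => posDef_metricIn _ he hy }
  smooth_form := fun _ ht I =>
    TSmooth.slice (F := fun s y => formIn (H s) e y I) (hgH.smooth_form e he I) ht
  evolve := ⟨fun I => hgH.smooth_metric e he (I 0) (I 1),
    fun t ht y hy I => hgH.evolve_metric e he t ht y hy (I 0) (I 1)⟩

end chart

end

theorem proposition4p1 (n l : ℕ) :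
    -- the universal coefficients of the schematic products, and the universal constant
    ∃ (a : (i j : ℕ) → Pattern ((4 + i) + (4 + j)) (4 + l) 2 → ℝ)
      (b : (i j k : ℕ) → Pattern (((3 + i) + (3 + j)) + (4 + k)) (4 + l) 3 → ℝ)
      (c : (i j : ℕ) → Pattern ((3 + i) + (3 + j)) (4 + l) 2 → ℝ)
      (C : ℝ), 0 < C ∧
      ∀ (M : Type u) [TopologicalSpace M] [T2Space M] [CompactSpace M]
        [ChartedSpace (Coord n) M] [IsManifold 𝓘(ℝ, Coord n) ∞ M]
        (J : Set ℝ) (_ : J.OrdConnected) (_ : J.Nontrivial)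
        (g : ℝ → SmoothMetric n M) (H : ℝ → ThreeForm n M) (_ : IsGRF J g H)
        (e : OpenPartialHomeomorph M (Coord n))
        (_ : e ∈ IsManifold.maximalAtlas 𝓘(ℝ, Coord n) ∞ M)
        (t : ℝ) (_ : t ∈ J) (y : Coord n) (_ : y ∈ e.target),
        let G : ℝ → MetricField n := fun s => metricIn (g s) e
        let gi : Matrix (Fin n) (Fin n) ℝ := (G t y)⁻¹
        -- the evolution equation of `∇^l Rm`
        (∀ I : Fin (4 + l) → Fin n,
          HasDerivWithinAt (fun s => nablaRm (g s) e l y I)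
            (tensorLaplacian (G t) (nablaRm (g t) e l) y I
              + ∑ p ∈ Finset.HasAntidiagonal.antidiagonal l,
                  contractComb gi (a p.1 p.2)
                    (tensorMul (nablaRm (g t) e p.1 y) (nablaRm (g t) e p.2 y)) I
              + ∑ p ∈ Finset.HasAntidiagonal.antidiagonal l, ∑ q ∈ Finset.HasAntidiagonal.antidiagonal p.2,
                  contractComb gi (b p.1 q.1 q.2)
                    (tensorMul (tensorMul (nablaH (g t) (H t) e p.1 y)
                      (nablaH (g t) (H t) e q.1 y)) (nablaRm (g t) e q.2 y)) I
              + ∑ p ∈ Finset.HasAntidiagonal.antidiagonal (l + 2),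
                  contractComb gi (c p.1 p.2)
                    (tensorMul (nablaH (g t) (H t) e p.1 y) (nablaH (g t) (H t) e p.2 y)) I)
            J t) ∧
        -- the evolution inequality of `|∇^l Rm|^2`
        (∃ D : ℝ,
          HasDerivWithinAt (fun s => normSq (G s y)⁻¹ (nablaRm (g s) e l y)) D J t ∧
          D ≤ scalarLaplacian (G t) (fun z => normSq (G t z)⁻¹ (nablaRm (g t) e l z)) y
              - 2 * normSq gi (nablaRm (g t) e (l + 1) y)
              + C * ∑ p ∈ Finset.HasAntidiagonal.antidiagonal l,
                  tensorNorm gi (nablaRm (g t) e p.1 y) * tensorNorm gi (nablaRm (g t) e p.2 y)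
                    * tensorNorm gi (nablaRm (g t) e l y)
              + C * ∑ p ∈ Finset.HasAntidiagonal.antidiagonal l, ∑ q ∈ Finset.HasAntidiagonal.antidiagonal p.2,
                  tensorNorm gi (nablaH (g t) (H t) e p.1 y)
                    * tensorNorm gi (nablaH (g t) (H t) e q.1 y)
                    * tensorNorm gi (nablaRm (g t) e q.2 y)
                    * tensorNorm gi (nablaRm (g t) e l y)
              + C * ∑ p ∈ Finset.HasAntidiagonal.antidiagonal (l + 2),
                  tensorNorm gi (nablaH (g t) (H t) e p.1 y)
                    * tensorNorm gi (nablaH (g t) (H t) e p.2 y)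
                    * tensorNorm gi (nablaRm (g t) e l y)) := by
  obtain ⟨E, hE, HE⟩ := exists_evolution_curvField n l
  obtain ⟨F, hF, HF⟩ := exists_evolution_normSq n l
  obtain ⟨a, b, c, habc⟩ := hE.exists_coefficients
  obtain ⟨C, hC, hbound⟩ := hF.exists_bound
  -- The factor 2 belongs to 2⟨F, ∇^l Rm⟩, and adding 1 makes the constant positive even if C = 0.
  refine ⟨a, b, c, 2 * C + 1, by positivity, ?_⟩
  intro M _ _ _ _ _ J hJ hJ' g H hgH e he t ht y hy
  let X := hgH.localFlow hJ hJ' he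
  refine ⟨fun I => ?_, _, HF X t ht y hy, ?_⟩
  · refine ((HE X).deriv t ht y hy I).congr_deriv ?_
    rw [habc X t ht y hy]
    simp only [Pi.add_apply, Finset.sum_apply, ← add_assoc]
    rw [tensorLaplacian_eq]
    rfl
  · have hgi := (X.isMetricOn ht).inv_posDef hy
    have h1 := pairing_le_arrNorm_mul hgi (F X t y) (curvField n l X t y)
    have h2 := mul_le_mul_of_nonneg_right (hbound X t ht y hy)
      (arrNorm_nonneg (gi := (X.met t y)⁻¹) (curvField n l X t y))
    simp only [mul_add, add_mul, Finset.sum_mul, mul_assoc C] at h2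
    have key : ∀ {x p u v w a b c : ℝ}, p ≤ x → x ≤ C * a + C * b + C * c → 0 ≤ a → 0 ≤ b →
        0 ≤ c → u - v + 2 * p ≤ u - v + (2 * C + 1) * a + (2 * C + 1) * b + (2 * C + 1) * c := by
      intros; linarith
    exact key (w := 0) h1 h2
      (Finset.sum_nonneg fun _ _ => mul_nonneg (mul_nonneg (arrNorm_nonneg _) (arrNorm_nonneg _))
        (arrNorm_nonneg _))
      (Finset.sum_nonneg fun _ _ => Finset.sum_nonneg fun _ _ => mul_nonneg (mul_nonneg
        (mul_nonneg (arrNorm_nonneg _) (arrNorm_nonneg _)) (arrNorm_nonneg _)) (arrNorm_nonneg _))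
      (Finset.sum_nonneg fun _ _ => mul_nonneg (mul_nonneg (arrNorm_nonneg _) (arrNorm_nonneg _))
        (arrNorm_nonneg _))
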